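/- **Conventions.** An SVD of $A\in\mathbb R^{m\times n}$ is $A=U\Sigma V^\top$ with $U\in\mathbb R^{m\times m}$, $V\in\mathbb R^{n\times n}$ orthogonal and $\Sigma\in\mathbb R^{m\times n}$ rectangular diagonal with non-negative, non-increasing diagonal. A rank-$k$ truncated SVD, written $(U_k,\Sigma_k,V_k)=\mathrm{SVD}_k(A)$, consists of the first $k$ columns of $U$ and $V$ and the first $k$ singular values, for some SVD of $A$ ($1\le k\le\min(m,n)$). $\mathrm{nnz}(X)$ is the number of non-zero entries of $X$. Running times are on a real RAM: registers and arrays of natural numbers, arrays of real numbers with computed indices, unit cost for each memory access, comparison and arithmetic operation (including $\sqrt{\cdot}$ on reals), together with a built-in instruction that returns some exact $\mathrm{SVD}_{k}$ of a $p\times q$ matrix in time $O((p+q)^3+1)$. Sparse inputs are given as lists of their non-zero entries in arbitrary order. **Theorem.** There is a data structure that stores, for $k\ge1$, the five factors of $$\widetilde A=U'\,U''\,\Sigma_k\,V''^{\top}V'^{\top},\qquad U'\in\mathbb R^{m\times k},\ V'\in\mathbb R^{n\times k},\ U'',V''\in\mathbb R^{k\times k},$$ explicitly, entry by entry, where $U_k=U'U''$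 and $V_k=V'V''$ have orthonormal columns and $\Sigma_k$ is diagonal with non-negative non-increasing diagonal. It can be initialised with any rank-$k$ truncated SVD of a matrix $A\in\mathbb R^{m\times n}$, with $U''=V''=I$. It maintains an approximate rank-$k$ truncated SVD of $A$: from every stored state, and for every $s\ge 0$, it supports the following operations, by fixed programs and with an absolute constant in all the bounds. The updates always terminate with a correct result stored in the same form; their time bounds hold whenever the update is non-degenerate in the sense below. * **Add rows** $E_r\in\mathbb R^{s\times n}$: $(U_k,\Sigma_k,V_k)\gets\mathrm{SVD}_k\begin{bmatrix}\widetilde A\\E_r\end{bmatrix}$, in time $O(\mathrm{nnz}(E_r)(s+k)^2+(s+k)^3)$. * **Add columns** $E_c\in\mathbb R^{m\times s}$: $(U_k,\Sigma_k,V_k)\gets\mathrm{SVD}_k\begin{bmatrix}\widetilde A&E_c\end{bmatrix}$, in time $O(\mathrm{nnz}(E_c)(s+k)^2+(s+k)^3)$. * **Update weights** $D\in\mathbb R^{m\times s}$, $E_m\in\mathbb R^{n\times s}$: $(U_k,\Sigma_k,V_k)\gets\mathrm{SVD}_k(\widetilde A+DE_m^\top)$, in time $O((\mathrm{nnz}(D)+\mathrm{nnz}(E_m))(s+k)^2+(s+k)^3)$.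 * **Query** $i$: return row $i$ of $U_k$ (or of $V_k$) and $\Sigma_k$, leaving the stored factors unchanged, in time $O(k^2)$. Non-degeneracy: call an old row of $U_k$ untouched if the update does not involve its index, that is, the corresponding row of $E_c$ (when columns are added), respectively of $D$ (in a weight update), is zero; when rows are added, all $m$ old rows of $U_k$ are untouched. For $V_k$ the same holds with the roles exchanged: row $j$ is untouched if column $j$ of $E_r$, respectively row $j$ of $E_m$, is zero, and when columns are added all $n$ old rows of $V_k$ are untouched. The update is non-degenerate if, both for $U_k$ and for $V_k$, the block of untouched rows has the same rank after the update as before it. -/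

import Mathlib

open scoped Matrix

namespace TruncSVD

/-! ### Singular value decompositions -/

/-- The number of non-zero entries of a matrix. -/
noncomputable def nnz {p q : ℕ} (E : Matrix (Fin p) (Fin q) ℝ) : ℕ :=
  Nat.card {x : Fin p × Fin q // E x.1 x.2 ≠ 0}

/-- The `p × q` rectangular diagonal matrix with diagonal `τ 0, τ 1, …`. -/
def rectDiag (p q : ℕ) (τ : ℕ → ℝ) : Matrix (Fin p) (Fin q) ℝ :=
  Matrix.of fun i j => if (i : ℕ) = (j : ℕ) then τ i else 0

/-- `A = U Σ Vᵀ` with `U`, `V` square orthogonal and `Σ` rectangular diagonal with non-negative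
non-increasing diagonal.  (Only the first `min p q` values of `τ` enter.) -/
structure IsSVD {p q : ℕ} (A : Matrix (Fin p) (Fin q) ℝ) (U : Matrix (Fin p) (Fin p) ℝ)
    (τ : ℕ → ℝ) (V : Matrix (Fin q) (Fin q) ℝ) : Prop where
  left_orth : Uᵀ * U = 1
  right_orth : Vᵀ * V = 1
  nonneg : ∀ i, 0 ≤ τ i
  sorted : Antitone τ
  eq : A = U * rectDiag p q τ * Vᵀ

/-- `(U, σ, V)` is a rank-`k` truncated SVD of `A`: the first `k` singular values together with the
first `k` columns of `U` and `V`, for some singular value decomposition of `A`. -/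
def IsTruncSVD {p q : ℕ} (k : ℕ) (A : Matrix (Fin p) (Fin q) ℝ)
    (U : Matrix (Fin p) (Fin k) ℝ) (σ : Fin k → ℝ) (V : Matrix (Fin q) (Fin k) ℝ) : Prop :=
  ∃ (hp : k ≤ p) (hq : k ≤ q) (Ufull : Matrix (Fin p) (Fin p) ℝ) (τ : ℕ → ℝ)
    (Vfull : Matrix (Fin q) (Fin q) ℝ), IsSVD A Ufull τ Vfull ∧
      U = Ufull.submatrix id (Fin.castLE hp) ∧ (∀ j, σ j = τ j) ∧
      V = Vfull.submatrix id (Fin.castLE hq)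

/-- A routine that is asked for a rank-`k` truncated SVD of a `p × q` matrix. -/
structure SVDRoutine where
  left : (p q k : ℕ) → Matrix (Fin p) (Fin q) ℝ → Matrix (Fin p) (Fin k) ℝ
  vals : (p q k : ℕ) → Matrix (Fin p) (Fin q) ℝ → Fin k → ℝ
  right : (p q k : ℕ) → Matrix (Fin p) (Fin q) ℝ → Matrix (Fin q) (Fin k) ℝ

/-- The routine answers every meaningful request by some rank-`k` truncated SVD. -/
def SVDRoutine.Correct (O : SVDRoutine) : Prop :=
  ∀ (p q k : ℕ) (X : Matrix (Fin p) (Fin q) ℝ), k ≤ p → k ≤ q →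
    IsTruncSVD k X (O.left p q k X) (O.vals p q k X) (O.right p q k X)

/-! ### A real random access machine, as a structured programming language

A program is a finite piece of syntax.  It uses registers that hold natural numbers, arrays of
natural numbers, and two-dimensional arrays of real numbers; the names of registers and arrays are
fixed numerals in the program text, array indices are computed.  Every arithmetic operation, every
comparison, every memory access and every branching has cost one.  The exact truncated SVD of a
`p × q` matrix, which is not computable by arithmetic operations and square roots, is a built-in
instruction of cost `(p + q) ^ 3 + 1` (plus the cost of evaluating its size arguments). -/

/-- The memory. -/
structure Mem where
  reg : ℕ → ℕ
  iarr : ℕ → ℕ → ℕ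
  rarr : ℕ → ℕ → ℕ → ℝ

/-- Expressions for natural numbers. -/
inductive IExp where
  | lit (c : ℕ)
  | reg (x : ℕ)
  | arr (a : ℕ) (i : IExp)
  | add (e f : IExp)
  | sub (e f : IExp)

def IExp.eval (M : Mem) : IExp → ℕ
  | lit c => c
  | reg x => M.reg x
  | arr a i => M.iarr a (i.eval M)
  | add e f => e.eval M + f.eval M
  | sub e f => e.eval M - f.eval M

def IExp.cost : IExp → ℕ
  | lit _ => 1
  | reg _ => 1
  | arr _ i => i.cost + 1
  | add e f => e.cost + f.cost + 1
  | sub e f => e.cost + f.cost + 1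

/-- Expressions for real numbers (with the conventions `x / 0 = 0`, and `√x = 0` for `x < 0`). -/
inductive RExp where
  | zero
  | one
  | arr (a : ℕ) (i j : IExp)
  | add (e f : RExp)
  | sub (e f : RExp)
  | mul (e f : RExp)
  | div (e f : RExp)
  | sqrt (e : RExp)

noncomputable def RExp.eval (M : Mem) : RExp → ℝ
  | zero => 0
  | one => 1
  | arr a i j => M.rarr a (i.eval M) (j.eval M)
  | add e f => e.eval M + f.eval M
  | sub e f => e.eval M - f.eval M
  | mul e f => e.eval M * f.eval M
  | div e f => e.eval M / f.eval M
  | sqrt e => Real.sqrt (e.eval M)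

def RExp.cost : RExp → ℕ
  | zero => 1
  | one => 1
  | arr _ i j => i.cost + j.cost + 1
  | add e f => e.cost + f.cost + 1
  | sub e f => e.cost + f.cost + 1
  | mul e f => e.cost + f.cost + 1
  | div e f => e.cost + f.cost + 1
  | sqrt e => e.cost + 1

/-- Tests. -/
inductive BExp where
  | ilt (e f : IExp)
  | ieq (e f : IExp)
  | rlt (e f : RExp)
  | req (e f : RExp)
  | not (b : BExp)
  | and (b c : BExp)

def BExp.Holds (M : Mem) : BExp → Prop
  | ilt e f => e.eval M < f.eval M
  | ieq e f => e.eval M = f.eval M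
  | rlt e f => e.eval M < f.eval M
  | req e f => e.eval M = f.eval M
  | not b => ¬ b.Holds M
  | and b c => b.Holds M ∧ c.Holds M

def BExp.cost : BExp → ℕ
  | ilt e f => e.cost + f.cost + 1
  | ieq e f => e.cost + f.cost + 1
  | rlt e f => e.cost + f.cost + 1
  | req e f => e.cost + f.cost + 1
  | not b => b.cost + 1
  | and b c => b.cost + c.cost + 1

/-- Programs.  `svd p q k src F T G` computes a rank-`k` truncated SVD of the `p × q` matrix in the
real array `src` and stores the left vectors in `F`, the singular values in row `0` of `T` and the
right vectors in `G`. -/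
inductive Prog where
  | skip
  | setReg (x : ℕ) (e : IExp)
  | setInt (a : ℕ) (i : IExp) (e : IExp)
  | setReal (a : ℕ) (i j : IExp) (e : RExp)
  | seq (c d : Prog)
  | cond (b : BExp) (c d : Prog)
  | loop (b : BExp) (c : Prog)
  | svd (p q k : IExp) (src F T G : ℕ)

def Mem.setReg (M : Mem) (x v : ℕ) : Mem :=
  { M with reg := Function.update M.reg x v }

def Mem.setInt (M : Mem) (a i v : ℕ) : Mem :=
  { M with iarr := Function.update M.iarr a (Function.update (M.iarr a) i v) }

noncomputable def Mem.setReal (M : Mem) (a i j : ℕ) (v : ℝ) : Mem :=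
  { M with rarr := Function.update M.rarr a <|
      Function.update (M.rarr a) i <| Function.update (M.rarr a i) j v }

/-- The upper left `p × q` block of the real array `a`. -/
def Mem.block (M : Mem) (a p q : ℕ) : Matrix (Fin p) (Fin q) ℝ :=
  Matrix.of fun i j => M.rarr a i j

/-- Overwrite the upper left `p × q` block of the real array `a`. -/
noncomputable def Mem.setBlock (M : Mem) (a p q : ℕ) (X : Matrix (Fin p) (Fin q) ℝ) : Mem :=
  { M with rarr := Function.update M.rarr a fun i j =>
      if h : i < p ∧ j < q then X ⟨i, h.1⟩ ⟨j, h.2⟩ else M.rarr a i j }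

/-- The effect of the SVD instruction. -/
noncomputable def Mem.runSVD (M : Mem) (O : SVDRoutine) (p q k src F T G : ℕ) : Mem :=
  ((M.setBlock F p k (O.left p q k (M.block src p q))).setBlock T 1 k
    (Matrix.of fun _ j => O.vals p q k (M.block src p q) j)).setBlock G q k
      (O.right p q k (M.block src p q))

/-- `Exec O c M M' t`: started in the memory `M`, the program `c` halts in the memory `M'` after
time `t`.  (The machine is deterministic; it gets stuck on an SVD request with `k > min p q`.) -/
inductive Exec (O : SVDRoutine) : Prog → Mem → Mem → ℕ → Prop where
  | skip (M : Mem) : Exec O .skip M M 1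
  | setReg (M : Mem) (x : ℕ) (e : IExp) :
      Exec O (.setReg x e) M (M.setReg x (e.eval M)) (e.cost + 1)
  | setInt (M : Mem) (a : ℕ) (i e : IExp) :
      Exec O (.setInt a i e) M (M.setInt a (i.eval M) (e.eval M)) (i.cost + e.cost + 1)
  | setReal (M : Mem) (a : ℕ) (i j : IExp) (e : RExp) :
      Exec O (.setReal a i j e) M (M.setReal a (i.eval M) (j.eval M) (e.eval M))
        (i.cost + j.cost + e.cost + 1)
  | seq {c d : Prog} {M M' M'' : Mem} {t t' : ℕ} :
      Exec O c M M' t → Exec O d M' M'' t' → Exec O (.seq c d) M M'' (t + t')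
  | cond_true {b : BExp} {c d : Prog} {M M' : Mem} {t : ℕ} :
      b.Holds M → Exec O c M M' t → Exec O (.cond b c d) M M' (b.cost + t + 1)
  | cond_false {b : BExp} {c d : Prog} {M M' : Mem} {t : ℕ} :
      ¬ b.Holds M → Exec O d M M' t → Exec O (.cond b c d) M M' (b.cost + t + 1)
  | loop_true {b : BExp} {c : Prog} {M M' M'' : Mem} {t t' : ℕ} :
      b.Holds M → Exec O c M M' t → Exec O (.loop b c) M' M'' t' →
        Exec O (.loop b c) M M'' (b.cost + t + t' + 1)
  | loop_false {b : BExp} {c : Prog} {M : Mem} :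
      ¬ b.Holds M → Exec O (.loop b c) M M (b.cost + 1)
  | svd (M : Mem) (p q k : IExp) (src F T G : ℕ) :
      k.eval M ≤ p.eval M → k.eval M ≤ q.eval M →
        Exec O (.svd p q k src F T G) M
          (M.runSVD O (p.eval M) (q.eval M) (k.eval M) src F T G)
          ((p.eval M + q.eval M) ^ 3 + p.cost + q.cost + k.cost + 1)

/-! ### The extended decomposition and its layout in memory -/

/-- The five factors `U' U'' Σ V''ᵀ V'ᵀ`, with `U' U''` and `V' V''` having orthonormal columns and
`Σ = diag σ` non-negative and non-increasing. -/
structure FiveFactor (m n k : ℕ) where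
  U₁ : Matrix (Fin m) (Fin k) ℝ
  U₂ : Matrix (Fin k) (Fin k) ℝ
  σ : Fin k → ℝ
  V₁ : Matrix (Fin n) (Fin k) ℝ
  V₂ : Matrix (Fin k) (Fin k) ℝ
  left_orth : (U₁ * U₂)ᵀ * (U₁ * U₂) = 1
  right_orth : (V₁ * V₂)ᵀ * (V₁ * V₂) = 1
  nonneg : ∀ j, 0 ≤ σ j
  sorted : Antitone σ

namespace FiveFactor

variable {m n k : ℕ}

/-- The left singular vectors `U_k = U' U''`. -/
def U (S : FiveFactor m n k) : Matrix (Fin m) (Fin k) ℝ := S.U₁ * S.U₂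

/-- The right singular vectors `V_k = V' V''`. -/
def V (S : FiveFactor m n k) : Matrix (Fin n) (Fin k) ℝ := S.V₁ * S.V₂

/-- The represented matrix `Ã = U_k Σ_k V_kᵀ`. -/
def approx (S : FiveFactor m n k) : Matrix (Fin m) (Fin n) ℝ :=
  S.U * Matrix.diagonal S.σ * S.Vᵀ

end FiveFactor

/-- The five factors are stored in the real arrays `0, …, 4` (`Σ` as row `0` of array `2`), and the
registers `0, 1, 2` hold the dimensions `m, n, k`.  All other memory is arbitrary. -/
structure Stores {m n k : ℕ} (M : Mem) (S : FiveFactor m n k) : Prop where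
  rows : M.reg 0 = m
  cols : M.reg 1 = n
  rank : M.reg 2 = k
  U₁ : M.block 0 m k = S.U₁
  U₂ : M.block 1 k k = S.U₂
  σ : M.rarr 2 0 ∘ Fin.val = S.σ
  V₁ : M.block 3 n k = S.V₁
  V₂ : M.block 4 k k = S.V₂

/-- The sparse matrix `E` is given in coordinate format, i.e. as a list, in an arbitrary order, of
its non-zero entries: register `len` holds the length of the list, the integer arrays `row` and
`col` hold the positions of the entries and row `0` of the real array `val` their values. -/
def GivenSparse {p q : ℕ} (M : Mem) (len row col val : ℕ) (E : Matrix (Fin p) (Fin q) ℝ) : Prop :=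
  ∃ e : Fin (M.reg len) ≃ {x : Fin p × Fin q // E x.1 x.2 ≠ 0}, ∀ t : Fin (M.reg len),
    M.iarr row t = (e t).1.1 ∧ M.iarr col t = (e t).1.2 ∧
      M.rarr val 0 t = E (e t).1.1 (e t).1.2

/-- Inputs of an update with one sparse matrix: `s` in register `3`, the matrix in the integer
arrays `0, 1` and the real array `5`, its number of entries in register `4`. -/
def Input₁ {p q : ℕ} (M : Mem) (s : ℕ) (E : Matrix (Fin p) (Fin q) ℝ) : Prop :=
  M.reg 3 = s ∧ GivenSparse M 4 0 1 5 E

/-- Inputs of an update with two sparse matrices: the second one is in the integer arrays `2, 3` and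
the real array `6`, its number of entries in register `5`. -/
def Input₂ {p q p' q' : ℕ} (M : Mem) (s : ℕ) (D : Matrix (Fin p) (Fin q) ℝ)
    (E : Matrix (Fin p') (Fin q') ℝ) : Prop :=
  Input₁ M s D ∧ GivenSparse M 5 2 3 6 E

/-- Output of a query: the requested row in row `0` of the real array `7`, and the singular values
in row `0` of the real array `8`. -/
def Output {k : ℕ} (M : Mem) (r σ : Fin k → ℝ) : Prop :=
  (∀ j : Fin k, M.rarr 7 0 j = r j) ∧ ∀ j : Fin k, M.rarr 8 0 j = σ j

/-! ### Updates -/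

/-- `[A; E]`, the rows of `E` appended below `A`. -/
def appendRows {m n s : ℕ} (A : Matrix (Fin m) (Fin n) ℝ) (E : Matrix (Fin s) (Fin n) ℝ) :
    Matrix (Fin (m + s)) (Fin n) ℝ :=
  Matrix.of (Fin.append A E)

/-- `[A  E]`, the columns of `E` appended to the right of `A`. -/
def appendCols {m n s : ℕ} (A : Matrix (Fin m) (Fin n) ℝ) (E : Matrix (Fin m) (Fin s) ℝ) :
    Matrix (Fin m) (Fin (n + s)) ℝ :=
  Matrix.of fun i => Fin.append (A i) (E i)

/-- Passing from the singular vectors `X` to `Y` does not lower the rank of the block of rows in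
`J`.  With `J` the rows that an update does not touch, this is what allows the update to multiply
the `k × k` factor by an invertible matrix while leaving the rows in `J` of the tall factor as they
are. -/
def SameRankOn {p k : ℕ} (J : Set (Fin p)) (X Y : Matrix (Fin p) (Fin k) ℝ) : Prop :=
  (Y.submatrix (Subtype.val : J → Fin p) id).rank = (X.submatrix (Subtype.val : J → Fin p) id).rank

/-- The indices of the zero rows of a matrix. -/
def zeroRows {p q : ℕ} (E : Matrix (Fin p) (Fin q) ℝ) : Set (Fin p) := {i | ∀ j, E i j = 0}

/-- The first `p` rows of a matrix with `p + s` rows. -/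
def topRows {p s k : ℕ} (X : Matrix (Fin (p + s)) (Fin k) ℝ) : Matrix (Fin p) (Fin k) ℝ :=
  X.submatrix (Fin.castAdd s) id

end TruncSVD

open TruncSVD

namespace TruncSVD

/-! ### Evaluation lemmas and elementary program logic -/

/-! Every update is reduced to a weight update. With `B = [U D]` and `B' = [V E]`, the new matrix is
`B diag(σ, 1) B'ᵀ` (`add_mul_transpose_eq`); appended rows or columns are a zero-padded factor plus
a product with the sparse 0/1 matrix `shift`. If `B = Q R` and `B' = Q' R'`, where `Q = B L` and `Q'
= B' L'` have orthonormal columns, then a truncated SVD `(F, θ, G)` of the small matrix `R diag(σ,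
1) R'ᵀ` lifts to the truncated SVD `(Q F, θ, Q' G)` of the new matrix (`IsTruncSVD.lift`).

In the fast case no step may cost `m` or `n`. Call a row touched if `D` is non-zero there; there are
at most `nnz D` touched rows. The Gram matrix `BᵀB` has upper left block `UᵀU = 1`, and its other
blocks only see touched rows, so it is cheap. Its SVD is an eigendecomposition, and the positive
eigenvalues give `L` and `R` (`IsTruncSVD.gram_factor`), even if `B` is rank deficient.

The new left vectors are `B (L F)`. Let `W` be the top `k × k` block of `L F` and `U_J` the block of
untouched rows of `U`. On these rows the new vectors are `U_J W`, so it suffices to multiply `U''`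
by `W` and to rewrite the touched rows of `U'` using the inverse of the new `U''`. This needs `W` to
be invertible, but only its action on `U_J` counts: with `H = U_Jᵀ U_J`, any `W'` with `H W' = H W`
will do. Take an SVD `H W = F τ Gᵀ` (with new `F`, `G`) and let `F₀` be `F` with the columns of
non-zero `τ` erased. If `H F₀ = 0`, then `W' = W - F₀ (F₀ᵀ W - Gᵀ)` has this property and is
invertible (`isUnit_completion`). If `U_J W` has the same rank as `U_J`, then `H F₀ = 0`
(`gram_mul_eq_zero_of_rank_eq`); this is where non-degeneracy enters. The program tests `H F₀ = 0`
and otherwise multiplies out the tall factor, which is correct but not covered by the time bound.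
The right vectors are treated in the same way.

The programs are verified with a loop rule (`exec_forLoop`) and a rule for tabulating sums
(`exec_tabulate`); `cost_bound` compares their costs with `(z + N) * N ^ 2`, where `N = k + s` and
`z` bounds the numbers of non-zero entries. -/

@[simp] theorem Mem.setReg_iarr (M : Mem) (x v : ℕ) : (M.setReg x v).iarr = M.iarr := rfl
@[simp] theorem Mem.setReg_rarr (M : Mem) (x v : ℕ) : (M.setReg x v).rarr = M.rarr := rfl
@[simp] theorem Mem.setInt_reg (M : Mem) (a i v : ℕ) : (M.setInt a i v).reg = M.reg := rfl
@[simp] theorem Mem.setReal_reg (M : Mem) (a i j : ℕ) (v : ℝ) :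
    (M.setReal a i j v).reg = M.reg := rfl

theorem Mem.setReg_reg (M : Mem) (x v y : ℕ) :
    (M.setReg x v).reg y = if y = x then v else M.reg y := by
  simp [Mem.setReg, Function.update_apply]

@[simp] theorem Mem.setReg_reg_self (M : Mem) (x v : ℕ) : (M.setReg x v).reg x = v := by
  simp [Mem.setReg]

theorem Mem.setReg_reg_of_ne (M : Mem) {x v y : ℕ} (h : y ≠ x) :
    (M.setReg x v).reg y = M.reg y := by
  simp [Mem.setReg, h]

theorem Mem.setInt_iarr (M : Mem) (a i v b j : ℕ) :
    (M.setInt a i v).iarr b j = if b = a ∧ j = i then v else M.iarr b j := by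
  by_cases h : b = a
  · subst h
    by_cases h' : j = i <;> simp [Mem.setInt, h']
  · simp [Mem.setInt, h]

theorem Mem.setReal_rarr (M : Mem) (a i j : ℕ) (v : ℝ) (b i' j' : ℕ) :
    (M.setReal a i j v).rarr b i' j' = if b = a ∧ i' = i ∧ j' = j then v else M.rarr b i' j' := by
  by_cases h : b = a
  · subst h
    by_cases h' : i' = i
    · subst h'
      by_cases h'' : j' = j <;> simp [Mem.setReal, h'']
    · simp [Mem.setReal, h']
  · simp [Mem.setReal, h]

theorem Mem.setReal_rarr_of_ne (M : Mem) {a i j : ℕ} {v : ℝ} {b : ℕ} (h : b ≠ a) :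
    (M.setReal a i j v).rarr b = M.rarr b := by
  simp [Mem.setReal, h]

/-- `for x = 0, …, n - 1 do body`. -/
def forLoop (x : ℕ) (n : IExp) (body : Prog) : Prog :=
  .seq (.setReg x (.lit 0))
    (.loop (.ilt (.reg x) n) (.seq body (.setReg x (.add (.reg x) (.lit 1)))))

/-- Induction on the number of remaining rounds. The invariant is checked after the counter has been
advanced, and the body must hand the counter back unchanged. The bound `n` is re-evaluated in every
round, so the invariant has to preserve its value (`hn`). -/
theorem exec_forLoop {O : SVDRoutine} {x : ℕ} {n : IExp} {body : Prog} {M : Mem} (N c : ℕ)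
    (Inv : ℕ → Mem → Prop) (h0 : Inv 0 (M.setReg x 0))
    (hn : ∀ i M, i ≤ N → Inv i M → n.eval M = N)
    (step : ∀ i M, i < N → M.reg x = i → Inv i M →
      ∃ M' t, Exec O body M M' t ∧ t ≤ c ∧ M'.reg x = i ∧ Inv (i + 1) (M'.setReg x (i + 1))) :
    ∃ M' t, Exec O (forLoop x n body) M M' t ∧ t ≤ (c + n.cost + 10) * (N + 1) ∧
      M'.reg x = N ∧ Inv N M' := by
  suffices H : ∀ d i M, i + d = N → M.reg x = i → Inv i M → ∃ M' t,
      Exec O (.loop (.ilt (.reg x) n) (.seq body (.setReg x (.add (.reg x) (.lit 1))))) M M' t ∧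
      t ≤ (c + n.cost + 7) * d + n.cost + 3 ∧ M'.reg x = N ∧ Inv N M' by
    obtain ⟨M', t, e, ht, hx, hI⟩ := H N 0 _ (by simp) (by simp) h0
    refine ⟨M', _, .seq (.setReg _ _ _) e, ?_, hx, hI⟩
    simp only [IExp.cost]
    nlinarith
  intro d
  induction d with
  | zero =>
    intro i M hi hx hI
    have hi : i = N := by omega
    subst hi
    refine ⟨M, _, .loop_false ?_, ?_, hx, hI⟩
    · simp [BExp.Holds, IExp.eval, hn i M le_rfl hI, hx]
    · simp [BExp.cost, IExp.cost]; omega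
  | succ d ih =>
    intro i M hi hx hI
    obtain ⟨M', t, e, ht, hx', hI'⟩ := step i M (by omega) hx hI
    obtain ⟨M'', t', e', ht', hx'', hI''⟩ :=
      ih (i + 1) (M'.setReg x (i + 1)) (by omega) (by simp) hI'
    refine ⟨M'', _, .loop_true (t' := t') ?_ (.seq e (.setReg _ _ _)) ?_, ?_, hx'', hI''⟩
    · simp [BExp.Holds, IExp.eval, hn i M (by omega) hI, hx]; omega
    · simpa [IExp.eval, hx'] using e'
    · simp only [BExp.cost, IExp.cost]
      nlinarith

/-! ### Which memory an expression reads -/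

/-- All registers in the expression are below `n`. -/
def IExp.Below (n : ℕ) : IExp → Prop
  | lit _ => True
  | reg x => x < n
  | arr _ i => i.Below n
  | add e f => e.Below n ∧ f.Below n
  | sub e f => e.Below n ∧ f.Below n

/-- All registers in the expression are below `n`, and the array `d` is not read. -/
def RExp.Avoids (n d : ℕ) : RExp → Prop
  | zero => True
  | one => True
  | arr a i j => a ≠ d ∧ i.Below n ∧ j.Below n
  | add e f => e.Avoids n d ∧ f.Avoids n d
  | sub e f => e.Avoids n d ∧ f.Avoids n d
  | mul e f => e.Avoids n d ∧ f.Avoids n d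
  | div e f => e.Avoids n d ∧ f.Avoids n d
  | sqrt e => e.Avoids n d

theorem IExp.eval_congr {n : ℕ} {M M' : Mem} (hr : ∀ x < n, M'.reg x = M.reg x)
    (hi : M'.iarr = M.iarr) : ∀ {e : IExp}, e.Below n → e.eval M' = e.eval M
  | lit _, _ => rfl
  | reg x, h => hr x h
  | arr a i, h => by simp only [IExp.eval, hi, IExp.eval_congr hr hi (e := i) h]
  | add e f, h => by
    simp only [IExp.eval, IExp.eval_congr hr hi h.1, IExp.eval_congr hr hi h.2]
  | sub e f, h => by
    simp only [IExp.eval, IExp.eval_congr hr hi h.1, IExp.eval_congr hr hi h.2]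

theorem RExp.eval_congr {n d : ℕ} {M M' : Mem} (hr : ∀ x < n, M'.reg x = M.reg x)
    (hi : M'.iarr = M.iarr) (ha : ∀ a ≠ d, M'.rarr a = M.rarr a) :
    ∀ {e : RExp}, e.Avoids n d → e.eval M' = e.eval M
  | zero, _ => rfl
  | one, _ => rfl
  | arr a i j, h => by
    simp only [RExp.eval, ha a h.1, IExp.eval_congr hr hi h.2.1, IExp.eval_congr hr hi h.2.2]
  | add e f, h => by
    simp only [RExp.eval, RExp.eval_congr hr hi ha h.1, RExp.eval_congr hr hi ha h.2]
  | sub e f, h => by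
    simp only [RExp.eval, RExp.eval_congr hr hi ha h.1, RExp.eval_congr hr hi ha h.2]
  | mul e f, h => by
    simp only [RExp.eval, RExp.eval_congr hr hi ha h.1, RExp.eval_congr hr hi ha h.2]
  | div e f, h => by
    simp only [RExp.eval, RExp.eval_congr hr hi ha h.1, RExp.eval_congr hr hi ha h.2]
  | sqrt e, h => by
    simp only [RExp.eval, RExp.eval_congr hr hi ha (e := e) h]

/-! ### Tabulating sums into arrays -/

/-- The memory with the loop counters set to `i, j, l`. -/
def Mem.counters (M : Mem) (i j l : ℕ) : Mem :=
  ((M.setReg 1000 i).setReg 1001 j).setReg 1002 l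

@[simp] theorem Mem.counters_iarr (M : Mem) (i j l : ℕ) : (M.counters i j l).iarr = M.iarr := rfl
@[simp] theorem Mem.counters_rarr (M : Mem) (i j l : ℕ) : (M.counters i j l).rarr = M.rarr := rfl
theorem Mem.counters_reg (M : Mem) (i j l x : ℕ) : (M.counters i j l).reg x =
    if x = 1002 then l else if x = 1001 then j else if x = 1000 then i else M.reg x := by
  simp [Mem.counters, Mem.setReg_reg]
@[simp] theorem Mem.counters_reg_fst (M : Mem) (i j l : ℕ) : (M.counters i j l).reg 1000 = i := by
  simp [Mem.counters_reg]
@[simp] theorem Mem.counters_reg_snd (M : Mem) (i j l : ℕ) : (M.counters i j l).reg 1001 = j := by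
  simp [Mem.counters_reg]
@[simp] theorem Mem.counters_reg_trd (M : Mem) (i j l : ℕ) : (M.counters i j l).reg 1002 = l := by
  simp [Mem.counters_reg]
theorem Mem.counters_reg_of_lt (M : Mem) {i j l x : ℕ} (h : x < 1000) :
    (M.counters i j l).reg x = M.reg x := by
  rw [Mem.counters_reg, if_neg, if_neg, if_neg] <;> omega

/-- `M'` differs from `M` at most in the real array `d` and the registers from `1000` on. -/
structure Mem.SameBut (d : ℕ) (M M' : Mem) : Prop where
  reg : ∀ {x}, x < 1000 → M'.reg x = M.reg x
  iarr : M'.iarr = M.iarr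
  rarr : ∀ {a}, a ≠ d → M'.rarr a = M.rarr a

theorem Mem.SameBut.block {d : ℕ} {M M' : Mem} (h : M.SameBut d M') {a : ℕ} (ha : a ≠ d)
    (p q : ℕ) : M'.block a p q = M.block a p q := by
  simp only [Mem.block, h.rarr ha]

/-- Tabulation of `e i j + ∑ l < L, f i j l`, for `i < p` and `j < q`, into the array `d`. -/
def tabulate (d : ℕ) (r c p q L : IExp) (e f : RExp) : Prog :=
  forLoop 1000 p <| forLoop 1001 q <| .seq (.setReal d r c e) <|
    forLoop 1002 L <| .setReal d r c (.add (.arr d r c) f)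

/-- The constant in the time bound for `tabulate`. -/
def tabulateCost (r c p q L : IExp) (e f : RExp) : ℕ :=
  3 * r.cost + 3 * c.cost + p.cost + q.cost + L.cost + e.cost + f.cost + 50

/-- The loops are verified from the inside out, with the invariant that the cells visited so far
hold their final values and all others their old ones. The sum is accumulated in the target cell
itself. By `inj` distinct index pairs address distinct cells, so no later round destroys an earlier
result. Target cells may be scattered, which serves to overwrite selected rows or a diagonal. -/
theorem exec_tabulate (O : SVDRoutine) (M : Mem) (d : ℕ) (r c p q L : IExp) (e f : RExp)
    (hr : r.Below 1002) (hc : c.Below 1002) (hp : p.Below 1000) (hq : q.Below 1000)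
    (hL : L.Below 1000) (he : e.Avoids 1002 d) (hf : f.Avoids 1003 d)
    (inj : ∀ i < p.eval M, ∀ j < q.eval M, ∀ i' < p.eval M, ∀ j' < q.eval M,
      r.eval (M.counters i j 0) = r.eval (M.counters i' j' 0) →
      c.eval (M.counters i j 0) = c.eval (M.counters i' j' 0) → i = i' ∧ j = j')
    (K : ℕ) (hK : tabulateCost r c p q L e f ≤ K) :
    ∃ M' t, Exec O (tabulate d r c p q L e f) M M' t ∧
      t ≤ K * ((p.eval M + 1) * (q.eval M + 1) * (L.eval M + 1)) ∧ M.SameBut d M' ∧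
      (∀ i < p.eval M, ∀ j < q.eval M,
        M'.rarr d (r.eval (M.counters i j 0)) (c.eval (M.counters i j 0)) =
          e.eval (M.counters i j 0) +
            ∑ l ∈ Finset.range (L.eval M), f.eval (M.counters i j l)) ∧
      ∀ a b, (∀ i < p.eval M, ∀ j < q.eval M,
        ¬ (a = r.eval (M.counters i j 0) ∧ b = c.eval (M.counters i j 0))) →
        M'.rarr d a b = M.rarr d a b := by
  have ev : ∀ {n : IExp} {M' : Mem}, n.Below 1000 → M.SameBut d M' → n.eval M' = n.eval M :=
    fun h h' => IExp.eval_congr (fun x hx => h'.reg hx) h'.iarr h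
  have agree : ∀ {i j : ℕ} {M' : Mem}, M.SameBut d M' → M'.reg 1000 = i → M'.reg 1001 = j →
      ∀ x < 1002, M'.reg x = (M.counters i j 0).reg x := by
    intro i j M' h hi hj x hx
    rw [Mem.counters_reg, if_neg (by omega)]
    split_ifs with h1 h2
    · rw [h1, hj]
    · rw [h2, hi]
    · exact h.reg (by omega)
  have agree' : ∀ {i j l : ℕ} {M' : Mem}, M.SameBut d M' → M'.reg 1000 = i → M'.reg 1001 = j →
      M'.reg 1002 = l → ∀ x < 1003, M'.reg x = (M.counters i j l).reg x := by
    intro i j l M' h hi hj hl x hx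
    rw [Mem.counters_reg]
    split_ifs with h0 h1 h2
    · rw [h0, hl]
    · rw [h1, hj]
    · rw [h2, hi]
    · exact h.reg (by omega)
  have evI : ∀ {n : IExp} {i j : ℕ} {M' : Mem}, n.Below 1002 → M.SameBut d M' →
      M'.reg 1000 = i → M'.reg 1001 = j → n.eval M' = n.eval (M.counters i j 0) :=
    fun h h' hi hj => IExp.eval_congr (agree h' hi hj) h'.iarr h
  have sreg : ∀ {M' : Mem} {x v : ℕ}, M.SameBut d M' → 1000 ≤ x →
      M.SameBut d (M'.setReg x v) := by
    intro M' x v h hx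
    exact ⟨fun {y} hy => by rw [Mem.setReg_reg_of_ne _ (by omega), h.reg hy], h.iarr, h.rarr⟩
  have sreal : ∀ {M' : Mem} {a b : ℕ} {v : ℝ}, M.SameBut d M' →
      M.SameBut d (M'.setReal d a b v) := by
    intro M' a b v h
    exact ⟨h.reg, h.iarr, fun ha => by rw [Mem.setReal_rarr_of_ne _ ha, h.rarr ha]⟩
  set P := p.eval M with hP
  set Q := q.eval M with hQ
  set LL := L.eval M with hLL
  set R : ℕ → ℕ → ℕ := fun i j => r.eval (M.counters i j 0) with hR
  set C : ℕ → ℕ → ℕ := fun i j => c.eval (M.counters i j 0) with hC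
  set part : ℕ → ℕ → ℕ → ℝ := fun i j n => e.eval (M.counters i j 0) +
    ∑ l ∈ Finset.range n, f.eval (M.counters i j l) with hpart
  -- the inner loop
  set c1 := 2 * r.cost + 2 * c.cost + f.cost + 3 with hc1
  have inner : ∀ (i j : ℕ) (M₀ : Mem), M.SameBut d M₀ → M₀.reg 1000 = i → M₀.reg 1001 = j →
      ∃ M' t, Exec O (.seq (.setReal d r c e) <|
          forLoop 1002 L <| .setReal d r c (.add (.arr d r c) f)) M₀ M' t ∧
        t ≤ (c1 + L.cost + 10) * (LL + 1) + (r.cost + c.cost + e.cost + 1) ∧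
        M.SameBut d M' ∧ M'.reg 1000 = i ∧ M'.reg 1001 = j ∧
        M'.rarr d (R i j) (C i j) = part i j LL ∧
        ∀ a b, ¬ (a = R i j ∧ b = C i j) → M'.rarr d a b = M₀.rarr d a b := by
    intro i j M₀ hs hi hj
    obtain ⟨M', t, ex, ht, -, hs', hi', hj', hv, hu⟩ := exec_forLoop (O := O) (x := 1002) (n := L)
      (body := .setReal d r c (.add (.arr d r c) f))
      (M := M₀.setReal d (r.eval M₀) (c.eval M₀) (e.eval M₀)) LL c1
      (fun n M' => M.SameBut d M' ∧ M'.reg 1000 = i ∧ M'.reg 1001 = j ∧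
        M'.rarr d (R i j) (C i j) = part i j n ∧
        ∀ a b, ¬ (a = R i j ∧ b = C i j) → M'.rarr d a b = M₀.rarr d a b)
      (by
        refine ⟨sreg (sreal hs) (by omega), by simp [Mem.setReg_reg, hi],
          by simp [Mem.setReg_reg, hj], ?_, ?_⟩
        · simp only [Mem.setReg_rarr, Mem.setReal_rarr, evI hr hs hi hj, evI hc hs hi hj, hR, hC,
            and_self, if_true, hpart, Finset.range_zero, Finset.sum_empty, add_zero]
          exact RExp.eval_congr (agree hs hi hj) hs.iarr (fun a ha => hs.rarr ha) he
        · intro a b hab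
          simp only [Mem.setReg_rarr, Mem.setReal_rarr, evI hr hs hi hj, evI hc hs hi hj]
          rw [if_neg]
          simpa using hab)
      (fun n M' _ h => ev hL h.1)
      (by
        rintro l M' hl hlr ⟨hs', hi', hj', hv, hu⟩
        refine ⟨_, _, .setReal _ _ _ _ _, ?_, ?_, sreg (sreal hs') (by omega), ?_, ?_, ?_, ?_⟩
        · simp only [RExp.cost, hc1]; omega
        · simpa using hlr
        · simp [Mem.setReg_reg, hi']
        · simp [Mem.setReg_reg, hj']
        · have h1 : f.eval M' = f.eval (M.counters i j l) :=
            RExp.eval_congr (agree' hs' hi' hj' hlr) hs'.iarr (fun a ha => hs'.rarr ha) hf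
          simp only [Mem.setReg_rarr, Mem.setReal_rarr, evI hr hs' hi' hj', evI hc hs' hi' hj',
            and_self, if_true, RExp.eval, hR, hC, h1]
          simp only [hR, hC] at hv
          rw [hv]
          simp only [hpart, Finset.sum_range_succ, add_assoc]
        · intro a b hab
          simp only [Mem.setReg_rarr, Mem.setReal_rarr, evI hr hs' hi' hj', evI hc hs' hi' hj']
          rw [if_neg, hu a b hab]
          simpa using hab)
    exact ⟨M', _, .seq (.setReal _ _ _ _ _) ex, by omega, hs', hi', hj', hv, hu⟩
  set c2 := (c1 + L.cost + 10) * (LL + 1) + (r.cost + c.cost + e.cost + 1) with hc2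
  have middle : ∀ (i : ℕ) (M₀ : Mem), i < P → M.SameBut d M₀ → M₀.reg 1000 = i →
      ∃ M' t, Exec O (forLoop 1001 q <| .seq (.setReal d r c e) <|
          forLoop 1002 L <| .setReal d r c (.add (.arr d r c) f)) M₀ M' t ∧
        t ≤ (c2 + q.cost + 10) * (Q + 1) ∧
        M.SameBut d M' ∧ M'.reg 1000 = i ∧
        (∀ j < Q, M'.rarr d (R i j) (C i j) = part i j LL) ∧
        ∀ a b, (∀ j < Q, ¬ (a = R i j ∧ b = C i j)) → M'.rarr d a b = M₀.rarr d a b := by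
    intro i M₀ hiP hs hi
    obtain ⟨M', t, ex, ht, -, hs', hi', hv, hu⟩ := exec_forLoop (O := O) (x := 1001) (n := q)
      (body := .seq (.setReal d r c e) <|
          forLoop 1002 L <| .setReal d r c (.add (.arr d r c) f))
      (M := M₀) Q c2
      (fun n M' => M.SameBut d M' ∧ M'.reg 1000 = i ∧
        (∀ j < n, M'.rarr d (R i j) (C i j) = part i j LL) ∧
        ∀ a b, (∀ j < n, ¬ (a = R i j ∧ b = C i j)) → M'.rarr d a b = M₀.rarr d a b)
      ⟨sreg hs (by omega), by simp [Mem.setReg_reg, hi], by simp, by simp⟩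
      (fun n M' _ h => ev hq h.1)
      (by
        rintro j M' hj hjr ⟨hs', hi', hv, hu⟩
        obtain ⟨M'', t, ex, ht, hs'', hi'', hj'', hv'', hu''⟩ := inner i j M' hs' hi' hjr
        refine ⟨M'', t, ex, ht, hj'', sreg hs'' (by omega), by simp [Mem.setReg_reg, hi''], ?_, ?_⟩
        · intro j' hj'
          rcases Nat.lt_succ_iff_lt_or_eq.1 hj' with h | h
          · rw [Mem.setReg_rarr, hu'', hv j' h]
            rintro ⟨h1, h2⟩
            have := inj i hiP j' (by omega) i hiP j hj h1 h2
            omega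
          · subst h; exact hv''
        · intro a b hab
          rw [Mem.setReg_rarr, hu'' a b (hab j (by omega)),
            hu a b fun j' hj' => hab j' (by omega)])
    exact ⟨M', t, ex, ht, hs', hi', hv, hu⟩
  set c3 := (c2 + q.cost + 10) * (Q + 1) with hc3
  obtain ⟨M', t, ex, ht, -, hs', hv, hu⟩ := exec_forLoop (O := O) (x := 1000) (n := p)
      (body := forLoop 1001 q <| .seq (.setReal d r c e) <|
          forLoop 1002 L <| .setReal d r c (.add (.arr d r c) f))
      (M := M) P c3
      (fun n M' => M.SameBut d M' ∧
        (∀ i < n, ∀ j < Q, M'.rarr d (R i j) (C i j) = part i j LL) ∧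
        ∀ a b, (∀ i < n, ∀ j < Q, ¬ (a = R i j ∧ b = C i j)) → M'.rarr d a b = M.rarr d a b)
      ⟨sreg ⟨fun _ => rfl, rfl, fun _ => rfl⟩ (by omega), by simp, by simp⟩
      (fun n M' _ h => ev hp h.1)
      (by
        rintro i M' hi hir ⟨hs', hv, hu⟩
        obtain ⟨M'', t, ex, ht, hs'', hi'', hv'', hu''⟩ := middle i M' hi hs' hir
        refine ⟨M'', t, ex, ht, hi'', sreg hs'' (by omega), ?_, ?_⟩
        · intro i' hi' j hj
          rcases Nat.lt_succ_iff_lt_or_eq.1 hi' with h | h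
          · rw [Mem.setReg_rarr, hu'', hv i' h j hj]
            rintro j' hj' ⟨h1, h2⟩
            have := inj i' (by omega) j hj i hi j' hj' h1 h2
            omega
          · subst h; exact hv'' j hj
        · intro a b hab
          rw [Mem.setReg_rarr, hu'' a b (hab i (by omega)),
            hu a b fun j' hj' => hab j' (by omega)])
  refine ⟨M', t, ex, ht.trans ?_, hs', hv, hu⟩
  -- Each loop contributes its length plus one as a factor; additive overheads go into the constant
  -- because these factors are at least one.
  have h2 : c2 ≤ (c1 + L.cost + 10 + (r.cost + c.cost + e.cost + 1)) * (LL + 1) := by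
    rw [hc2]; nlinarith
  have h3 : c3 ≤ (c1 + L.cost + 10 + (r.cost + c.cost + e.cost + 1) + q.cost + 10) *
      ((LL + 1) * (Q + 1)) := by
    rw [hc3, ← mul_assoc]
    gcongr
    nlinarith
  have h4 : (c3 + p.cost + 10) ≤ K * ((LL + 1) * (Q + 1)) := by
    have h5 : c1 + L.cost + 10 + (r.cost + c.cost + e.cost + 1) + q.cost + 10 + p.cost + 10 ≤ K := by
      refine le_trans ?_ hK
      simp only [tabulateCost, hc1]
      omega
    have h6 : 1 ≤ (LL + 1) * (Q + 1) := Nat.mul_pos (by omega) (by omega)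
    calc c3 + p.cost + 10 ≤ (c1 + L.cost + 10 + (r.cost + c.cost + e.cost + 1) + q.cost + 10) *
            ((LL + 1) * (Q + 1)) + (p.cost + 10) * ((LL + 1) * (Q + 1)) := by nlinarith
      _ ≤ K * ((LL + 1) * (Q + 1)) := by
        rw [← add_mul]; gcongr; omega
  calc (c3 + p.cost + 10) * (P + 1) ≤ K * ((LL + 1) * (Q + 1)) * (P + 1) := by gcongr
    _ = _ := by ring

/-- Tabulation of a `p × q` matrix into the array `d`. -/
def fill (d : ℕ) (p q L : IExp) (e f : RExp) : Prog :=
  tabulate d (.reg 1000) (.reg 1001) p q L e f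

theorem exec_fill (O : SVDRoutine) (M : Mem) (d : ℕ) (p q L : IExp) (e f : RExp) {P Q R : ℕ}
    (hP : p.eval M = P) (hQ : q.eval M = Q) (hR : L.eval M = R)
    (hp : p.Below 1000) (hq : q.Below 1000)
    (hL : L.Below 1000) (he : e.Avoids 1002 d) (hf : f.Avoids 1003 d)
    (hK : tabulateCost (.reg 1000) (.reg 1001) p q L e f ≤ 100) :
    ∃ M' t, Exec O (fill d p q L e f) M M' t ∧
      t ≤ 100 * ((P + 1) * (Q + 1) * (R + 1)) ∧ M.SameBut d M' ∧
      (∀ i < P, ∀ j < Q, M'.rarr d i j = e.eval (M.counters i j 0) +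
            ∑ l ∈ Finset.range R, f.eval (M.counters i j l)) ∧
      ∀ i j, ¬ (i < P ∧ j < Q) → M'.rarr d i j = M.rarr d i j := by
  subst hP hQ hR
  obtain ⟨M', t, ex, ht, hs, hv, hu⟩ := exec_tabulate O M d (.reg 1000) (.reg 1001) p q L e f
    (by simp [IExp.Below]) (by simp [IExp.Below]) hp hq hL he hf
    (by intros; simp_all [IExp.eval]) 100 hK
  simp only [IExp.eval, Mem.counters_reg_fst, Mem.counters_reg_snd] at hv hu
  exact ⟨M', t, ex, ht, hs, hv, fun i j h => hu i j fun i' hi' j' hj' h' => h (by omega)⟩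

/-- The specification of the built-in instruction. -/
theorem exec_svd {O : SVDRoutine} (hO : O.Correct) (M : Mem) (p q k : IExp) (src F T G : ℕ)
    {P Q K : ℕ} (hP : p.eval M = P) (hQ : q.eval M = Q) (hK : k.eval M = K)
    (hKP : K ≤ P) (hKQ : K ≤ Q) (hFT : F ≠ T) (hFG : F ≠ G) (hTG : T ≠ G) :
    ∃ M' t, Exec O (.svd p q k src F T G) M M' t ∧
      t ≤ (P + Q) ^ 3 + p.cost + q.cost + k.cost + 1 ∧
      IsTruncSVD K (M.block src P Q) (M'.block F P K) (fun j => M'.rarr T 0 j)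
        (M'.block G Q K) ∧
      M'.reg = M.reg ∧ M'.iarr = M.iarr ∧
      ∀ {a}, a ≠ F → a ≠ T → a ≠ G → M'.rarr a = M.rarr a := by
  subst hP hQ hK
  refine ⟨_, _, .svd M p q k src F T G hKP hKQ, le_rfl, ?_, rfl, rfl, ?_⟩
  · convert hO _ _ _ (M.block src (p.eval M) (q.eval M)) hKP hKQ using 1
    · ext i j
      simp [Mem.block, Mem.runSVD, Mem.setBlock, hFT, hFG]
    · ext j
      simp [Mem.runSVD, Mem.setBlock, hTG]
    · ext i j
      simp [Mem.block, Mem.runSVD, Mem.setBlock]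
  · intro a h1 h2 h3
    simp [Mem.runSVD, Mem.setBlock, h1, h2, h3]

/-! ### Linear algebra -/

/-- The columns of `Q` form an orthonormal family in Euclidean space, which extends to an
orthonormal basis; `v` has the dummy value zero where the basis vectors are still free. -/
theorem exists_orthogonal_extension {p r : ℕ} (h : r ≤ p) (Q : Matrix (Fin p) (Fin r) ℝ)
    (hQ : Qᵀ * Q = 1) : ∃ Q' : Matrix (Fin p) (Fin p) ℝ, Q'ᵀ * Q' = 1 ∧
      Q'.submatrix id (Fin.castLE h) = Q := by
  let v : Fin p → EuclideanSpace ℝ (Fin p) := fun j =>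
    if hj : (j : ℕ) < r then WithLp.toLp 2 fun i => Q i ⟨j, hj⟩ else 0
  have hv : Orthonormal ℝ (Set.domRestrict {j : Fin p | (j : ℕ) < r} v) := by
    rw [orthonormal_iff_ite]
    rintro ⟨a, ha⟩ ⟨b, hb⟩
    have ha' : (a : ℕ) < r := ha
    have hb' : (b : ℕ) < r := hb
    have := congrFun (congrFun hQ ⟨a, ha⟩) ⟨b, hb⟩
    simp only [Matrix.mul_apply, Matrix.transpose_apply, Matrix.one_apply, Fin.mk.injEq] at this
    simp only [PiLp.inner_apply, RCLike.inner_apply, conj_trivial, Subtype.mk.injEq, Fin.ext_iff]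
    rw [← this]
    refine Finset.sum_congr rfl fun i _ => ?_
    simp only [Set.domRestrict_apply, v, dif_pos ha', dif_pos hb']
    exact mul_comm _ _
  obtain ⟨b, hb⟩ := hv.exists_orthonormalBasis_extension_of_card_eq (by simp)
  refine ⟨Matrix.of fun i j => b j i, ?_, ?_⟩
  · ext i j
    have := orthonormal_iff_ite.1 b.orthonormal i j
    simp only [PiLp.inner_apply, RCLike.inner_apply, conj_trivial] at this
    simp only [Matrix.mul_apply, Matrix.transpose_apply, Matrix.of_apply, Matrix.one_apply]
    rw [← this]
    exact Finset.sum_congr rfl fun i _ => mul_comm _ _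
  · ext i j
    have : b (Fin.castLE h j) = v (Fin.castLE h j) := hb _ (by simp)
    simp [this, v]

theorem le_of_transpose_mul_self_eq_one {p r : ℕ} {Q : Matrix (Fin p) (Fin r) ℝ}
    (hQ : Qᵀ * Q = 1) : r ≤ p := by
  have h : (Qᵀ * Q).rank ≤ p := (Matrix.rank_mul_le_right _ _).trans (by
    simpa using Q.rank_le_card_height)
  simpa [hQ] using h

/-- Only the first `min p q` diagonal terms survive. The sum runs over natural numbers so that
decompositions of different sizes, whose indices live in different types `Fin`, can be compared term
by term in `IsTruncSVD.lift`. -/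
theorem mul_rectDiag_mul_apply {p q m n : ℕ} (U : Matrix (Fin m) (Fin p) ℝ)
    (V : Matrix (Fin n) (Fin q) ℝ) (τ : ℕ → ℝ) (i : Fin m) (j : Fin n) :
    (U * rectDiag p q τ * Vᵀ) i j = ∑ l ∈ Finset.range (min p q), if h : l < p ∧ l < q then
      U i ⟨l, h.1⟩ * τ l * V j ⟨l, h.2⟩ else 0 := by
  have key : ∀ b : Fin q, (U * rectDiag p q τ) i b =
      if h : (b : ℕ) < p then U i ⟨b, h⟩ * τ b else 0 := by
    intro b
    simp only [Matrix.mul_apply, rectDiag, Matrix.of_apply, mul_ite, mul_zero]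
    split_ifs with h
    · rw [Finset.sum_eq_single ⟨b, h⟩]
      · simp
      · intro a _ ha
        rw [if_neg]
        intro h'
        exact ha (Fin.ext h')
      · simp
    · refine Finset.sum_eq_zero fun a _ => if_neg ?_
      have := a.2
      omega
  rw [Matrix.mul_apply]
  simp only [key, Matrix.transpose_apply]
  rw [Finset.sum_subset (s₁ := Finset.range (min p q)) (s₂ := Finset.range q)
    (f := fun l => if h : l < p ∧ l < q then U i ⟨l, h.1⟩ * τ l * V j ⟨l, h.2⟩ else 0)
    (by intro; simp) (by
      intro x _ hx
      rw [dif_neg]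
      simpa using hx), Finset.sum_range]
  refine Finset.sum_congr rfl fun b _ => ?_
  by_cases h : (b : ℕ) < p <;> simp [h]

/-- A truncated SVD of `X` gives one of `Q X Q'ᵀ` when `Q` and `Q'` have orthonormal columns. -/
theorem IsTruncSVD.lift {m n p q k : ℕ} {X : Matrix (Fin p) (Fin q) ℝ}
    {F : Matrix (Fin p) (Fin k) ℝ} {θ : Fin k → ℝ} {G : Matrix (Fin q) (Fin k) ℝ}
    (h : IsTruncSVD k X F θ G) {Q : Matrix (Fin m) (Fin p) ℝ} {Q' : Matrix (Fin n) (Fin q) ℝ}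
    (hQ : Qᵀ * Q = 1) (hQ' : Q'ᵀ * Q' = 1) :
    IsTruncSVD k (Q * X * Q'ᵀ) (Q * F) θ (Q' * G) := by
  obtain ⟨hp, hq, Uf, τ, Vf, ⟨h1, h2, h3, h4, h5⟩, rfl, h6, rfl⟩ := h
  have hpm := le_of_transpose_mul_self_eq_one hQ
  have hqn := le_of_transpose_mul_self_eq_one hQ'
  obtain ⟨UU, hU, hU'⟩ := exists_orthogonal_extension hpm (Q * Uf) (by
    rw [Matrix.transpose_mul, Matrix.mul_assoc, ← Matrix.mul_assoc Qᵀ, hQ, Matrix.one_mul, h1])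
  obtain ⟨VV, hV, hV'⟩ := exists_orthogonal_extension hqn (Q' * Vf) (by
    rw [Matrix.transpose_mul, Matrix.mul_assoc, ← Matrix.mul_assoc Q'ᵀ, hQ', Matrix.one_mul, h2])
  -- Beyond `min p q` the values of `τ` are irrelevant for `X` but could enter the larger diagonal,
  -- so they are cut off to zero; the sequence stays non-negative and non-increasing.
  refine ⟨hp.trans hpm, hq.trans hqn, UU, fun l => if l < min p q then τ l else 0, VV,
    ⟨hU, hV, ?_, ?_, ?_⟩, ?_, ?_, ?_⟩
  · intro i
    split_ifs
    exacts [h3 i, le_rfl]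
  · intro a b hab
    dsimp only
    split_ifs with ha hb
    exacts [h4 hab, absurd (lt_of_le_of_lt hab ha) hb, h3 _, le_rfl]
  · have : Q * X * Q'ᵀ = (Q * Uf) * rectDiag p q τ * (Q' * Vf)ᵀ := by
      rw [h5, Matrix.transpose_mul]
      simp only [Matrix.mul_assoc]
    rw [this]
    ext i j
    rw [mul_rectDiag_mul_apply, mul_rectDiag_mul_apply]
    rw [← Finset.sum_subset (s₁ := Finset.range (min p q)) (s₂ := Finset.range (min m n))
      (by intro x; simp; omega)]
    · refine Finset.sum_congr rfl fun l hl => ?_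
      have hl' := hl
      simp only [Finset.mem_range] at hl hl'
      rw [lt_min_iff] at hl
      rw [dif_pos hl, dif_pos ⟨by omega, by omega⟩, if_pos hl', ← hU', ← hV']
      rfl
    · intro x _ hx
      have : ¬ x < min p q := by simpa using hx
      simp [this]
  · rw [show Q * Uf.submatrix id (Fin.castLE hp) = (Q * Uf).submatrix id (Fin.castLE hp) from rfl,
      ← hU']
    rfl
  · intro j
    have : (j : ℕ) < min p q := by have := j.2; omega
    simp only [h6, if_pos this]
  · rw [show Q' * Vf.submatrix id (Fin.castLE hq) = (Q' * Vf).submatrix id (Fin.castLE hq) from rfl,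
      ← hV']
    rfl

theorem IsTruncSVD.left_orth {p q k : ℕ} {X : Matrix (Fin p) (Fin q) ℝ}
    {F : Matrix (Fin p) (Fin k) ℝ} {θ : Fin k → ℝ} {G : Matrix (Fin q) (Fin k) ℝ}
    (h : IsTruncSVD k X F θ G) : Fᵀ * F = 1 := by
  obtain ⟨hp, hq, Uf, τ, Vf, ⟨h1, h2, h3, h4, h5⟩, rfl, h6, rfl⟩ := h
  rw [show (Uf.submatrix id (Fin.castLE hp))ᵀ * Uf.submatrix id (Fin.castLE hp) =
    (Ufᵀ * Uf).submatrix (Fin.castLE hp) (Fin.castLE hp) from rfl, h1]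
  ext i j
  simp [Matrix.one_apply, Fin.ext_iff]

theorem IsTruncSVD.right_orth {p q k : ℕ} {X : Matrix (Fin p) (Fin q) ℝ}
    {F : Matrix (Fin p) (Fin k) ℝ} {θ : Fin k → ℝ} {G : Matrix (Fin q) (Fin k) ℝ}
    (h : IsTruncSVD k X F θ G) : Gᵀ * G = 1 := by
  obtain ⟨hp, hq, Uf, τ, Vf, ⟨h1, h2, h3, h4, h5⟩, rfl, h6, rfl⟩ := h
  rw [show (Vf.submatrix id (Fin.castLE hq))ᵀ * Vf.submatrix id (Fin.castLE hq) =
    (Vfᵀ * Vf).submatrix (Fin.castLE hq) (Fin.castLE hq) from rfl, h2]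
  ext i j
  simp [Matrix.one_apply, Fin.ext_iff]

theorem IsTruncSVD.nonneg {p q k : ℕ} {X : Matrix (Fin p) (Fin q) ℝ}
    {F : Matrix (Fin p) (Fin k) ℝ} {θ : Fin k → ℝ} {G : Matrix (Fin q) (Fin k) ℝ}
    (h : IsTruncSVD k X F θ G) (j : Fin k) : 0 ≤ θ j := by
  obtain ⟨hp, hq, Uf, τ, Vf, ⟨h1, h2, h3, h4, h5⟩, rfl, h6, rfl⟩ := h
  rw [h6]; exact h3 _

theorem IsTruncSVD.antitone {p q k : ℕ} {X : Matrix (Fin p) (Fin q) ℝ}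
    {F : Matrix (Fin p) (Fin k) ℝ} {θ : Fin k → ℝ} {G : Matrix (Fin q) (Fin k) ℝ}
    (h : IsTruncSVD k X F θ G) : Antitone θ := by
  obtain ⟨hp, hq, Uf, τ, Vf, ⟨h1, h2, h3, h4, h5⟩, rfl, h6, rfl⟩ := h
  intro a b hab
  rw [h6, h6]; exact h4 hab

theorem IsTruncSVD.eq_of_square {N : ℕ} {X F G : Matrix (Fin N) (Fin N) ℝ} {θ : Fin N → ℝ}
    (h : IsTruncSVD N X F θ G) : X = F * Matrix.diagonal θ * Gᵀ := by
  obtain ⟨hp, hq, Uf, τ, Vf, ⟨h1, h2, h3, h4, h5⟩, rfl, h6, rfl⟩ := h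
  have : rectDiag N N τ = Matrix.diagonal θ := by
    ext i j
    simp [rectDiag, Matrix.diagonal_apply, h6, Fin.ext_iff]
  rw [h5, this]
  rfl

/-! ### Orthonormalisation through the Gram matrix -/

/-- The SVD of a positive semidefinite matrix is an eigendecomposition. -/
theorem IsTruncSVD.mul_left_of_gram {ι : Type*} [Fintype ι] {N : ℕ} {B : Matrix ι (Fin N) ℝ}
    {F G : Matrix (Fin N) (Fin N) ℝ} {θ : Fin N → ℝ} (h : IsTruncSVD N (Bᵀ * B) F θ G) :
    Bᵀ * B * F = F * Matrix.diagonal θ := by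
  have hF := h.left_orth
  have hG := h.right_orth
  have hX := h.eq_of_square
  -- Symmetry of `Bᵀ * B`: transposing its SVD exchanges `F` and `G`.
  have hX' : Bᵀ * B = G * Matrix.diagonal θ * Fᵀ := by
    have := congrArg Matrix.transpose hX
    simpa [Matrix.transpose_mul, Matrix.mul_assoc] using this
  have e1 : Bᵀ * B * F = G * Matrix.diagonal θ := by
    rw [hX', Matrix.mul_assoc, hF, Matrix.mul_one]
  have e2 : Bᵀ * B * G = F * Matrix.diagonal θ := by
    rw [hX, Matrix.mul_assoc, hG, Matrix.mul_one]
  rw [e1]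
  ext i j
  rw [Matrix.mul_diagonal, Matrix.mul_diagonal]
  rcases (h.nonneg j).eq_or_lt with h0 | hpos
  · simp [← h0]
  · congr 1
    -- For `θ j > 0` the difference of the two singular vectors satisfies `BᵀB x = -θ j x`, and
    -- positive semidefiniteness forces `x = 0`.
    set x : Fin N → ℝ := fun i => F i j - G i j with hx
    have hmul : (Bᵀ * B) *ᵥ x = -(θ j) • x := by
      have : (Bᵀ * B) *ᵥ x = (Bᵀ * B * (F - G)).col j := by
        ext a; simp [Matrix.mulVec, dotProduct, Matrix.mul_apply (M := Bᵀ * B), hx]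
      rw [this, Matrix.mul_sub, e1, e2]
      ext a
      simp [Matrix.mul_diagonal, hx]
      ring
    have hq : x ⬝ᵥ ((Bᵀ * B) *ᵥ x) = (B *ᵥ x) ⬝ᵥ (B *ᵥ x) := by
      rw [← Matrix.mulVec_mulVec, Matrix.dotProduct_mulVec, Matrix.vecMul_transpose]
    have h1 : 0 ≤ (B *ᵥ x) ⬝ᵥ (B *ᵥ x) := Finset.sum_nonneg fun i _ => mul_self_nonneg _
    have h2 : 0 ≤ x ⬝ᵥ x := Finset.sum_nonneg fun i _ => mul_self_nonneg _
    rw [← hq, hmul, dotProduct_smul, smul_eq_mul] at h1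
    have h3 : x ⬝ᵥ x = 0 := by nlinarith
    have h4 := congrFun (dotProduct_self_eq_zero.1 h3) i
    simp only [hx, Pi.zero_apply] at h4
    linarith

/-- Orthonormalisation of the columns of `B` by means of an SVD of the Gram matrix. -/
theorem IsTruncSVD.gram_factor {ι : Type*} [Fintype ι] {N ρ : ℕ} {B : Matrix ι (Fin N) ℝ}
    {F G : Matrix (Fin N) (Fin N) ℝ} {θ : Fin N → ℝ} (h : IsTruncSVD N (Bᵀ * B) F θ G)
    (hρ : ρ ≤ N) (hθ : ∀ j : Fin N, 0 < θ j ↔ (j : ℕ) < ρ) {L : Matrix (Fin N) (Fin ρ) ℝ}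
    {R : Matrix (Fin ρ) (Fin N) ℝ}
    (hL : ∀ i j, L i j = F i (Fin.castLE hρ j) / √(θ (Fin.castLE hρ j)))
    (hR : ∀ i j, R i j = √(θ (Fin.castLE hρ i)) * F j (Fin.castLE hρ i)) :
    (B * L)ᵀ * (B * L) = 1 ∧ B * L * R = B := by
  have hF := h.left_orth
  have hF' : F * Fᵀ = 1 := mul_eq_one_comm.1 hF
  have hE := h.mul_left_of_gram
  have hD : Fᵀ * (Bᵀ * B) * F = Matrix.diagonal θ := by
    rw [Matrix.mul_assoc, hE, ← Matrix.mul_assoc, hF, Matrix.one_mul]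
  have hpos : ∀ j : Fin ρ, 0 < θ (Fin.castLE hρ j) := fun j => (hθ _).2 (by simp)
  constructor
  -- The columns of `B * F` are orthogonal with squared norms `θ`, so division by `√θ` normalises
  -- the first `ρ` of them.
  · have e : L = (F.submatrix id (Fin.castLE hρ)) *
        Matrix.diagonal fun j => (√(θ (Fin.castLE hρ j)))⁻¹ := by
      ext i j; simp [hL, div_eq_mul_inv, Matrix.mul_diagonal]
    have e2 : (F.submatrix id (Fin.castLE hρ))ᵀ * (Bᵀ * B) * (F.submatrix id (Fin.castLE hρ)) =
        Matrix.diagonal fun j => θ (Fin.castLE hρ j) := by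
      have : (F.submatrix id (Fin.castLE hρ))ᵀ * (Bᵀ * B) * (F.submatrix id (Fin.castLE hρ)) =
        (Fᵀ * (Bᵀ * B) * F).submatrix (Fin.castLE hρ) (Fin.castLE hρ) := rfl
      rw [this, hD]
      ext i j
      simp [Matrix.diagonal_apply, Fin.ext_iff]
    have e3 : (B * L)ᵀ * (B * L) = (Matrix.diagonal fun j => (√(θ (Fin.castLE hρ j)))⁻¹) *
        ((F.submatrix id (Fin.castLE hρ))ᵀ * (Bᵀ * B) * (F.submatrix id (Fin.castLE hρ))) *
        Matrix.diagonal fun j => (√(θ (Fin.castLE hρ j)))⁻¹ := by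
      rw [e]
      simp only [Matrix.transpose_mul, Matrix.diagonal_transpose, Matrix.mul_assoc]
    rw [e3, e2, Matrix.diagonal_mul_diagonal, Matrix.diagonal_mul_diagonal, ← Matrix.diagonal_one]
    congr 1
    ext j
    have h1 := Real.sqrt_pos.2 (hpos j)
    have h2 := Real.mul_self_sqrt (hpos j).le
    field_simp
    nlinarith
  · -- the columns of `B * F` beyond the first `ρ` vanish
    have hz : ∀ a (j : Fin N), ¬ (j : ℕ) < ρ → (B * F) a j = 0 := by
      intro a j hj
      have h0 : θ j = 0 := le_antisymm (not_lt.1 fun h' => hj ((hθ j).1 h')) (h.nonneg j)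
      have h1 := congrFun (congrFun hD j) j
      have h2 : (Fᵀ * (Bᵀ * B) * F) j j = ∑ a, (B * F) a j * (B * F) a j := by
        have : Fᵀ * (Bᵀ * B) * F = (B * F)ᵀ * (B * F) := by
          simp only [Matrix.transpose_mul, Matrix.mul_assoc]
        rw [this, Matrix.mul_apply]
        rfl
      rw [h2, Matrix.diagonal_apply_eq, h0] at h1
      have := (Finset.sum_eq_zero_iff_of_nonneg fun i _ => mul_self_nonneg _).1 h1 a
        (Finset.mem_univ a)
      exact mul_self_eq_zero.1 this
    -- The square roots cancel, and the omitted columns of `B * F` are zero, so the truncated sum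
    -- equals the full one.
    have h1 : B * L * R = (B * F) * Fᵀ := by
      ext a b
      rw [Matrix.mul_apply, Matrix.mul_apply (M := B * F)]
      have e1 : ∀ j : Fin ρ, (B * L) a j * R j b =
          (B * F) a (Fin.castLE hρ j) * F b (Fin.castLE hρ j) := by
        intro j
        have h1 := Real.sqrt_pos.2 (hpos j)
        have : (B * L) a j = (B * F) a (Fin.castLE hρ j) / √(θ (Fin.castLE hρ j)) := by
          simp only [Matrix.mul_apply, hL, Finset.sum_div, mul_div_assoc]
        rw [this, hR]
        field_simp
      simp only [e1, Matrix.transpose_apply]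
      symm
      rw [← Finset.sum_subset (s₁ := Finset.univ.map (Fin.castLEEmb hρ)) (Finset.subset_univ _)]
      · simp [Finset.sum_map]
      · intro j _ hj
        rw [hz a j, zero_mul]
        intro hj'
        exact hj (by simpa using ⟨⟨j, hj'⟩, by ext; simp⟩)
    rw [h1, Matrix.mul_assoc, hF', Matrix.mul_one]

/-- Compare ranks: `UᵀU = 1` has rank `k` and factors through the `ρ` rows of `R`. It ensures that
the small middle matrix is large enough for an SVD request of rank `k`. -/
theorem le_of_orthonormal_factor {ι : Type*} [Fintype ι] {k ρ : ℕ} {U : Matrix ι (Fin k) ℝ}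
    {Q : Matrix ι (Fin ρ) ℝ} {R : Matrix (Fin ρ) (Fin k) ℝ} (hU : Uᵀ * U = 1) (h : Q * R = U) :
    k ≤ ρ := by
  have h1 : (Uᵀ * U).rank ≤ R.rank := by
    rw [← h, ← Matrix.mul_assoc]; exact Matrix.rank_mul_le_right _ _
  have h2 := R.rank_le_card_height
  rw [hU] at h1
  simp at h1 h2
  omega

/-- `1 - x / x` is the indicator of `x = 0`. -/
theorem one_sub_div_self_eq_ite (x : ℝ) : 1 - x / x = if x = 0 then 1 else 0 := by
  split_ifs with h
  · simp [h]
  · simp [h]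

/-! ### Completing the transition matrix to an invertible one -/

/-- Replace `W` by an invertible matrix without changing `H * W`. -/
theorem isUnit_completion {k : ℕ} {H W F G : Matrix (Fin k) (Fin k) ℝ} {τ : Fin k → ℝ}
    (h : IsTruncSVD k (H * W) F τ G) {F₀ : Matrix (Fin k) (Fin k) ℝ}
    (hF₀ : F₀ = F * Matrix.diagonal fun j => 1 - τ j / τ j) (hH : H * F₀ = 0)
    {W' : Matrix (Fin k) (Fin k) ℝ} (hW' : W' = W - F₀ * (F₀ᵀ * W - Gᵀ)) :
    H * W' = H * W ∧ IsUnit W' := by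
  have hF := h.left_orth
  have hG := h.right_orth
  have hX := h.eq_of_square
  have e1 : H * W' = H * W := by
    rw [hW', Matrix.mul_sub, ← Matrix.mul_assoc, hH, Matrix.zero_mul, sub_zero]
  refine ⟨e1, ?_⟩
  -- As `x / x = 0` at `x = 0`, `E` is the coordinate projection onto the zero singular values, and
  -- `F₀ = F * E` keeps exactly the left singular vectors belonging to them.
  set E : Matrix (Fin k) (Fin k) ℝ := Matrix.diagonal fun j => 1 - τ j / τ j with hE
  have hEE : E * E = E := by
    rw [hE, Matrix.diagonal_mul_diagonal]
    congr 1
    ext j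
    simp only [one_sub_div_self_eq_ite]
    split_ifs <;> simp
  have hEt : Eᵀ = E := Matrix.diagonal_transpose _
  have e2 : F₀ᵀ * F₀ = E := by
    rw [hF₀, Matrix.transpose_mul, hEt, Matrix.mul_assoc, ← Matrix.mul_assoc Fᵀ, hF,
      Matrix.one_mul, hEE]
  have e3 : E * F₀ᵀ = F₀ᵀ := by
    rw [hF₀, Matrix.transpose_mul, hEt, ← Matrix.mul_assoc, hEE]
  -- Along `F₀` the correction replaces the component of `W` by that of `Gᵀ`; this repairs the
  -- kernel.
  have e4 : F₀ᵀ * W' = E * Gᵀ := by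
    rw [hW', Matrix.mul_sub, ← Matrix.mul_assoc, e2, Matrix.mul_sub, ← Matrix.mul_assoc, e3]
    abel
  rw [Matrix.isUnit_iff_isUnit_det, isUnit_iff_ne_zero]
  intro hdet
  obtain ⟨x, hx0, hx⟩ := Matrix.exists_mulVec_eq_zero_iff.2 hdet
  apply hx0
  -- In the coordinates `y`, a kernel vector of `W'` is killed by `diag τ` (through `H * W'`) and by
  -- `E` (through `F₀ᵀ * W'`). These diagonals have complementary supports, so `y = 0`.
  set y := Gᵀ *ᵥ x with hy
  have h1 : Matrix.diagonal τ *ᵥ y = 0 := by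
    have : Fᵀ * (H * W') = Matrix.diagonal τ * Gᵀ := by
      rw [e1, hX, ← Matrix.mul_assoc, ← Matrix.mul_assoc, hF, Matrix.one_mul]
    rw [hy, Matrix.mulVec_mulVec, ← this, ← Matrix.mulVec_mulVec, ← Matrix.mulVec_mulVec, hx]
    simp
  have h2 : E *ᵥ y = 0 := by
    rw [hy, Matrix.mulVec_mulVec, ← e4, ← Matrix.mulVec_mulVec, hx]
    simp
  have h3 : y = 0 := by
    ext j
    have a := congrFun h1 j
    have b := congrFun h2 j
    rw [Matrix.mulVec_diagonal] at a
    rw [hE, Matrix.mulVec_diagonal, one_sub_div_self_eq_ite] at b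
    by_cases hj : τ j = 0
    · simpa [hj] using b
    · simpa [hj] using a
  have h4 : G *ᵥ y = x := by
    rw [hy, Matrix.mulVec_mulVec, mul_eq_one_comm.1 hG, Matrix.one_mulVec]
  rw [← h4, h3, Matrix.mulVec_zero]

/-- If passing from `B` to `B * W` does not change the rank, the completion succeeds. -/
theorem gram_mul_eq_zero_of_rank_eq {ι : Type*} [Fintype ι] {k : ℕ} {B : Matrix ι (Fin k) ℝ}
    {W F G : Matrix (Fin k) (Fin k) ℝ} {τ : Fin k → ℝ} (h : IsTruncSVD k (Bᵀ * B * W) F τ G)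
    (hr : (B * W).rank = B.rank) :
    Bᵀ * B * (F * Matrix.diagonal fun j => 1 - τ j / τ j) = 0 := by
  have hF := h.left_orth
  have hX := h.eq_of_square
  set H := Bᵀ * B with hH
  -- `rank H = rank B = rank (B W) = rank (Wᵀ H W) ≤ rank (H W)`, so `H * W` and `H` have the same
  -- range.
  have r1 : H.rank ≤ (H * W).rank := by
    rw [hH, Matrix.rank_transpose_mul_self, ← hr, ← Matrix.rank_transpose_mul_self,
      Matrix.transpose_mul]
    rw [show Wᵀ * Bᵀ * (B * W) = Wᵀ * (Bᵀ * B * W) by simp only [Matrix.mul_assoc]]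
    exact Matrix.rank_mul_le_right _ _
  have hle : LinearMap.range (H * W).mulVecLin ≤ LinearMap.range H.mulVecLin := by
    rintro _ ⟨x, rfl⟩
    exact ⟨W *ᵥ x, by simp [Matrix.mulVec_mulVec]⟩
  have heq := Submodule.eq_of_le_of_finrank_le hle r1
  set F₀ := F * Matrix.diagonal fun j => 1 - τ j / τ j with hF₀
  have z : F₀ᵀ * (H * W) = 0 := by
    rw [hF₀, Matrix.transpose_mul, hX, Matrix.diagonal_transpose, Matrix.mul_assoc,
      ← Matrix.mul_assoc Fᵀ, ← Matrix.mul_assoc Fᵀ, hF, Matrix.one_mul, ← Matrix.mul_assoc,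
      Matrix.diagonal_mul_diagonal]
    have : (fun j => (1 - τ j / τ j) * τ j) = 0 := by
      ext j
      rw [one_sub_div_self_eq_ite]
      split_ifs with hj <;> simp [hj]
    rw [this]
    simp
  -- `F₀ᵀ` vanishes on the range of `H * W`, hence on that of `H`. Since `H` is symmetric, the claim
  -- is the transpose.
  have z' : F₀ᵀ * H = 0 := by
    ext i j
    have hm : H *ᵥ Pi.single j 1 ∈ LinearMap.range H.mulVecLin := ⟨Pi.single j 1, rfl⟩
    rw [← heq] at hm
    obtain ⟨x, hx⟩ := hm
    have : F₀ᵀ *ᵥ (H *ᵥ Pi.single j 1) = 0 := by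
      rw [← hx, Matrix.mulVecLin_apply, Matrix.mulVec_mulVec, z, Matrix.zero_mulVec]
    rw [Matrix.mulVec_mulVec] at this
    simpa using congrFun this i
  have := congrArg Matrix.transpose z'
  rw [Matrix.transpose_mul, Matrix.transpose_transpose, hH, Matrix.transpose_mul,
    Matrix.transpose_transpose, Matrix.transpose_zero] at this
  exact this

/-- The inverse of an invertible matrix from its SVD. -/
theorem IsTruncSVD.inverse_mul {k : ℕ} {A F G : Matrix (Fin k) (Fin k) ℝ} {τ : Fin k → ℝ}
    (h : IsTruncSVD k A F τ G) (hA : IsUnit A) :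
    (G * (Matrix.diagonal fun j => (τ j)⁻¹) * Fᵀ) * A = 1 := by
  have hF := h.left_orth
  have hG := h.right_orth
  have hX := h.eq_of_square
  have hd : IsUnit (Matrix.diagonal τ).det := by
    rw [← Matrix.isUnit_iff_isUnit_det]
    have : Matrix.diagonal τ = Fᵀ * A * G := by
      rw [hX, ← Matrix.mul_assoc, ← Matrix.mul_assoc, hF, Matrix.one_mul, Matrix.mul_assoc, hG,
        Matrix.mul_one]
    rw [this]
    exact ((IsUnit.of_mul_eq_one F hF).mul hA).mul
      (IsUnit.of_mul_eq_one Gᵀ (mul_eq_one_comm.1 hG))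
  have hτ : ∀ j, τ j ≠ 0 := by
    intro j hj
    rw [Matrix.det_diagonal, isUnit_iff_ne_zero] at hd
    exact hd (Finset.prod_eq_zero (Finset.mem_univ j) hj)
  rw [hX, Matrix.mul_assoc, ← Matrix.mul_assoc Fᵀ, ← Matrix.mul_assoc Fᵀ, hF, Matrix.one_mul,
    Matrix.mul_assoc, ← Matrix.mul_assoc (Matrix.diagonal _), Matrix.diagonal_mul_diagonal]
  have : (fun j => (τ j)⁻¹ * τ j) = fun _ => 1 := by
    ext j; exact inv_mul_cancel₀ (hτ j)
  rw [this, Matrix.diagonal_one, Matrix.one_mul, mul_eq_one_comm.1 hG]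

/-- The sum over all rows is split along the image of `idx` and its complement `J`. Products of tall
matrices thereby become accessible from the touched rows: the rest is found by subtraction or
contains a zero factor. -/
theorem gram_split {m r p q : ℕ} {idx : Fin r → Fin m} (hidx : Function.Injective idx)
    {J : Set (Fin m)} (hJ : ∀ i, i ∈ J ↔ ∀ t, idx t ≠ i) [Fintype J]
    (X : Matrix (Fin m) (Fin p) ℝ) (Y : Matrix (Fin m) (Fin q) ℝ) :
    Xᵀ * Y = (X.submatrix idx id)ᵀ * Y.submatrix idx id +
      (X.submatrix (Subtype.val : J → Fin m) id)ᵀ *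
        Y.submatrix (Subtype.val : J → Fin m) id := by
  classical
  ext a b
  simp only [Matrix.add_apply, Matrix.mul_apply, Matrix.transpose_apply, Matrix.submatrix_apply,
    id]
  rw [← Finset.sum_add_sum_compl (Finset.univ.image idx)]
  congr 1
  · rw [Finset.sum_image fun _ _ _ _ h => hidx h]
  · rw [← Finset.sum_coe_sort]
    refine Fintype.sum_equiv (Equiv.subtypeEquivRight fun i => ?_) _ _ fun i => rfl
    simp [hJ]

/-! ### Matrix operations as programs -/

theorem exec_fill_block (O : SVDRoutine) (M : Mem) (d : ℕ) (p q L : IExp) (e f : RExp) {P Q R : ℕ}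
    (hP : p.eval M = P) (hQ : q.eval M = Q) (hR : L.eval M = R)
    (hp : p.Below 1000) (hq : q.Below 1000)
    (hL : L.Below 1000) (he : e.Avoids 1002 d) (hf : f.Avoids 1003 d)
    (hK : tabulateCost (.reg 1000) (.reg 1001) p q L e f ≤ 100) :
    ∃ M' t, Exec O (fill d p q L e f) M M' t ∧
      t ≤ 100 * ((P + 1) * (Q + 1) * (R + 1)) ∧ M.SameBut d M' ∧
      (∀ (i : Fin P) (j : Fin Q), M'.block d P Q i j = e.eval (M.counters i j 0) +
            ∑ l : Fin R, f.eval (M.counters i j l)) ∧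
      ∀ i j, ¬ (i < P ∧ j < Q) → M'.rarr d i j = M.rarr d i j := by
  obtain ⟨M', t, ex, ht, hs, hv, hu⟩ := exec_fill O M d p q L e f hP hQ hR hp hq hL he hf hK
  refine ⟨M', t, ex, ht, hs, fun i j => ?_, hu⟩
  rw [← Finset.sum_range (f := fun l => f.eval (M.counters i j l))]
  exact hv i i.2 j j.2

/-- Matrix multiplication `d := a * b`. -/
def matMul (d a b : ℕ) (p q L : IExp) : Prog :=
  fill d p q L .zero (.mul (.arr a (.reg 1000) (.reg 1002)) (.arr b (.reg 1002) (.reg 1001)))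

theorem exec_matMul (O : SVDRoutine) (M : Mem) (d a b : ℕ) (p q L : IExp) {P Q R : ℕ}
    (hP : p.eval M = P) (hQ : q.eval M = Q) (hR : L.eval M = R)
    (hp : p.Below 1000) (hq : q.Below 1000) (hL : L.Below 1000) (ha : a ≠ d) (hb : b ≠ d)
    (hK : p.cost + q.cost + L.cost ≤ 30) :
    ∃ M' t, Exec O (matMul d a b p q L) M M' t ∧
      t ≤ 100 * ((P + 1) * (Q + 1) * (R + 1)) ∧ M.SameBut d M' ∧
      M'.block d P Q = M.block a P R * M.block b R Q := by
  obtain ⟨M', t, ex, ht, hs, hv, -⟩ := exec_fill_block O M d p q L .zero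
    (.mul (.arr a (.reg 1000) (.reg 1002)) (.arr b (.reg 1002) (.reg 1001))) hP hQ hR hp hq hL
    trivial ⟨⟨ha, by simp [IExp.Below], by simp [IExp.Below]⟩, hb, by simp [IExp.Below],
      by simp [IExp.Below]⟩ (by simp only [tabulateCost, IExp.cost, RExp.cost]; omega)
  refine ⟨M', t, ex, ht, hs, ?_⟩
  ext i j
  rw [hv]
  simp [RExp.eval, IExp.eval, Matrix.mul_apply, Mem.block]

/-- The reference cost is `(z + N) * N ^ 2 = z * N ^ 2 + N ^ 3`: a nest of three loops may have one
long side, at most `z + N`, and two short ones. The summands `+ 1` are paid for by `1 ≤ N`. -/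
theorem cost_bound {z N P Q R : ℕ} (hN : 1 ≤ N) (hP : P ≤ z + N) (hQ : Q ≤ N) (hR : R ≤ N) :
    (P + 1) * (Q + 1) * (R + 1) ≤ 8 * ((z + N) * N ^ 2) := by
  calc (P + 1) * (Q + 1) * (R + 1) ≤ (2 * (z + N)) * (2 * N) * (2 * N) := by
        gcongr <;> omega
    _ = _ := by ring

theorem cost_bound' {z N P Q R : ℕ} (hN : 1 ≤ N) (hP : P ≤ N) (hQ : Q ≤ N) (hR : R ≤ z + N) :
    (P + 1) * (Q + 1) * (R + 1) ≤ 8 * ((z + N) * N ^ 2) := by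
  rw [mul_comm, ← mul_assoc]
  exact cost_bound hN hR hP hQ

theorem le_cost {z N : ℕ} (hN : 1 ≤ N) : z + N ≤ (z + N) * N ^ 2 :=
  Nat.le_mul_of_pos_right _ (by positivity)

theorem cube_le_cost {z N : ℕ} : N ^ 3 ≤ (z + N) * N ^ 2 := by
  nlinarith [Nat.zero_le (z * N ^ 2)]

/-- `M'` differs from `M` at most in the registers and arrays with names in `[o, o + 50)` and in
the registers from `1000` on. -/
structure Mem.Within (o : ℕ) (M M' : Mem) : Prop where
  reg : ∀ {x}, x < 1000 → (x < o ∨ o + 50 ≤ x) → M'.reg x = M.reg x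
  iarr : ∀ {a}, (a < o ∨ o + 50 ≤ a) → M'.iarr a = M.iarr a
  rarr : ∀ {a}, (a < o ∨ o + 50 ≤ a) → M'.rarr a = M.rarr a

theorem Mem.Within.trans {o : ℕ} {M M' M'' : Mem} (h : M.Within o M') (h' : M'.Within o M'') :
    M.Within o M'' :=
  ⟨fun hx hx' => (h'.reg hx hx').trans (h.reg hx hx'), fun ha => (h'.iarr ha).trans (h.iarr ha),
    fun ha => (h'.rarr ha).trans (h.rarr ha)⟩

theorem Mem.SameBut.within {o d : ℕ} {M M' : Mem} (h : M.SameBut d M') (h1 : o ≤ d)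
    (h2 : d < o + 50) : M.Within o M' :=
  ⟨fun hx _ => h.reg hx, fun _ => by rw [h.iarr], fun ha => h.rarr (by omega)⟩

/-! ### The touched rows -/

/-- List without repetition, in the integer array `o + 1`, the entries of the integer array `row`;
their number goes to register `o`, and the integer array `o` gets the inverse of the list, shifted
by one. -/
def indexRows (o len row : ℕ) : Prog :=
  .seq (forLoop 1000 (.reg len) (.setInt o (.arr row (.reg 1000)) (.lit 0))) <|
  .seq (.setReg o (.lit 0)) <|
  forLoop 1000 (.reg len) <|
    .cond (.ieq (.arr o (.arr row (.reg 1000))) (.lit 0))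
      (.seq (.setInt (o + 1) (.reg o) (.arr row (.reg 1000)))
        (.seq (.setReg o (.add (.reg o) (.lit 1)))
          (.setInt o (.arr row (.reg 1000)) (.reg o))))
      .skip

/-- The work array may contain anything, and clearing all of it would cost `m`, so the first loop
zeroes only the positions occurring in the list. Afterwards zero means "not listed yet", which is
why the inverse index is shifted by one, and repetitions are recognised in constant time. -/
theorem exec_indexRows (O : SVDRoutine) (M : Mem) {o len row : ℕ} (ho : 100 ≤ o) (ho' : o < 900)
    (hlen : len < 100) (hrow : row < 100) :
    ∃ M' t, Exec O (indexRows o len row) M M' t ∧ t ≤ 100 * (M.reg len + 1) ∧ M.Within o M' ∧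
      M'.rarr = M.rarr ∧ M'.reg o ≤ M.reg len ∧
      (∀ i < M'.reg o, ∃ t < M.reg len, M'.iarr (o + 1) i = M.iarr row t) ∧
      (∀ i < M'.reg o, M'.iarr o (M'.iarr (o + 1) i) = i + 1) ∧
      ∀ t < M.reg len, 0 < M'.iarr o (M.iarr row t) ∧ M'.iarr o (M.iarr row t) ≤ M'.reg o ∧
        M'.iarr (o + 1) (M'.iarr o (M.iarr row t) - 1) = M.iarr row t := by
  set z := M.reg len with hz
  set ρ := M.iarr row with hρ
  obtain ⟨M₁, t₁, ex₁, ht₁, -, w₁, r₁, h₁⟩ := exec_forLoop (O := O) (x := 1000) (n := .reg len)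
    (body := .setInt o (.arr row (.reg 1000)) (.lit 0)) (M := M) z 10
    (fun n M' => M.Within o M' ∧ M'.rarr = M.rarr ∧ ∀ t < n, M'.iarr o (ρ t) = 0)
    ⟨⟨fun hx _ => Mem.setReg_reg_of_ne _ (by omega), fun _ => rfl, fun _ => rfl⟩, rfl, by simp⟩
    (fun n M' _ h => h.1.reg (by omega) (by omega))
    (by
      rintro t M' ht hx ⟨hw, hr, h⟩
      have hρ' : M'.iarr row = ρ := hw.iarr (by omega)
      refine ⟨_, _, .setInt _ _ _ _, by simp [IExp.cost], by simpa using hx, ?_, hr, ?_⟩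
      · refine hw.trans ⟨fun hx _ => ?_, fun {a} ha => ?_, fun _ => rfl⟩
        · rw [Mem.setReg_reg_of_ne _ (by omega)]; rfl
        · ext j
          rw [Mem.setReg_iarr, Mem.setInt_iarr, if_neg]
          omega
      · intro t' ht'
        rw [Mem.setReg_iarr, Mem.setInt_iarr]
        simp only [IExp.eval, hρ', hx]
        split_ifs with h'
        · rfl
        · rcases Nat.lt_succ_iff_lt_or_eq.1 ht' with h'' | h''
          · exact h t' h''
          · subst h''; simp at h')
  set M₂ := M₁.setReg o 0 with hM₂
  have w₂ : M.Within o M₂ :=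
    w₁.trans ⟨fun hx hx' => Mem.setReg_reg_of_ne _ (by omega), fun _ => rfl, fun _ => rfl⟩
  obtain ⟨M₃, t₃, ex₃, ht₃, -, w₃, r₃, c₃, l₃, p₃, q₃, z₃⟩ := exec_forLoop (O := O) (x := 1000)
    (n := .reg len)
    (body := .cond (.ieq (.arr o (.arr row (.reg 1000))) (.lit 0))
      (.seq (.setInt (o + 1) (.reg o) (.arr row (.reg 1000)))
        (.seq (.setReg o (.add (.reg o) (.lit 1)))
          (.setInt o (.arr row (.reg 1000)) (.reg o))))
      .skip) (M := M₂) z 40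
    (fun n M' => M.Within o M' ∧ M'.rarr = M.rarr ∧ M'.reg o ≤ n ∧
      (∀ i < M'.reg o, ∃ t < z, M'.iarr (o + 1) i = ρ t) ∧
      (∀ i < M'.reg o, M'.iarr o (M'.iarr (o + 1) i) = i + 1) ∧
      (∀ t < z, M'.iarr o (ρ t) = 0 ∨ (0 < M'.iarr o (ρ t) ∧ M'.iarr o (ρ t) ≤ M'.reg o ∧
        M'.iarr (o + 1) (M'.iarr o (ρ t) - 1) = ρ t)) ∧
      ∀ t < n, M'.iarr o (ρ t) ≠ 0)
    (by
      have h0 : (M₂.setReg 1000 0).reg o = 0 := by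
        rw [Mem.setReg_reg_of_ne _ (by omega), hM₂, Mem.setReg_reg_self]
      refine ⟨w₂.trans ⟨fun hx _ => Mem.setReg_reg_of_ne _ (by omega), fun _ => rfl,
        fun _ => rfl⟩, r₁, h0.le, ?_, ?_, ?_, by simp⟩
      · intro i hi; omega
      · intro i hi; omega
      · intro t ht; left; exact h₁ t ht)
    (fun n M' _ h => h.1.reg (by omega) (by omega))
    (by
      rintro t M' ht hx ⟨hw, hr, hc, hl, hp, hq, hz'⟩
      have hρ' : M'.iarr row = ρ := hw.iarr (by omega)
      by_cases h0 : M'.iarr o (ρ t) = 0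
      · set M'' := ((M'.setInt (o + 1) (M'.reg o) (ρ t)).setReg o (M'.reg o + 1)).setInt o (ρ t)
          (M'.reg o + 1) with hM''
        have ex : Exec O (.seq (.setInt (o + 1) (.reg o) (.arr row (.reg 1000)))
            (.seq (.setReg o (.add (.reg o) (.lit 1)))
              (.setInt o (.arr row (.reg 1000)) (.reg o)))) M' M'' (4 + (4 + 4)) := by
          have e2 := Exec.setReg (O := O) (M'.setInt (o + 1) (M'.reg o) (ρ t)) o
            (.add (.reg o) (.lit 1))
          have e1 : Exec O (.setInt (o + 1) (.reg o) (.arr row (.reg 1000))) M'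
              (M'.setInt (o + 1) (M'.reg o) (ρ t)) 4 := by
            have := Exec.setInt (O := O) M' (o + 1) (.reg o) (.arr row (.reg 1000))
            simpa [IExp.eval, IExp.cost, hρ', hx] using this
          have e3 : Exec O (.setInt o (.arr row (.reg 1000)) (.reg o))
              ((M'.setInt (o + 1) (M'.reg o) (ρ t)).setReg o (M'.reg o + 1)) M'' 4 := by
            have := Exec.setInt (O := O)
              ((M'.setInt (o + 1) (M'.reg o) (ρ t)).setReg o (M'.reg o + 1)) o
              (.arr row (.reg 1000)) (.reg o)
            have hrow' : (M'.setInt (o + 1) (M'.reg o) (ρ t)).iarr row = ρ := by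
              ext j
              rw [Mem.setInt_iarr, if_neg (by omega), hρ']
            have hx' : ((M'.setInt (o + 1) (M'.reg o) (ρ t)).setReg o (M'.reg o + 1)).reg 1000
                = t := by
              rw [Mem.setReg_reg_of_ne _ (by omega)]; exact hx
            simpa [IExp.eval, IExp.cost, hrow', hx'] using this
          exact .seq e1 (.seq (by simpa [IExp.eval, IExp.cost] using e2) e3)
        have g1 : M''.reg o = M'.reg o + 1 := by simp [hM'']
        have g2 : ∀ x, x ≠ o → M''.reg x = M'.reg x := by
          intro x hx
          rw [hM'', Mem.setInt_reg, Mem.setReg_reg_of_ne _ hx]; rfl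
        have g3 : ∀ j, M''.iarr (o + 1) j = if j = M'.reg o then ρ t else M'.iarr (o + 1) j := by
          intro j
          simp [hM'', Mem.setInt_iarr]
        have g4 : ∀ j, M''.iarr o j = if j = ρ t then M'.reg o + 1 else M'.iarr o j := by
          intro j
          simp [hM'', Mem.setInt_iarr]
        have g5 : ∀ a, a < o ∨ o + 50 ≤ a → M''.iarr a = M'.iarr a := by
          intro a ha
          ext j
          rw [hM'', Mem.setInt_iarr, if_neg (by omega), Mem.setReg_iarr, Mem.setInt_iarr,
            if_neg (by omega)]
        refine ⟨M'', _, .cond_true ?_ ex, by simp [BExp.cost, IExp.cost], ?_, ?_, hr, ?_, ?_, ?_, ?_,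
          ?_⟩
        · simpa [BExp.Holds, IExp.eval, hρ', hx] using h0
        · rw [g2 _ (by omega), hx]
        · refine hw.trans ⟨fun hx hx' => ?_, fun ha => g5 _ ha, fun _ => rfl⟩
          rw [Mem.setReg_reg_of_ne _ (by omega), g2 _ (by omega)]
        · rw [Mem.setReg_reg_of_ne _ (by omega), g1]; omega
        · intro i hi
          rw [Mem.setReg_reg_of_ne _ (by omega), g1] at hi
          rw [Mem.setReg_iarr, g3]
          split_ifs with hi'
          · exact ⟨t, ht, rfl⟩
          · exact hl i (by omega)
        · intro i hi
          rw [Mem.setReg_reg_of_ne _ (by omega), g1] at hi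
          rw [Mem.setReg_iarr, g3]
          split_ifs with hi'
          · rw [g4, if_pos rfl, hi']
          -- A row listed earlier is not the new row `ρ t`: its inverse index is `i + 1`, while that
          -- of `ρ t` was still zero.
          · rw [g4, hp i (by omega), if_neg]
            intro h
            have := hp i (by omega)
            rw [h, h0] at this
            omega
        · intro t' ht'
          rw [Mem.setReg_reg_of_ne _ (by omega), Mem.setReg_iarr, g1, g4]
          split_ifs with h'
          · right
            rw [h', g3]
            simp
          · rcases hq t' ht' with h | ⟨h1, h2, h3⟩
            · left; exact h
            · right
              refine ⟨h1, by omega, ?_⟩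
              rw [g3, if_neg (by omega), h3]
        · intro t' ht'
          rw [Mem.setReg_iarr, g4]
          split_ifs with h'
          · omega
          · rcases Nat.lt_succ_iff_lt_or_eq.1 ht' with h'' | h''
            · exact hz' t' h''
            · subst h''; simp at h'
      · refine ⟨M', _, .cond_false ?_ (.skip _), by simp [BExp.cost, IExp.cost], hx, ?_, hr, ?_, ?_,
          ?_, ?_, ?_⟩
        · simpa [BExp.Holds, IExp.eval, hρ', hx] using h0
        · exact hw.trans ⟨fun hx _ => Mem.setReg_reg_of_ne _ (by omega), fun _ => rfl,
            fun _ => rfl⟩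
        · rw [Mem.setReg_reg_of_ne _ (by omega)]; omega
        · rw [Mem.setReg_reg_of_ne _ (by omega)]; exact hl
        · rw [Mem.setReg_reg_of_ne _ (by omega)]; exact hp
        · rw [Mem.setReg_reg_of_ne _ (by omega)]; exact hq
        · intro t' ht'
          rcases Nat.lt_succ_iff_lt_or_eq.1 ht' with h'' | h''
          · exact hz' t' h''
          · subst h''; exact h0)
  refine ⟨M₃, _, .seq ex₁ (.seq (.setReg _ _ _) ex₃), ?_, w₃, r₃, c₃, l₃, p₃, ?_⟩
  · simp only [IExp.cost] at ht₁ ht₃ ⊢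
    omega
  · intro t ht
    exact (q₃ t ht).resolve_left (z₃ t ht)

/-- Collect the touched rows of `[U D]`, where `U` is the product of the arrays `u₁` and `u₂` and
`D` is a sparse matrix, as a dense matrix in the array `o`. -/
def gather (o u₁ u₂ len row col val : ℕ) : Prog :=
  .seq (indexRows o len row) <|
  .seq (fill o (.reg o) (.reg 9) (.lit 0) .zero .zero) <|
  .seq (forLoop 1000 (.reg len)
    (.setReal o (.sub (.arr o (.arr row (.reg 1000))) (.lit 1))
      (.add (.reg 2) (.arr col (.reg 1000))) (.arr val (.lit 0) (.reg 1000)))) <|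
  fill o (.reg o) (.reg 2) (.reg 2) .zero
    (.mul (.arr u₁ (.arr (o + 1) (.reg 1000)) (.reg 1002)) (.arr u₂ (.reg 1002) (.reg 1001)))

/-- The dense block is zeroed, the list entries are scattered into its last `s` columns, and the
first `k` columns are filled with rows of `U₁ * U₂` at a cost of order `k ^ 2` per touched row. As
the list holds all the non-zero entries and nothing else, the rows not found are exactly the zero
rows of `D`. -/
theorem exec_gather (O : SVDRoutine) (M : Mem) {o u₁ u₂ len row col val : ℕ} (ho : 100 ≤ o)
    (ho' : o < 900) (hu₁ : u₁ < 100) (hu₂ : u₂ < 100) (hlen : len < 100) (hrow : row < 100)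
    (hcol : col < 100) (hval : val < 100) {m k s : ℕ} (hk : 0 < k) (h2 : M.reg 2 = k)
    (h9 : M.reg 9 = k + s) {U₁ : Matrix (Fin m) (Fin k) ℝ} {U₂ : Matrix (Fin k) (Fin k) ℝ}
    {D : Matrix (Fin m) (Fin s) ℝ} (hU₁ : M.block u₁ m k = U₁) (hU₂ : M.block u₂ k k = U₂)
    (hD : GivenSparse M len row col val D) :
    ∃ M' t, Exec O (gather o u₁ u₂ len row col val) M M' t ∧
      t ≤ 2000 * ((M.reg len + (k + s)) * (k + s) ^ 2) ∧ M.Within o M' ∧ M'.reg o ≤ M.reg len ∧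
      ∃ idx : Fin (M'.reg o) → Fin m, Function.Injective idx ∧
        (∀ i, i ∈ zeroRows D ↔ ∀ t, idx t ≠ i) ∧ (∀ t : Fin (M'.reg o), M'.iarr (o + 1) t = idx t) ∧
        M'.block o (M'.reg o) (k + s) = (appendCols (U₁ * U₂) D).submatrix idx id := by
  obtain ⟨z, hz⟩ : ∃ z, M.reg len = z := ⟨_, rfl⟩
  rw [GivenSparse, hz] at hD
  rw [hz]
  obtain ⟨en, hen⟩ := hD
  have hN : 1 ≤ k + s := by omega
  -- the index of the touched rows
  obtain ⟨M₁, t₁, ex₁, ht₁, w₁, ra₁, c₁, l₁, p₁, q₁⟩ := exec_indexRows O M ho ho' hlen hrow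
  rw [hz] at ht₁ c₁ l₁ q₁
  set r := M₁.reg o with hr
  have r1_2 : M₁.reg 2 = k := by rw [w₁.reg (by omega) (by omega), h2]
  have r1_9 : M₁.reg 9 = k + s := by rw [w₁.reg (by omega) (by omega), h9]
  obtain ⟨M₂, t₂, ex₂, ht₂, s₂, v₂, -⟩ := exec_fill O M₁ o (.reg o) (.reg 9) (.lit 0) .zero .zero
    (P := r) (Q := k + s) (R := 0) rfl r1_9 rfl (by simp [IExp.Below]; omega) (by simp [IExp.Below])
    trivial trivial trivial (by simp [tabulateCost, IExp.cost, RExp.cost])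
  have row₁ : M₁.iarr row = M.iarr row := w₁.iarr (by omega)
  have col₁ : M₁.iarr col = M.iarr col := w₁.iarr (by omega)
  -- the values
  obtain ⟨M₃, t₃, ex₃, ht₃, -, s₃, v₃, z₃⟩ := exec_forLoop (O := O) (x := 1000) (n := .reg len)
    (body := .setReal o (.sub (.arr o (.arr row (.reg 1000))) (.lit 1))
      (.add (.reg 2) (.arr col (.reg 1000))) (.arr val (.lit 0) (.reg 1000))) (M := M₂) z 20
    (fun n M' => M₁.SameBut o M' ∧
      (∀ t < n, M'.rarr o (M₁.iarr o (M.iarr row t) - 1) (k + M.iarr col t) = M.rarr val 0 t) ∧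
      ∀ i < r, ∀ j < s, (∀ t < n, ¬ (M.iarr row t = M₁.iarr (o + 1) i ∧ M.iarr col t = j)) →
        M'.rarr o i (k + j) = 0)
    (by
      refine ⟨⟨fun hx => ?_, s₂.iarr, s₂.rarr⟩, by simp, ?_⟩
      · rw [Mem.setReg_reg_of_ne _ (by omega), s₂.reg hx]
      · intro i hi j hj _
        rw [Mem.setReg_rarr, v₂ i hi (k + j) (by omega)]
        simp [RExp.eval])
    (fun n M' _ h => by
      simp only [IExp.eval]
      rw [h.1.reg (by omega), w₁.reg (by omega) (by omega), hz])
    (by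
      rintro t M' ht hx ⟨hs, hv, hzero⟩
      have e1 : IExp.eval M' (.sub (.arr o (.arr row (.reg 1000))) (.lit 1)) =
          M₁.iarr o (M.iarr row t) - 1 := by simp [IExp.eval, hx, hs.iarr, row₁]
      have e2 : IExp.eval M' (.add (.reg 2) (.arr col (.reg 1000))) = k + M.iarr col t := by
        simp [IExp.eval, hx, hs.iarr, col₁, hs.reg, r1_2]
      have e3 : RExp.eval M' (.arr val (.lit 0) (.reg 1000)) = M.rarr val 0 t := by
        simp only [RExp.eval, IExp.eval, hx]
        rw [hs.rarr (by omega), w₁.rarr (by omega)]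
      refine ⟨_, _, .setReal _ _ _ _ _, by simp [IExp.cost, RExp.cost], by simpa using hx,
        ⟨fun hx => ?_, hs.iarr, fun ha => ?_⟩, ?_, ?_⟩
      · rw [Mem.setReg_reg_of_ne _ (by omega), Mem.setReal_reg, hs.reg hx]
      · rw [Mem.setReg_rarr, Mem.setReal_rarr_of_ne _ ha, hs.rarr ha]
      · intro t' ht'
        rw [Mem.setReg_rarr, Mem.setReal_rarr, e1, e2, e3]
        rcases Nat.lt_succ_iff_lt_or_eq.1 ht' with h'' | h''
        · rw [if_neg, hv t' h'']
          -- Two list entries written to the same cell have equal row and column, hence are the same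
          -- entry; so no value is overwritten.
          rintro ⟨-, h3, h4⟩
          have htz : t' < z := by omega
          obtain ⟨a1, a2, a3⟩ := q₁ t ht
          obtain ⟨b1, b2, b3⟩ := q₁ t' htz
          have h5 : M.iarr row t' = M.iarr row t := by rw [← b3, h3, a3]
          have h6 : M.iarr col t' = M.iarr col t := by omega
          have hA := hen ⟨t, ht⟩
          have hB := hen ⟨t', htz⟩
          simp only at hA hB
          have : en ⟨t, ht⟩ = en ⟨t', htz⟩ := by
            apply Subtype.ext
            apply Prod.ext <;> apply Fin.ext
            · rw [← hA.1, ← hB.1, h5]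
            · rw [← hA.2.1, ← hB.2.1, h6]
          have := en.injective this
          simp only [Fin.mk.injEq] at this
          omega
        · subst h''; simp
      · intro i hi j hj h
        rw [Mem.setReg_rarr, Mem.setReal_rarr, e1, e2, if_neg, hzero i hi j hj]
        · intro t' ht'
          exact h t' (by omega)
        · rintro ⟨-, h3, h4⟩
          apply h t (by omega)
          refine ⟨?_, by omega⟩
          rw [h3, (q₁ t ht).2.2])
  -- the singular vectors
  have r3_o : M₃.reg o = r := s₃.reg (by omega)
  have r3_2 : M₃.reg 2 = k := by rw [s₃.reg (by omega), r1_2]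
  obtain ⟨M₄, t₄, ex₄, ht₄, s₄, v₄, u₄⟩ := exec_fill O M₃ o (.reg o) (.reg 2) (.reg 2) .zero
    (.mul (.arr u₁ (.arr (o + 1) (.reg 1000)) (.reg 1002)) (.arr u₂ (.reg 1002) (.reg 1001)))
    (P := r) (Q := k) (R := k) r3_o r3_2 r3_2 (by simp [IExp.Below]; omega) (by simp [IExp.Below])
    (by simp [IExp.Below]) trivial (by simp [RExp.Avoids, IExp.Below]; omega)
    (by simp [tabulateCost, IExp.cost, RExp.cost])
  have r4_o : M₄.reg o = r := by rw [s₄.reg (by omega), r3_o]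
  have ia : M₄.iarr = M₁.iarr := by rw [s₄.iarr, s₃.iarr]
  refine ⟨M₄, _, .seq ex₁ (.seq ex₂ (.seq ex₃ ex₄)), ?_, ?_, by rw [r4_o]; exact c₁, ?_⟩
  · have b1 := le_cost (z := z) hN
    have b2 := cost_bound (z := z) (P := r) (Q := k + s) (R := 0) hN (by omega) le_rfl (by omega)
    have b3 := cost_bound (z := z) (P := r) (Q := k) (R := k) hN (by omega) (by omega) (by omega)
    simp only [IExp.cost] at ht₃
    omega
  · exact w₁.trans ((s₃.within le_rfl (by omega)).trans (s₄.within le_rfl (by omega)))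
  · rw [r4_o, ia]
    have lt : ∀ i : Fin r, M₁.iarr (o + 1) i < m := by
      intro i
      obtain ⟨t, ht, h⟩ := l₁ i i.2
      rw [h, (hen ⟨t, ht⟩).1]
      exact Fin.isLt _
    refine ⟨fun i => ⟨M₁.iarr (o + 1) i, lt i⟩, ?_, ?_, fun _ => rfl, ?_⟩
    · intro i j hij
      simp only [Fin.mk.injEq] at hij
      have a := p₁ i i.2
      have b := p₁ j j.2
      rw [hij] at a
      apply Fin.ext
      omega
    · intro i
      constructor
      · intro hi t ht
        obtain ⟨t', ht', h⟩ := l₁ t t.2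
        have hA := (hen ⟨t', ht'⟩).1
        simp only at hA
        have : (en ⟨t', ht'⟩).1.1 = i := by
          rw [← ht]; apply Fin.ext; simp only [h, hA]
        apply (en ⟨t', ht'⟩).2
        rw [this]
        exact hi _
      · intro h j
        by_contra hne
        set t := en.symm ⟨(i, j), hne⟩ with ht
        have hA := (hen t).1
        rw [ht, Equiv.apply_symm_apply, ← ht] at hA
        simp only at hA
        obtain ⟨a1, a2, a3⟩ := q₁ t t.2
        refine h ⟨M₁.iarr o (M.iarr row t) - 1, by omega⟩ ?_
        apply Fin.ext
        exact a3.trans hA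
    · ext i j
      simp only [Matrix.submatrix_apply, id, appendCols, Matrix.of_apply, Mem.block]
      refine Fin.addCases (fun j => ?_) (fun j => ?_) j
      · rw [Fin.append_left]
        rw [v₄ i i.2 _ (by simp)]
        simp only [RExp.eval, IExp.eval, Mem.counters_reg_fst, Mem.counters_reg_snd,
          Mem.counters_reg_trd, Mem.counters_rarr, Mem.counters_iarr, Fin.val_castAdd, zero_add]
        rw [Finset.sum_range, Matrix.mul_apply]
        refine Finset.sum_congr rfl fun l _ => ?_
        rw [← hU₁, ← hU₂, s₃.rarr (by omega), s₃.rarr (by omega), w₁.rarr (by omega),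
          w₁.rarr (by omega), s₃.iarr]
        rfl
      · rw [Fin.append_right, Fin.val_natAdd]
        rw [u₄ i (k + j) (by omega)]
        -- No list entry addresses a cell where `D` is zero, so the initial zero is still there; a
        -- non-zero cell is addressed by the entry that `en.symm` finds.
        by_cases hne : D ⟨M₁.iarr (o + 1) i, lt i⟩ j = 0
        · rw [hne]
          refine z₃ i i.2 j j.2 ?_
          rintro t ht ⟨h3, h4⟩
          apply (en ⟨t, ht⟩).2
          refine Eq.trans ?_ hne
          have hA := hen ⟨t, ht⟩
          simp only at hA
          congr 1
          · apply Fin.ext; rw [← hA.1]; simp only [h3]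
          · apply Fin.ext; rw [← hA.2.1]; simp only [h4]
        · set t := en.symm ⟨(_, j), hne⟩ with ht
          have hA := hen t
          rw [ht, Equiv.apply_symm_apply, ← ht] at hA
          simp only at hA
          have := v₃ t t.2
          rw [hA.1, hA.2.1, hA.2.2, p₁ i i.2] at this
          simpa using this

/-- Store in register `x` the number of positive entries of a non-increasing sequence. -/
def countPos (x T : ℕ) (n : IExp) : Prog :=
  .seq (.setReg x (.lit 0)) <| forLoop 1000 n <|
    .cond (.rlt .zero (.arr T (.lit 0) (.reg 1000)))
      (.setReg x (.add (.reg 1000) (.lit 1))) .skip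

/-- In a non-increasing sequence the positive entries form an initial segment, so the last positive
index plus one is their number. -/
theorem exec_countPos (O : SVDRoutine) (M : Mem) {x T y N : ℕ} (hx : x < 1000) (hxy : y ≠ x)
    (hy : y < 1000) (hN : M.reg y = N)
    (hT : ∀ i j, i ≤ j → j < N → M.rarr T 0 j ≤ M.rarr T 0 i) :
    ∃ M' t, Exec O (countPos x T (.reg y)) M M' t ∧ t ≤ 100 * (N + 1) ∧
      (∀ z < 1000, z ≠ x → M'.reg z = M.reg z) ∧ M'.iarr = M.iarr ∧ M'.rarr = M.rarr ∧
      M'.reg x ≤ N ∧ ∀ j < N, 0 < M.rarr T 0 j ↔ j < M'.reg x := by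
  obtain ⟨M', t, ex, ht, -, h1, h2, h3, h4, h5⟩ := exec_forLoop (O := O) (x := 1000) (n := .reg y)
    (body := .cond (.rlt .zero (.arr T (.lit 0) (.reg 1000)))
      (.setReg x (.add (.reg 1000) (.lit 1))) .skip) (M := M.setReg x 0) N 20
    (fun n M' => (∀ z < 1000, z ≠ x → M'.reg z = M.reg z) ∧ M'.iarr = M.iarr ∧
      M'.rarr = M.rarr ∧ M'.reg x ≤ n ∧ ∀ j < n, 0 < M.rarr T 0 j ↔ j < M'.reg x)
    (by
      refine ⟨fun z hz hz' => ?_, rfl, rfl, ?_, by simp⟩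
      · rw [Mem.setReg_reg_of_ne _ (by omega), Mem.setReg_reg_of_ne _ hz']
      · rw [Mem.setReg_reg_of_ne _ (by omega), Mem.setReg_reg_self])
    (fun n M' _ h => by simp only [IExp.eval]; rw [h.1 y hy hxy, hN])
    (by
      rintro n M' hn hr ⟨h1, h2, h3, h4, h5⟩
      by_cases hp : 0 < M.rarr T 0 n
      · refine ⟨_, _, .cond_true ?_ (.setReg _ _ _), by simp [BExp.cost, IExp.cost, RExp.cost], ?_,
          fun z hz hz' => ?_, h2, h3, ?_, ?_⟩
        · simpa [BExp.Holds, RExp.eval, IExp.eval, hr, h3] using hp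
        · rw [Mem.setReg_reg_of_ne _ (by omega), hr]
        · rw [Mem.setReg_reg_of_ne _ (by omega), Mem.setReg_reg_of_ne _ hz', h1 z hz hz']
        · rw [Mem.setReg_reg_of_ne _ (by omega), Mem.setReg_reg_self]
          simp [IExp.eval, hr]
        · intro j hj
          rw [Mem.setReg_reg_of_ne _ (by omega), Mem.setReg_reg_self]
          simp only [IExp.eval, hr, hj, iff_true]
          exact lt_of_lt_of_le hp (hT j n (by omega) hn)
      · refine ⟨M', _, .cond_false ?_ (.skip _), by simp [BExp.cost, IExp.cost, RExp.cost], hr,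
          fun z hz hz' => ?_, h2, h3, ?_, ?_⟩
        · simpa [BExp.Holds, RExp.eval, IExp.eval, hr, h3] using hp
        · rw [Mem.setReg_reg_of_ne _ (by omega), h1 z hz hz']
        · rw [Mem.setReg_reg_of_ne _ (by omega)]; omega
        · intro j hj
          rw [Mem.setReg_reg_of_ne _ (by omega)]
          rcases Nat.lt_succ_iff_lt_or_eq.1 hj with h'' | h''
          · exact h5 j h''
          · subst h''
            simp only [hp, false_iff]
            omega)
  refine ⟨M', _, .seq (.setReg _ _ _) ex, ?_, h1, h2, h3, h4, h5⟩
  simp only [IExp.cost] at ht ⊢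
  omega

/-! ### Orthonormalising `[U D]` from its touched rows -/

/-- From the touched rows of `B = [U D]`, compute the Gram matrix of the untouched rows of `U`
(array `o + 2`) and factors `L`, `R` (arrays `o + 6`, `o + 7`) such that `B * L` is an orthonormal
basis of the column space and `B = B * L * R`. -/
def orthonormalize (o : ℕ) : Prog :=
  .seq (fill (o + 1) (.reg 9) (.reg 9) (.reg o) .zero
    (.mul (.arr o (.reg 1002) (.reg 1000)) (.arr o (.reg 1002) (.reg 1001)))) <|
  .seq (fill (o + 2) (.reg 2) (.reg 2) (.lit 0)
    (.sub (.arr 9 (.reg 1000) (.reg 1001)) (.arr (o + 1) (.reg 1000) (.reg 1001))) .zero) <|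
  .seq (fill (o + 1) (.reg 2) (.reg 2) (.lit 0) (.arr 9 (.reg 1000) (.reg 1001)) .zero) <|
  .seq (.svd (.reg 9) (.reg 9) (.reg 9) (o + 1) (o + 3) (o + 4) (o + 5)) <|
  .seq (countPos (o + 1) (o + 4) (.reg 9)) <|
  .seq (fill (o + 6) (.reg 9) (.reg (o + 1)) (.lit 0)
    (.div (.arr (o + 3) (.reg 1000) (.reg 1001)) (.sqrt (.arr (o + 4) (.lit 0) (.reg 1001))))
    .zero) <|
  fill (o + 7) (.reg (o + 1)) (.reg 9) (.lit 0)
    (.mul (.sqrt (.arr (o + 4) (.lit 0) (.reg 1000))) (.arr (o + 3) (.reg 1001) (.reg 1000)))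
    .zero

noncomputable instance zeroRows.fintype {p q : ℕ} (E : Matrix (Fin p) (Fin q) ℝ) :
    Fintype (zeroRows E) :=
  Fintype.ofFinite _

/-- One side of an update after its first phase: `U` are the singular vectors and `D` is the
sparse matrix. -/
structure Prepared {m k s : ℕ} (M : Mem) (o z r ρ : ℕ) (U : Matrix (Fin m) (Fin k) ℝ)
    (D : Matrix (Fin m) (Fin s) ℝ) (idx : Fin r → Fin m) : Prop where
  reg_count : M.reg o = r
  reg_rank : M.reg (o + 1) = ρ
  count_le : r ≤ z
  injective : Function.Injective idx
  mem_zeroRows : ∀ i, i ∈ zeroRows D ↔ ∀ t, idx t ≠ i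
  list : ∀ t : Fin r, M.iarr (o + 1) t = idx t
  rows : M.block o r (k + s) = (appendCols U D).submatrix idx id
  gram : M.block (o + 2) k k = (U.submatrix (Subtype.val : zeroRows D → Fin m) id)ᵀ *
    U.submatrix (Subtype.val : zeroRows D → Fin m) id
  le_rank : k ≤ ρ
  rank_le : ρ ≤ k + s
  orth : (appendCols U D * M.block (o + 6) (k + s) ρ)ᵀ *
    (appendCols U D * M.block (o + 6) (k + s) ρ) = 1
  factor : appendCols U D * M.block (o + 6) (k + s) ρ * M.block (o + 7) ρ (k + s) =
    appendCols U D

/-- Carries the data of one side through phases that work elsewhere in memory. -/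
theorem Prepared.congr {m k s : ℕ} {M M' : Mem} {o z r ρ : ℕ} {U : Matrix (Fin m) (Fin k) ℝ}
    {D : Matrix (Fin m) (Fin s) ℝ} {idx : Fin r → Fin m} (h : Prepared M o z r ρ U D idx)
    (h0 : M'.reg o = M.reg o) (h1 : M'.reg (o + 1) = M.reg (o + 1))
    (hi : M'.iarr (o + 1) = M.iarr (o + 1))
    (hr : ∀ a, o ≤ a → a < o + 8 → M'.rarr a = M.rarr a) : Prepared M' o z r ρ U D idx := by
  have hb : ∀ a p q, o ≤ a → a < o + 8 → M'.block a p q = M.block a p q := by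
    intro a p q h1 h2
    simp only [Mem.block, hr a h1 h2]
  refine ⟨h0.trans h.reg_count, h1.trans h.reg_rank, h.count_le, h.injective, h.mem_zeroRows, ?_,
    ?_, ?_, h.le_rank, h.rank_le, ?_, ?_⟩
  · rw [hi]; exact h.list
  · rw [hb _ _ _ (by omega) (by omega)]; exact h.rows
  · rw [hb _ _ _ (by omega) (by omega)]; exact h.gram
  · rw [hb _ _ _ (by omega) (by omega)]; exact h.orth
  · rw [hb _ _ _ (by omega) (by omega), hb _ _ _ (by omega) (by omega)]; exact h.factor

/-- In the Gram matrix of `[U D]` the block `UᵀU` is the identity, and every other block contains a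
factor `D`, which vanishes on the untouched rows. So the whole matrix is found from the touched
rows. Subtracting their share from the identity gives the Gram matrix of the untouched rows of `U`,
needed later for the transition. The SVD, cut after its positive values, yields `L` and `R`. -/
theorem exec_orthonormalize {O : SVDRoutine} (hO : O.Correct) (M : Mem) {o : ℕ} (ho : 100 ≤ o)
    (ho' : o < 900) {m k s z : ℕ} (hk : 0 < k) (h2 : M.reg 2 = k)
    (h9 : M.reg 9 = k + s) (hid : M.block 9 k k = 1) {U : Matrix (Fin m) (Fin k) ℝ}
    (hU : Uᵀ * U = 1) {D : Matrix (Fin m) (Fin s) ℝ} {r : ℕ} (hr : M.reg o = r) (hrz : r ≤ z)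
    {idx : Fin r → Fin m} (hidx : Function.Injective idx)
    (hJ : ∀ i, i ∈ zeroRows D ↔ ∀ t, idx t ≠ i)
    (hB : M.block o r (k + s) = (appendCols U D).submatrix idx id) :
    ∃ M' t, Exec O (orthonormalize o) M M' t ∧ t ≤ 10000 * ((z + (k + s)) * (k + s) ^ 2) ∧
      M.Within o M' ∧ M'.reg o = r ∧ M'.iarr = M.iarr ∧ M'.rarr o = M.rarr o ∧
      M'.block (o + 2) k k = (U.submatrix (Subtype.val : zeroRows D → Fin m) id)ᵀ *
        U.submatrix (Subtype.val : zeroRows D → Fin m) id ∧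
      k ≤ M'.reg (o + 1) ∧ M'.reg (o + 1) ≤ k + s ∧
      (appendCols U D * M'.block (o + 6) (k + s) (M'.reg (o + 1)))ᵀ *
        (appendCols U D * M'.block (o + 6) (k + s) (M'.reg (o + 1))) = 1 ∧
      appendCols U D * M'.block (o + 6) (k + s) (M'.reg (o + 1)) *
        M'.block (o + 7) (M'.reg (o + 1)) (k + s) = appendCols U D := by
  have hN : 1 ≤ k + s := by omega
  set B := appendCols U D with hBdef
  have hBU : ∀ (i : Fin m) (j : Fin k), B i (Fin.castAdd s j) = U i j := by
    intro i j; simp [B, appendCols]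
  have hBD : ∀ (i : Fin m) (j : Fin s), B i (Fin.natAdd k j) = D i j := by
    intro i j; simp [B, appendCols]
  have hsplit := gram_split hidx hJ B B
  have hUsplit := gram_split hidx hJ U U
  -- the Gram matrix of the touched rows
  obtain ⟨M₁, t₁, ex₁, ht₁, s₁, v₁, -⟩ := exec_fill_block O M (o + 1) (.reg 9) (.reg 9) (.reg o)
    .zero (.mul (.arr o (.reg 1002) (.reg 1000)) (.arr o (.reg 1002) (.reg 1001)))
    (P := k + s) (Q := k + s) (R := r) h9 h9 hr (by simp [IExp.Below]) (by simp [IExp.Below])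
    (by simp [IExp.Below]; omega) trivial (by simp [RExp.Avoids, IExp.Below])
    (by simp [tabulateCost, IExp.cost, RExp.cost])
  have g₁ : M₁.block (o + 1) (k + s) (k + s) = (B.submatrix idx id)ᵀ * B.submatrix idx id := by
    ext i j
    rw [v₁, ← hB]
    simp [RExp.eval, IExp.eval, Matrix.mul_apply, Mem.block]
  have r1_2 : M₁.reg 2 = k := by rw [s₁.reg (by omega), h2]
  -- the Gram matrix of the untouched rows
  obtain ⟨M₂, t₂, ex₂, ht₂, s₂, v₂, -⟩ := exec_fill_block O M₁ (o + 2) (.reg 2) (.reg 2) (.lit 0)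
    (.sub (.arr 9 (.reg 1000) (.reg 1001)) (.arr (o + 1) (.reg 1000) (.reg 1001))) .zero
    (P := k) (Q := k) (R := 0) r1_2 r1_2 rfl (by simp [IExp.Below]) (by simp [IExp.Below])
    trivial (by simp [RExp.Avoids, IExp.Below]; omega) trivial
    (by simp [tabulateCost, IExp.cost, RExp.cost])
  have g₂ : M₂.block (o + 2) k k = (U.submatrix (Subtype.val : zeroRows D → Fin m) id)ᵀ *
        U.submatrix (Subtype.val : zeroRows D → Fin m) id := by
    rw [hU] at hUsplit
    rw [← sub_eq_iff_eq_add'.2 hUsplit]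
    ext i j
    rw [v₂]
    have a1 : M₁.rarr 9 i j = (1 : Matrix (Fin k) (Fin k) ℝ) i j := by
      rw [s₁.rarr (by omega), ← hid]; rfl
    have a2 : M₁.rarr (o + 1) i j =
        ((U.submatrix idx id)ᵀ * U.submatrix idx id : Matrix (Fin k) (Fin k) ℝ) i j := by
      have := congrFun (congrFun g₁ (Fin.castAdd s i)) (Fin.castAdd s j)
      simp only [Matrix.mul_apply, Matrix.transpose_apply, Matrix.submatrix_apply, hBU, id] at this ⊢
      exact this
    simp [RExp.eval, IExp.eval, a1, a2]
  have r2_2 : M₂.reg 2 = k := by rw [s₂.reg (by omega), r1_2]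
  -- the full Gram matrix
  obtain ⟨M₃, t₃, ex₃, ht₃, s₃, v₃, u₃⟩ := exec_fill_block O M₂ (o + 1) (.reg 2) (.reg 2) (.lit 0)
    (.arr 9 (.reg 1000) (.reg 1001)) .zero
    (P := k) (Q := k) (R := 0) r2_2 r2_2 rfl (by simp [IExp.Below]) (by simp [IExp.Below])
    trivial (by simp [RExp.Avoids, IExp.Below]; omega) trivial
    (by simp [tabulateCost, IExp.cost, RExp.cost])
  have g₃ : M₃.block (o + 1) (k + s) (k + s) = Bᵀ * B := by
    -- Outside the overwritten upper left block, array `o + 1` still holds the Gram matrix of the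
    -- touched rows.
    have out : ∀ i j : Fin (k + s), ¬ ((i : ℕ) < k ∧ (j : ℕ) < k) →
        M₃.block (o + 1) (k + s) (k + s) i j = ((B.submatrix idx id)ᵀ * B.submatrix idx id) i j := by
      intro i j hij
      rw [← g₁]
      simp only [Mem.block, Matrix.of_apply]
      rw [u₃ _ _ hij, s₂.rarr (by omega)]
    have hD0 : ∀ (i : zeroRows D) (j : Fin s), D i j = 0 := fun i j => i.2 j
    ext i j
    refine Fin.addCases (fun i => ?_) (fun i => ?_) i
    · refine Fin.addCases (fun j => ?_) (fun j => ?_) j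
      · have a1 := v₃ i j
        have a2 : M₂.rarr 9 i j = (1 : Matrix (Fin k) (Fin k) ℝ) i j := by
          rw [s₂.rarr (by omega), s₁.rarr (by omega), ← hid]; rfl
        simp only [RExp.eval, IExp.eval, Mem.counters_rarr, Mem.counters_reg_fst,
          Mem.counters_reg_snd, a2, Finset.univ_eq_empty, Finset.sum_empty, add_zero] at a1
        have a3 : (Bᵀ * B) (Fin.castAdd s i) (Fin.castAdd s j) = (Uᵀ * U) i j := by
          simp only [Matrix.mul_apply, Matrix.transpose_apply, hBU]
        rw [a3, hU, ← a1]
        rfl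
      · rw [out _ _ (by simp), hsplit, Matrix.add_apply, left_eq_add, Matrix.mul_apply]
        refine Finset.sum_eq_zero fun a _ => ?_
        simp [hBD, hD0]
    · rw [out _ _ (by simp), hsplit, Matrix.add_apply, left_eq_add, Matrix.mul_apply]
      refine Finset.sum_eq_zero fun a _ => ?_
      simp [hBD, hD0]
  have r3_9 : M₃.reg 9 = k + s := by
    rw [s₃.reg (by omega), s₂.reg (by omega), s₁.reg (by omega), h9]
  obtain ⟨M₄, t₄, ex₄, ht₄, svd₄, reg₄, ia₄, ra₄⟩ := exec_svd hO M₃ (.reg 9) (.reg 9) (.reg 9)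
    (o + 1) (o + 3) (o + 4) (o + 5) (P := k + s) (Q := k + s) (K := k + s) r3_9 r3_9 r3_9 le_rfl
    le_rfl (by omega) (by omega) (by omega)
  rw [g₃] at svd₄
  have r4_9 : M₄.reg 9 = k + s := by rw [reg₄, r3_9]
  obtain ⟨M₅, t₅, ex₅, ht₅, reg₅, ia₅, ra₅, rk₅, pos₅⟩ := exec_countPos O M₄ (x := o + 1)
    (T := o + 4) (y := 9) (N := k + s) (by omega) (by omega) (by omega) r4_9
    (fun i j hij hj => svd₄.antitone (a := ⟨i, by omega⟩) (b := ⟨j, hj⟩) hij)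
  set ρ := M₅.reg (o + 1) with hρ
  have r5_9 : M₅.reg 9 = k + s := by rw [reg₅ _ (by omega) (by omega), r4_9]
  obtain ⟨M₆, t₆, ex₆, ht₆, s₆, v₆, -⟩ := exec_fill_block O M₅ (o + 6) (.reg 9) (.reg (o + 1))
    (.lit 0)
    (.div (.arr (o + 3) (.reg 1000) (.reg 1001)) (.sqrt (.arr (o + 4) (.lit 0) (.reg 1001))))
    .zero (P := k + s) (Q := ρ) (R := 0) r5_9 rfl rfl (by simp [IExp.Below])
    (by simp [IExp.Below]; omega) trivial (by simp [RExp.Avoids, IExp.Below]) trivial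
    (by simp [tabulateCost, IExp.cost, RExp.cost])
  have r6_9 : M₆.reg 9 = k + s := by rw [s₆.reg (by omega), r5_9]
  have r6_1 : M₆.reg (o + 1) = ρ := s₆.reg (by omega)
  obtain ⟨M₇, t₇, ex₇, ht₇, s₇, v₇, -⟩ := exec_fill_block O M₆ (o + 7) (.reg (o + 1)) (.reg 9)
    (.lit 0)
    (.mul (.sqrt (.arr (o + 4) (.lit 0) (.reg 1000))) (.arr (o + 3) (.reg 1001) (.reg 1000)))
    .zero (P := ρ) (Q := k + s) (R := 0) r6_1 r6_9 rfl (by simp [IExp.Below]; omega)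
    (by simp [IExp.Below]) trivial (by simp [RExp.Avoids, IExp.Below]) trivial
    (by simp [tabulateCost, IExp.cost, RExp.cost])
  have r7_1 : M₇.reg (o + 1) = ρ := by rw [s₇.reg (by omega), r6_1]
  have hL : M₇.block (o + 6) (k + s) ρ = M₆.block (o + 6) (k + s) ρ :=
    s₇.block (by omega) _ _
  have fac := svd₄.gram_factor rk₅ (fun j => pos₅ j j.2) (L := M₇.block (o + 6) (k + s) ρ)
    (R := M₇.block (o + 7) ρ (k + s))
    (by
      intro i j
      rw [hL, v₆]
      simp [RExp.eval, IExp.eval, ra₅, Mem.block])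
    (by
      intro i j
      rw [v₇]
      simp only [RExp.eval, IExp.eval, Mem.counters_rarr, Mem.counters_reg_fst,
          Mem.counters_reg_snd, Finset.univ_eq_empty, Finset.sum_empty, add_zero]
      rw [s₆.rarr (by omega), s₆.rarr (by omega), ra₅]
      rfl)
  -- The first `k` columns of `B = B L R` express `U` through the `ρ` columns of `B L`.
  have hkρ : k ≤ ρ := by
    refine le_of_orthonormal_factor hU
      (Q := B * M₇.block (o + 6) (k + s) ρ)
      (R := (M₇.block (o + 7) ρ (k + s)).submatrix id (Fin.castAdd s)) ?_
    ext i j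
    rw [← hBU]
    exact congrFun (congrFun fac.2 i) (Fin.castAdd s j)
  refine ⟨M₇, _, .seq ex₁ (.seq ex₂ (.seq ex₃ (.seq ex₄ (.seq ex₅ (.seq ex₆ ex₇))))), ?_, ?_, ?_,
    ?_, ?_, ?_, ?_, ?_, ?_, ?_⟩
  · have b0 := le_cost (z := z) hN
    have b1 := cost_bound' (z := z) (P := k + s) (Q := k + s) (R := r) hN le_rfl le_rfl (by omega)
    have b2 := cost_bound (z := z) (P := k) (Q := k) (R := 0) hN (by omega) (by omega) (by omega)
    have b3 := cost_bound (z := z) (P := k + s) (Q := ρ) (R := 0) hN (by omega) (by omega)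
      (by omega)
    have b4 := cost_bound (z := z) (P := ρ) (Q := k + s) (R := 0) hN (by omega) (by omega)
      (by omega)
    have b5 : (k + s + (k + s)) ^ 3 ≤ 8 * ((z + (k + s)) * (k + s) ^ 2) := by
      have := cube_le_cost (z := z) (N := k + s)
      calc (k + s + (k + s)) ^ 3 = 8 * (k + s) ^ 3 := by ring
        _ ≤ _ := by omega
    simp only [IExp.cost] at ht₄
    omega
  · refine (s₁.within (by omega) (by omega)).trans <| (s₂.within (by omega) (by omega)).trans <|
      (s₃.within (by omega) (by omega)).trans <| Mem.Within.trans (M' := M₅) ?_ <|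
      (s₆.within (by omega) (by omega)).trans (s₇.within (by omega) (by omega))
    refine ⟨fun hx hx' => ?_, fun _ => by rw [ia₅, ia₄], fun ha => ?_⟩
    · rw [reg₅ _ hx (by omega), reg₄]
    · rw [ra₅, ra₄ (by omega) (by omega) (by omega)]
  · rw [s₇.reg (by omega), s₆.reg (by omega), reg₅ _ (by omega) (by omega), reg₄,
      s₃.reg (by omega), s₂.reg (by omega), s₁.reg (by omega), hr]
  · rw [s₇.iarr, s₆.iarr, ia₅, ia₄, s₃.iarr, s₂.iarr, s₁.iarr]
  · rw [s₇.rarr (by omega), s₆.rarr (by omega), ra₅, ra₄ (by omega) (by omega) (by omega),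
      s₃.rarr (by omega), s₂.rarr (by omega), s₁.rarr (by omega)]
  · rw [← g₂, s₇.block (by omega), s₆.block (by omega), ← s₃.block (a := o + 2) (by omega)]
    simp only [Mem.block, ra₅, ra₄ (show o + 2 ≠ o + 3 by omega) (show o + 2 ≠ o + 4 by omega)
      (show o + 2 ≠ o + 5 by omega)]
  · rw [r7_1]; exact hkρ
  · rw [r7_1]; exact rk₅
  · rw [r7_1]; exact fac.1
  · rw [r7_1]; exact fac.2

/-- The first phase of an update, on one side. -/
def prepare (o u₁ u₂ len row col val : ℕ) : Prog :=
  .seq (gather o u₁ u₂ len row col val) (orthonormalize o)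

theorem exec_prepare {O : SVDRoutine} (hO : O.Correct) (M : Mem) {o u₁ u₂ len row col val : ℕ}
    (ho : 100 ≤ o)
    (ho' : o < 900) (hu₁ : u₁ < 100) (hu₂ : u₂ < 100) (hlen : len < 100) (hrow : row < 100)
    (hcol : col < 100) (hval : val < 100) {m k s z : ℕ} (hk : 0 < k) (h2 : M.reg 2 = k)
    (h9 : M.reg 9 = k + s) (hid : M.block 9 k k = 1)
    {U₁ : Matrix (Fin m) (Fin k) ℝ} {U₂ : Matrix (Fin k) (Fin k) ℝ}
    {D : Matrix (Fin m) (Fin s) ℝ} (hU₁ : M.block u₁ m k = U₁) (hU₂ : M.block u₂ k k = U₂)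
    (hU : (U₁ * U₂)ᵀ * (U₁ * U₂) = 1)
    (hD : GivenSparse M len row col val D) (hz : M.reg len ≤ z) :
    ∃ M' t, Exec O (prepare o u₁ u₂ len row col val) M M' t ∧
      t ≤ 12000 * ((z + (k + s)) * (k + s) ^ 2) ∧ M.Within o M' ∧
      ∃ r ρ idx, Prepared M' o z r ρ (U₁ * U₂) D idx := by
  obtain ⟨M₁, t₁, ex₁, ht₁, w₁, c₁, idx, hidx, hJ, hl, hB⟩ := exec_gather O M ho ho' hu₁ hu₂ hlen
    hrow hcol hval hk h2 h9 hU₁ hU₂ hD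
  obtain ⟨M₂, t₂, ex₂, ht₂, w₂, r₂, ia₂, ra₂, a1, a2, a3, a4, a5⟩ := exec_orthonormalize hO M₁ ho ho'
    (z := z) hk (by rw [w₁.reg (by omega) (by omega), h2])
    (by rw [w₁.reg (by omega) (by omega), h9])
    (by rw [← hid]; simp only [Mem.block, w₁.rarr (show 9 < o ∨ o + 50 ≤ 9 by omega)]) hU rfl
    (by omega) hidx hJ hB
  refine ⟨M₂, _, .seq ex₁ ex₂, ?_, w₁.trans w₂, M₁.reg o, _, idx, r₂, rfl, by omega, hidx, hJ, ?_,
    ?_, a1, a2, a3, a4, a5⟩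
  · have : (M.reg len + (k + s)) * (k + s) ^ 2 ≤ (z + (k + s)) * (k + s) ^ 2 := by gcongr
    omega
  · rw [ia₂]; exact hl
  · rw [← hB]; simp only [Mem.block, ra₂]

/-! ### Transition to the new singular vectors -/

/-- New singular vectors on the touched rows (array `o + 9`), and the test for the completion of the
transition matrix (array `o + 17`). -/
def transition (o fx : ℕ) : Prog :=
  .seq (matMul (o + 8) (o + 6) fx (.reg 9) (.reg 2) (.reg (o + 1))) <|
  .seq (matMul (o + 9) o (o + 8) (.reg o) (.reg 2) (.reg 9)) <|
  .seq (matMul (o + 10) (o + 2) (o + 8) (.reg 2) (.reg 2) (.reg 2)) <|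
  .seq (.svd (.reg 2) (.reg 2) (.reg 2) (o + 10) (o + 11) (o + 12) (o + 13)) <|
  .seq (fill (o + 14) (.reg 2) (.reg 2) (.lit 0)
    (.mul (.arr (o + 11) (.reg 1000) (.reg 1001)) (.sub .one
      (.div (.arr (o + 12) (.lit 0) (.reg 1001)) (.arr (o + 12) (.lit 0) (.reg 1001))))) .zero) <|
  .seq (matMul (o + 15) (o + 2) (o + 14) (.reg 2) (.reg 2) (.reg 2)) <|
  .seq (fill (o + 16) (.lit 1) (.reg 2) (.reg 2) .zero
    (.mul (.arr (o + 15) (.reg 1002) (.reg 1001)) (.arr (o + 15) (.reg 1002) (.reg 1001)))) <|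
  fill (o + 17) (.lit 1) (.lit 1) (.reg 2) .zero (.arr (o + 16) (.lit 0) (.reg 1002))

theorem square_svd_cost {z k s : ℕ} : (k + k) ^ 3 ≤ 8 * ((z + (k + s)) * (k + s) ^ 2) := by
  have := cube_le_cost (z := z) (N := k + s)
  calc (k + k) ^ 3 = 8 * k ^ 3 := by ring
    _ ≤ 8 * (k + s) ^ 3 := by gcongr; omega
    _ ≤ _ := by omega

/-- With `F` in array `fx`, the top block `W` of `L * F` describes the passage from the old to the
new singular vectors on untouched rows. Its completion is safe if `H * F₀ = 0`, with `H` in array `o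
+ 2` and `F₀` in array `o + 14`; a sum of squares turns this matrix equation into a single
comparison with zero. -/
theorem exec_transition {O : SVDRoutine} (hO : O.Correct) (M : Mem) {o fx : ℕ} (ho : 100 ≤ o)
    (ho' : o < 900) (hfx : fx < o ∨ o + 50 ≤ fx) {k s z r ρ : ℕ} (hk : 0 < k) (h2 : M.reg 2 = k)
    (h9 : M.reg 9 = k + s) (hr : M.reg o = r) (hrz : r ≤ z) (hρ : M.reg (o + 1) = ρ)
    (hρN : ρ ≤ k + s) :
    ∃ M' t, Exec O (transition o fx) M M' t ∧ t ≤ 10000 * ((z + (k + s)) * (k + s) ^ 2) ∧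
      (∀ x < 1000, M'.reg x = M.reg x) ∧ M'.iarr = M.iarr ∧
      (∀ a, a < o + 8 ∨ o + 50 ≤ a → M'.rarr a = M.rarr a) ∧
      M'.block (o + 8) (k + s) k = M.block (o + 6) (k + s) ρ * M.block fx ρ k ∧
      M'.block (o + 9) r k = M.block o r (k + s) * M'.block (o + 8) (k + s) k ∧
      IsTruncSVD k (M.block (o + 2) k k * M'.block (o + 8) k k) (M'.block (o + 11) k k)
        (fun j => M'.rarr (o + 12) 0 j) (M'.block (o + 13) k k) ∧
      M'.block (o + 14) k k = M'.block (o + 11) k k * (Matrix.diagonal fun j : Fin k =>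
        1 - M'.rarr (o + 12) 0 j / M'.rarr (o + 12) 0 j) ∧
      (M'.rarr (o + 17) 0 0 = 0 ↔ M.block (o + 2) k k * M'.block (o + 14) k k = 0) := by
  have hN : 1 ≤ k + s := by omega
  obtain ⟨M₁, t₁, ex₁, ht₁, s₁, v₁⟩ := exec_matMul O M (o + 8) (o + 6) fx (.reg 9) (.reg 2)
    (.reg (o + 1)) h9 h2 hρ (by simp [IExp.Below]) (by simp [IExp.Below])
    (by simp [IExp.Below]; omega) (by omega) (by omega) (by simp [IExp.cost])
  obtain ⟨M₂, t₂, ex₂, ht₂, s₂, v₂⟩ := exec_matMul O M₁ (o + 9) o (o + 8) (.reg o) (.reg 2)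
    (.reg 9) (P := r) (Q := k) (R := k + s) (by rw [← hr]; exact s₁.reg (by omega))
    (by rw [← h2]; exact s₁.reg (by omega)) (by rw [← h9]; exact s₁.reg (by omega))
    (by simp [IExp.Below]; omega) (by simp [IExp.Below])
    (by simp [IExp.Below]) (by omega) (by omega) (by simp [IExp.cost])
  have r2_2 : M₂.reg 2 = k := by rw [s₂.reg (by omega), s₁.reg (by omega), h2]
  obtain ⟨M₃, t₃, ex₃, ht₃, s₃, v₃⟩ := exec_matMul O M₂ (o + 10) (o + 2) (o + 8) (.reg 2) (.reg 2)
    (.reg 2) r2_2 r2_2 r2_2 (by simp [IExp.Below]) (by simp [IExp.Below])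
    (by simp [IExp.Below]) (by omega) (by omega) (by simp [IExp.cost])
  have r3_2 : M₃.reg 2 = k := by rw [s₃.reg (by omega), r2_2]
  obtain ⟨M₄, t₄, ex₄, ht₄, svd₄, reg₄, ia₄, ra₄⟩ := exec_svd hO M₃ (.reg 2) (.reg 2) (.reg 2)
    (o + 10) (o + 11) (o + 12) (o + 13) r3_2 r3_2 r3_2 le_rfl le_rfl (by omega) (by omega)
    (by omega)
  have r4_2 : M₄.reg 2 = k := by rw [reg₄, r3_2]
  obtain ⟨M₅, t₅, ex₅, ht₅, s₅, v₅, -⟩ := exec_fill_block O M₄ (o + 14) (.reg 2) (.reg 2) (.lit 0)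
    (.mul (.arr (o + 11) (.reg 1000) (.reg 1001)) (.sub .one
      (.div (.arr (o + 12) (.lit 0) (.reg 1001)) (.arr (o + 12) (.lit 0) (.reg 1001))))) .zero
    (R := 0) r4_2 r4_2 rfl (by simp [IExp.Below]) (by simp [IExp.Below]) trivial
    (by simp [RExp.Avoids, IExp.Below]) trivial (by simp [tabulateCost, IExp.cost, RExp.cost])
  have r5_2 : M₅.reg 2 = k := by rw [s₅.reg (by omega), r4_2]
  obtain ⟨M₆, t₆, ex₆, ht₆, s₆, v₆⟩ := exec_matMul O M₅ (o + 15) (o + 2) (o + 14) (.reg 2) (.reg 2)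
    (.reg 2) r5_2 r5_2 r5_2 (by simp [IExp.Below]) (by simp [IExp.Below])
    (by simp [IExp.Below]) (by omega) (by omega) (by simp [IExp.cost])
  have r6_2 : M₆.reg 2 = k := by rw [s₆.reg (by omega), r5_2]
  obtain ⟨M₇, t₇, ex₇, ht₇, s₇, v₇, -⟩ := exec_fill_block O M₆ (o + 16) (.lit 1) (.reg 2) (.reg 2)
    .zero (.mul (.arr (o + 15) (.reg 1002) (.reg 1001)) (.arr (o + 15) (.reg 1002) (.reg 1001)))
    (P := 1) rfl r6_2 r6_2 trivial (by simp [IExp.Below]) (by simp [IExp.Below]) trivial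
    (by simp [RExp.Avoids, IExp.Below]) (by simp [tabulateCost, IExp.cost, RExp.cost])
  have r7_2 : M₇.reg 2 = k := by rw [s₇.reg (by omega), r6_2]
  obtain ⟨M₈, t₈, ex₈, ht₈, s₈, v₈, -⟩ := exec_fill_block O M₇ (o + 17) (.lit 1) (.lit 1) (.reg 2)
    .zero (.arr (o + 16) (.lit 0) (.reg 1002))
    (P := 1) (Q := 1) rfl rfl r7_2 trivial trivial (by simp [IExp.Below]) trivial
    (by simp [RExp.Avoids, IExp.Below]) (by simp [tabulateCost, IExp.cost, RExp.cost])
  -- arrays that are not written after a given step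
  have f84 : ∀ a, a < o + 14 ∨ o + 18 ≤ a → M₈.rarr a = M₄.rarr a := by
    intro a ha
    rw [s₈.rarr (by omega), s₇.rarr (by omega), s₆.rarr (by omega), s₅.rarr (by omega)]
  have f83 : ∀ a, a < o + 11 ∨ o + 18 ≤ a → M₈.rarr a = M₃.rarr a := by
    intro a ha
    rw [f84 _ (by omega), ra₄ (by omega) (by omega) (by omega)]
  have f8 : ∀ a, a < o + 8 ∨ o + 18 ≤ a → M₈.rarr a = M.rarr a := by
    intro a ha
    rw [f83 _ (by omega), s₃.rarr (by omega), s₂.rarr (by omega), s₁.rarr (by omega)]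
  have f5 : ∀ a, a < o + 8 → M₅.rarr a = M.rarr a := by
    intro a ha
    rw [← f8 a (by omega), s₈.rarr (by omega), s₇.rarr (by omega), s₆.rarr (by omega)]
  have b81 : ∀ p q, M₈.block (o + 8) p q = M₁.block (o + 8) p q := by
    intro p q
    simp only [Mem.block, f83 (o + 8) (by omega), s₃.rarr (show o + 8 ≠ o + 10 by omega),
      s₂.rarr (show o + 8 ≠ o + 9 by omega)]
  have b14 : M₈.block (o + 14) k k = M₅.block (o + 14) k k := by
    rw [s₈.block (by omega), s₇.block (by omega), s₆.block (by omega)]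
  refine ⟨M₈, _, .seq ex₁ (.seq ex₂ (.seq ex₃ (.seq ex₄ (.seq ex₅ (.seq ex₆ (.seq ex₇ ex₈)))))),
    ?_, ?_, ?_, fun a ha => f8 a (by omega), ?_, ?_, ?_, ?_, ?_⟩
  · have b0 := le_cost (z := z) hN
    have b1 := cost_bound (z := z) (P := k + s) (Q := k) (R := ρ) hN (by omega) (by omega) hρN
    have b2 := cost_bound (z := z) (P := r) (Q := k) (R := k + s) hN (by omega) (by omega)
      (by omega)
    have b3 := cost_bound (z := z) (P := k) (Q := k) (R := k) hN (by omega) (by omega) (by omega)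
    have b4 := cost_bound (z := z) (P := k) (Q := k) (R := 0) hN (by omega) (by omega) (by omega)
    have b5 := cost_bound (z := z) (P := 1) (Q := k) (R := k) hN (by omega) (by omega) (by omega)
    have b6 := cost_bound (z := z) (P := 1) (Q := 1) (R := k) hN (by omega) (by omega) (by omega)
    have b7 := square_svd_cost (z := z) (k := k) (s := s)
    simp only [IExp.cost] at ht₄
    omega
  · intro x hx
    rw [s₈.reg hx, s₇.reg hx, s₆.reg hx, s₅.reg hx, reg₄, s₃.reg hx, s₂.reg hx, s₁.reg hx]
  · rw [s₈.iarr, s₇.iarr, s₆.iarr, s₅.iarr, ia₄, s₃.iarr, s₂.iarr, s₁.iarr]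
  · rw [b81, v₁]
  · rw [b81, ← s₁.block (a := o) (by omega), ← v₂]
    simp only [Mem.block, f83 (o + 9) (by omega), s₃.rarr (show o + 9 ≠ o + 10 by omega)]
  · have e1 : M₃.block (o + 10) k k = M.block (o + 2) k k * M₈.block (o + 8) k k := by
      rw [v₃, b81, s₂.block (by omega), s₁.block (by omega), s₂.block (by omega)]
    rw [e1] at svd₄
    simpa only [Mem.block, f84 (o + 11) (by omega), f84 (o + 12) (by omega),
      f84 (o + 13) (by omega)] using svd₄
  · rw [b14]
    ext i j
    rw [v₅, Matrix.mul_diagonal]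
    simp [RExp.eval, IExp.eval, Mem.block, f84 (o + 11) (by omega), f84 (o + 12) (by omega)]
  · have e1 : M₆.block (o + 15) k k = M.block (o + 2) k k * M₈.block (o + 14) k k := by
      rw [v₆, b14]
      simp only [Mem.block, f5 (o + 2) (by omega)]
    rw [← e1]
    have e2 : M₈.rarr (o + 17) 0 0 = ∑ j : Fin k, ∑ i : Fin k,
        M₆.block (o + 15) k k i j * M₆.block (o + 15) k k i j := by
      have := v₈ 0 0
      simp only [RExp.eval, IExp.eval, Mem.counters_rarr, Mem.counters_reg_trd, zero_add] at this
      refine Eq.trans this (Finset.sum_congr rfl fun j _ => ?_)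
      refine Eq.trans (v₇ 0 j) ?_
      simp [RExp.eval, IExp.eval, Mem.block]
    rw [e2, Finset.sum_eq_zero_iff_of_nonneg fun j _ =>
      Finset.sum_nonneg fun i _ => mul_self_nonneg _]
    simp only [Finset.sum_eq_zero_iff_of_nonneg fun i _ => mul_self_nonneg _, Finset.mem_univ,
      true_imp_iff, mul_self_eq_zero]
    exact ⟨fun h => by ext i j; exact h j i, fun h j i => by rw [h]; rfl⟩

/-- Multiply the small factor by the completed transition matrix. -/
def multiplySmall (o u₂ : ℕ) : Prog :=
  .seq (fill (o + 18) (.reg 2) (.reg 2) (.reg 2)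
    (.sub .zero (.arr (o + 13) (.reg 1001) (.reg 1000)))
    (.mul (.arr (o + 14) (.reg 1002) (.reg 1000)) (.arr (o + 8) (.reg 1002) (.reg 1001)))) <|
  .seq (fill (o + 19) (.reg 2) (.reg 2) (.reg 2) (.arr (o + 8) (.reg 1000) (.reg 1001))
    (.sub .zero
      (.mul (.arr (o + 14) (.reg 1000) (.reg 1002)) (.arr (o + 18) (.reg 1002) (.reg 1001))))) <|
  .seq (matMul (o + 20) u₂ (o + 19) (.reg 2) (.reg 2) (.reg 2)) <|
  .seq (.svd (.reg 2) (.reg 2) (.reg 2) (o + 20) (o + 21) (o + 22) (o + 23)) <|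
  .seq (fill (o + 24) (.reg 2) (.reg 2) (.reg 2) .zero
    (.mul (.arr (o + 23) (.reg 1000) (.reg 1002)) (.div (.arr (o + 21) (.reg 1001) (.reg 1002))
      (.arr (o + 22) (.lit 0) (.reg 1002))))) <|
  fill u₂ (.reg 2) (.reg 2) (.lit 0) (.arr (o + 20) (.reg 1000) (.reg 1001)) .zero

/-- On the untouched rows only `H * W` matters, so the completed matrix may replace `W`. It is
invertible, as is the old small factor, and a further SVD yields the inverse of their product, which
the touched rows will need. -/
theorem exec_multiplySmall {O : SVDRoutine} (hO : O.Correct) (M : Mem) {o u₂ : ℕ} (ho : 100 ≤ o)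
    (ho' : o < 900) (hu₂ : u₂ < 100) {k s z : ℕ} (hk : 0 < k) (h2 : M.reg 2 = k)
    {H : Matrix (Fin k) (Fin k) ℝ}
    (hsvd : IsTruncSVD k (H * M.block (o + 8) k k) (M.block (o + 11) k k)
        (fun j => M.rarr (o + 12) 0 j) (M.block (o + 13) k k))
    (hF₀ : M.block (o + 14) k k = M.block (o + 11) k k * (Matrix.diagonal fun j : Fin k =>
        1 - M.rarr (o + 12) 0 j / M.rarr (o + 12) 0 j))
    (hH : H * M.block (o + 14) k k = 0) (hU₂ : IsUnit (M.block u₂ k k)) :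
    ∃ M' t, Exec O (multiplySmall o u₂) M M' t ∧ t ≤ 10000 * ((z + (k + s)) * (k + s) ^ 2) ∧
      (∀ x < 1000, M'.reg x = M.reg x) ∧ M'.iarr = M.iarr ∧
      (∀ a, a ≠ u₂ → a < o + 18 ∨ o + 50 ≤ a → M'.rarr a = M.rarr a) ∧
      (∃ W', H * W' = H * M.block (o + 8) k k ∧ M'.block u₂ k k = M.block u₂ k k * W') ∧
      M'.block (o + 24) k k * M'.block u₂ k k = 1 := by
  have hN : 1 ≤ k + s := by omega
  obtain ⟨M₁, t₁, ex₁, ht₁, s₁, v₁, -⟩ := exec_fill_block O M (o + 18) (.reg 2) (.reg 2) (.reg 2)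
    (.sub .zero (.arr (o + 13) (.reg 1001) (.reg 1000)))
    (.mul (.arr (o + 14) (.reg 1002) (.reg 1000)) (.arr (o + 8) (.reg 1002) (.reg 1001)))
    h2 h2 h2 (by simp [IExp.Below]) (by simp [IExp.Below]) (by simp [IExp.Below])
    (by simp [RExp.Avoids, IExp.Below]) (by simp [RExp.Avoids, IExp.Below])
    (by simp [tabulateCost, IExp.cost, RExp.cost])
  have r1_2 : M₁.reg 2 = k := by rw [s₁.reg (by omega), h2]
  obtain ⟨M₂, t₂, ex₂, ht₂, s₂, v₂, -⟩ := exec_fill_block O M₁ (o + 19) (.reg 2) (.reg 2) (.reg 2)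
    (.arr (o + 8) (.reg 1000) (.reg 1001))
    (.sub .zero
      (.mul (.arr (o + 14) (.reg 1000) (.reg 1002)) (.arr (o + 18) (.reg 1002) (.reg 1001))))
    r1_2 r1_2 r1_2 (by simp [IExp.Below]) (by simp [IExp.Below]) (by simp [IExp.Below])
    (by simp [RExp.Avoids, IExp.Below]) (by simp [RExp.Avoids, IExp.Below])
    (by simp [tabulateCost, IExp.cost, RExp.cost])
  have e1 : M₁.block (o + 18) k k =
      (M.block (o + 14) k k)ᵀ * M.block (o + 8) k k - (M.block (o + 13) k k)ᵀ := by
    ext i j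
    rw [v₁]
    simp only [RExp.eval, IExp.eval, Mem.counters_rarr, Mem.counters_reg_fst, Mem.counters_reg_snd,
      Mem.counters_reg_trd, Matrix.sub_apply, Matrix.mul_apply, Matrix.transpose_apply, Mem.block,
      Matrix.of_apply]
    ring
  have e2 : M₂.block (o + 19) k k = M.block (o + 8) k k - M.block (o + 14) k k *
      ((M.block (o + 14) k k)ᵀ * M.block (o + 8) k k - (M.block (o + 13) k k)ᵀ) := by
    rw [← e1]
    ext i j
    rw [v₂]
    simp only [RExp.eval, IExp.eval, Mem.counters_rarr, Mem.counters_reg_fst, Mem.counters_reg_snd,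
      Mem.counters_reg_trd, Matrix.sub_apply, Matrix.mul_apply, Mem.block,
      Matrix.of_apply, s₁.rarr (show o + 8 ≠ o + 18 by omega),
      s₁.rarr (show o + 14 ≠ o + 18 by omega), zero_sub, Finset.sum_neg_distrib]
    ring
  obtain ⟨c1, c2⟩ := isUnit_completion hsvd hF₀ hH e2
  have r2_2 : M₂.reg 2 = k := by rw [s₂.reg (by omega), r1_2]
  obtain ⟨M₃, t₃, ex₃, ht₃, s₃, v₃⟩ := exec_matMul O M₂ (o + 20) u₂ (o + 19) (.reg 2) (.reg 2)
    (.reg 2) r2_2 r2_2 r2_2 (by simp [IExp.Below]) (by simp [IExp.Below])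
    (by simp [IExp.Below]) (by omega) (by omega) (by simp [IExp.cost])
  rw [s₂.block (by omega), s₁.block (by omega)] at v₃
  have r3_2 : M₃.reg 2 = k := by rw [s₃.reg (by omega), r2_2]
  obtain ⟨M₄, t₄, ex₄, ht₄, svd₄, reg₄, ia₄, ra₄⟩ := exec_svd hO M₃ (.reg 2) (.reg 2) (.reg 2)
    (o + 20) (o + 21) (o + 22) (o + 23) r3_2 r3_2 r3_2 le_rfl le_rfl (by omega) (by omega)
    (by omega)
  have inv := svd₄.inverse_mul (by rw [v₃]; exact hU₂.mul c2)
  have r4_2 : M₄.reg 2 = k := by rw [reg₄, r3_2]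
  obtain ⟨M₅, t₅, ex₅, ht₅, s₅, v₅, -⟩ := exec_fill_block O M₄ (o + 24) (.reg 2) (.reg 2) (.reg 2)
    .zero (.mul (.arr (o + 23) (.reg 1000) (.reg 1002))
      (.div (.arr (o + 21) (.reg 1001) (.reg 1002)) (.arr (o + 22) (.lit 0) (.reg 1002))))
    r4_2 r4_2 r4_2 (by simp [IExp.Below]) (by simp [IExp.Below]) (by simp [IExp.Below]) trivial
    (by simp [RExp.Avoids, IExp.Below]) (by simp [tabulateCost, IExp.cost, RExp.cost])
  have r5_2 : M₅.reg 2 = k := by rw [s₅.reg (by omega), r4_2]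
  obtain ⟨M₆, t₆, ex₆, ht₆, s₆, v₆, -⟩ := exec_fill_block O M₅ u₂ (.reg 2) (.reg 2) (.lit 0)
    (.arr (o + 20) (.reg 1000) (.reg 1001)) .zero (R := 0)
    r5_2 r5_2 rfl (by simp [IExp.Below]) (by simp [IExp.Below]) trivial
    (by simp [RExp.Avoids, IExp.Below]; omega) trivial
    (by simp [tabulateCost, IExp.cost, RExp.cost])
  have e6 : M₆.block u₂ k k = M₃.block (o + 20) k k := by
    ext i j
    rw [v₆]
    simp [RExp.eval, IExp.eval, Mem.block, s₅.rarr (show o + 20 ≠ o + 24 by omega),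
      ra₄ (show o + 20 ≠ o + 21 by omega) (show o + 20 ≠ o + 22 by omega)
        (show o + 20 ≠ o + 23 by omega)]
  refine ⟨M₆, _, .seq ex₁ (.seq ex₂ (.seq ex₃ (.seq ex₄ (.seq ex₅ ex₆)))), ?_, ?_, ?_, ?_, ?_, ?_⟩
  · have b0 := le_cost (z := z) hN
    have b3 := cost_bound (z := z) (P := k) (Q := k) (R := k) hN (by omega) (by omega) (by omega)
    have b4 := cost_bound (z := z) (P := k) (Q := k) (R := 0) hN (by omega) (by omega) (by omega)
    have b7 := square_svd_cost (z := z) (k := k) (s := s)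
    simp only [IExp.cost] at ht₄
    omega
  · intro x hx
    rw [s₆.reg hx, s₅.reg hx, reg₄, s₃.reg hx, s₂.reg hx, s₁.reg hx]
  · rw [s₆.iarr, s₅.iarr, ia₄, s₃.iarr, s₂.iarr, s₁.iarr]
  · intro a ha ha'
    rw [s₆.rarr ha, s₅.rarr (by omega), ra₄ (by omega) (by omega) (by omega), s₃.rarr (by omega),
      s₂.rarr (by omega), s₁.rarr (by omega)]
  · exact ⟨_, c1, e6.trans v₃⟩
  · rw [e6, ← inv, s₆.block (by omega)]
    congr 1
    ext i j
    rw [v₅, Matrix.mul_apply]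
    simp [RExp.eval, IExp.eval, Matrix.mul_diagonal, Mem.block, div_eq_inv_mul, mul_assoc]

/-- Multiply the tall factor by the small one and by the transition matrix. -/
def multiplyTall (o u₁ u₂ mr : ℕ) : Prog :=
  .seq (matMul (o + 25) u₁ u₂ (.reg mr) (.reg 2) (.reg 2)) <|
  .seq (matMul u₁ (o + 25) (o + 8) (.reg mr) (.reg 2) (.reg 2)) <|
  .seq (fill u₂ (.reg 2) (.reg 2) (.lit 0) (.arr 9 (.reg 1000) (.reg 1001)) .zero) <|
  fill (o + 24) (.reg 2) (.reg 2) (.lit 0) (.arr 9 (.reg 1000) (.reg 1001)) .zero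

/-- The fallback, whose cost depends on `m` and is not bounded here. With the small factor and its
inverse both set to the identity, the touched rows can afterwards be rewritten exactly as in the
fast branch. -/
theorem exec_multiplyTall (O : SVDRoutine) (M : Mem) {o u₁ u₂ mr : ℕ} (ho : 100 ≤ o)
    (ho' : o < 900) (hu₁ : u₁ < 9) (hu₂ : u₂ < 9) (hu : u₁ ≠ u₂) (hmr : mr < 100) {m k : ℕ}
    (h2 : M.reg 2 = k) (hm : M.reg mr = m) (hid : M.block 9 k k = 1) :
    ∃ M' t, Exec O (multiplyTall o u₁ u₂ mr) M M' t ∧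
      (∀ x < 1000, M'.reg x = M.reg x) ∧ M'.iarr = M.iarr ∧
      (∀ a, a ≠ u₁ → a ≠ u₂ → a < o + 18 ∨ o + 50 ≤ a → M'.rarr a = M.rarr a) ∧
      M'.block u₁ m k = M.block u₁ m k * M.block u₂ k k * M.block (o + 8) k k ∧
      M'.block u₂ k k = 1 ∧ M'.block (o + 24) k k = 1 := by
  obtain ⟨M₁, t₁, ex₁, -, s₁, v₁⟩ := exec_matMul O M (o + 25) u₁ u₂ (.reg mr) (.reg 2)
    (.reg 2) hm h2 h2 (by simp [IExp.Below]; omega) (by simp [IExp.Below])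
    (by simp [IExp.Below]) (by omega) (by omega) (by simp [IExp.cost])
  have r1_2 : M₁.reg 2 = k := by rw [s₁.reg (by omega), h2]
  have r1_m : M₁.reg mr = m := by rw [s₁.reg (by omega), hm]
  obtain ⟨M₂, t₂, ex₂, -, s₂, v₂⟩ := exec_matMul O M₁ u₁ (o + 25) (o + 8) (.reg mr) (.reg 2)
    (.reg 2) r1_m r1_2 r1_2 (by simp [IExp.Below]; omega) (by simp [IExp.Below])
    (by simp [IExp.Below]) (by omega) (by omega) (by simp [IExp.cost])
  have r2_2 : M₂.reg 2 = k := by rw [s₂.reg (by omega), r1_2]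
  obtain ⟨M₃, t₃, ex₃, -, s₃, v₃, -⟩ := exec_fill_block O M₂ u₂ (.reg 2) (.reg 2) (.lit 0)
    (.arr 9 (.reg 1000) (.reg 1001)) .zero (R := 0)
    r2_2 r2_2 rfl (by simp [IExp.Below]) (by simp [IExp.Below]) trivial
    (by simp [RExp.Avoids, IExp.Below]; omega) trivial
    (by simp [tabulateCost, IExp.cost, RExp.cost])
  have r3_2 : M₃.reg 2 = k := by rw [s₃.reg (by omega), r2_2]
  obtain ⟨M₄, t₄, ex₄, -, s₄, v₄, -⟩ := exec_fill_block O M₃ (o + 24) (.reg 2) (.reg 2) (.lit 0)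
    (.arr 9 (.reg 1000) (.reg 1001)) .zero (R := 0)
    r3_2 r3_2 rfl (by simp [IExp.Below]) (by simp [IExp.Below]) trivial
    (by simp [RExp.Avoids, IExp.Below]) trivial
    (by simp [tabulateCost, IExp.cost, RExp.cost])
  refine ⟨M₄, _, .seq ex₁ (.seq ex₂ (.seq ex₃ ex₄)), ?_, ?_, ?_, ?_, ?_, ?_⟩
  · intro x hx
    rw [s₄.reg hx, s₃.reg hx, s₂.reg hx, s₁.reg hx]
  · rw [s₄.iarr, s₃.iarr, s₂.iarr, s₁.iarr]
  · intro a h1 h2 h3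
    rw [s₄.rarr (by omega), s₃.rarr h2, s₂.rarr h1, s₁.rarr (by omega)]
  · rw [s₄.block (by omega), s₃.block hu, v₂, v₁, s₁.block (by omega)]
  · rw [s₄.block (by omega), ← hid, ← s₁.block (a := 9) (by omega), ← s₂.block (a := 9) (by omega)]
    ext i j
    rw [v₃]
    simp [RExp.eval, IExp.eval, Mem.block]
  · rw [← hid, ← s₁.block (a := 9) (by omega), ← s₂.block (a := 9) (by omega),
      ← s₃.block (a := 9) (by omega)]
    ext i j
    rw [v₄]
    simp [RExp.eval, IExp.eval, Mem.block]

theorem appendCols_mul {m k s q : ℕ} (U : Matrix (Fin m) (Fin k) ℝ) (D : Matrix (Fin m) (Fin s) ℝ)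
    (Y : Matrix (Fin (k + s)) (Fin q) ℝ) :
    appendCols U D * Y = U * Y.submatrix (Fin.castAdd s) id + D * Y.submatrix (Fin.natAdd k) id := by
  ext i j
  simp [Matrix.mul_apply, Fin.sum_univ_add, appendCols]

/-- The last phase of an update, on one side. -/
def finish (o u₁ u₂ mr fx : ℕ) : Prog :=
  .seq (transition o fx) <|
  .seq (.cond (.req (.arr (o + 17) (.lit 0) (.lit 0)) .zero) (multiplySmall o u₂)
    (multiplyTall o u₁ u₂ mr)) <|
  tabulate u₁ (.arr (o + 1) (.reg 1000)) (.reg 1001) (.reg o) (.reg 2) (.reg 2) .zero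
    (.mul (.arr (o + 9) (.reg 1000) (.reg 1002)) (.arr (o + 24) (.reg 1002) (.reg 1001)))

/-- Where `D` vanishes, the new vectors are `U W`; the fast branch realises them through the small
factor, the slow one in the tall factor. On touched rows the tall factor is overwritten by the new
vectors times the inverse of the small factor. The rank condition enters only the time bound, by
excluding the slow branch. -/
theorem exec_finish {O : SVDRoutine} (hO : O.Correct) (M : Mem) {o u₁ u₂ mr fx : ℕ}
    (ho : 100 ≤ o) (ho' : o < 900) (hu₁ : u₁ < 9) (hu₂ : u₂ < 9) (hu : u₁ ≠ u₂) (hmr : mr < 100)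
    (hfx : fx < o ∨ o + 50 ≤ fx) {m k s z r ρ : ℕ} (hk : 0 < k)
    (h2 : M.reg 2 = k) (h9 : M.reg 9 = k + s) (hm : M.reg mr = m) (hid : M.block 9 k k = 1)
    {U₁ : Matrix (Fin m) (Fin k) ℝ} {U₂ : Matrix (Fin k) (Fin k) ℝ}
    {D : Matrix (Fin m) (Fin s) ℝ} (hU₁ : M.block u₁ m k = U₁) (hU₂ : M.block u₂ k k = U₂)
    (hU : (U₁ * U₂)ᵀ * (U₁ * U₂) = 1) {idx : Fin r → Fin m}
    (hprep : Prepared M o z r ρ (U₁ * U₂) D idx) {Unew : Matrix (Fin m) (Fin k) ℝ}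
    (hnew : Unew = appendCols (U₁ * U₂) D * M.block (o + 6) (k + s) ρ * M.block fx ρ k) :
    ∃ M' t, Exec O (finish o u₁ u₂ mr fx) M M' t ∧
      (∀ x < 1000, M'.reg x = M.reg x) ∧ M'.iarr = M.iarr ∧
      (∀ a, a ≠ u₁ → a ≠ u₂ → a < o ∨ o + 50 ≤ a → M'.rarr a = M.rarr a) ∧
      M'.block u₁ m k * M'.block u₂ k k = Unew ∧
      (SameRankOn (zeroRows D) (U₁ * U₂) Unew →
        t ≤ 30000 * ((z + (k + s)) * (k + s) ^ 2)) := by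
  have hN : 1 ≤ k + s := by omega
  obtain ⟨M₁, t₁, ex₁, ht₁, reg₁, ia₁, ra₁, wf, nw, svd, f0, chk⟩ := exec_transition hO M ho ho' hfx
    hk h2 h9 hprep.reg_count hprep.count_le hprep.reg_rank hprep.rank_le
  set U := U₁ * U₂ with hUdef
  set UJ := U.submatrix (Subtype.val : zeroRows D → Fin m) id with hUJ
  set W := M₁.block (o + 8) k k with hW
  have hWf : Unew = appendCols U D * M₁.block (o + 8) (k + s) k := by
    rw [hnew, wf, Matrix.mul_assoc]
  have hWsub : (M₁.block (o + 8) (k + s) k).submatrix (Fin.castAdd s) id = W := rfl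
  have hunt : ∀ i ∈ zeroRows D, Unew i = (U * W) i := by
    intro i hi
    ext j
    rw [hWf, appendCols_mul, hWsub, Matrix.add_apply, add_eq_left, Matrix.mul_apply]
    exact Finset.sum_eq_zero fun l _ => by rw [hi l, zero_mul]
  have hsub : Unew.submatrix (Subtype.val : zeroRows D → Fin m) id = UJ * W := by
    ext i j
    exact congrFun (hunt i i.2) j
  rw [hprep.gram] at svd chk
  have b1u₁ : M₁.block u₁ m k = U₁ := by
    rw [← hU₁]; simp only [Mem.block, ra₁ u₁ (by omega)]
  have b1u₂ : M₁.block u₂ k k = U₂ := by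
    rw [← hU₂]; simp only [Mem.block, ra₁ u₂ (by omega)]
  have b1id : M₁.block 9 k k = 1 := by
    rw [← hid]; simp only [Mem.block, ra₁ 9 (by omega)]
  -- Orthonormality of `U₁ * U₂` exhibits a left inverse of the square matrix `U₂`.
  have hunit : IsUnit U₂ := by
    rw [hUdef, ← Matrix.mul_assoc] at hU
    exact IsUnit.of_mul_eq_one _ (mul_eq_one_comm.1 hU)
  -- the small factor, its inverse, and the untouched rows of the tall factor
  obtain ⟨M₂, t₂, ex₂, ht₂, reg₂, ia₂, ra₂, inv₂, unt₂⟩ : ∃ M' t,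
      Exec O (.cond (.req (.arr (o + 17) (.lit 0) (.lit 0)) .zero) (multiplySmall o u₂)
        (multiplyTall o u₁ u₂ mr)) M₁ M' t ∧
      (SameRankOn (zeroRows D) U Unew → t ≤ 10010 * ((z + (k + s)) * (k + s) ^ 2)) ∧
      (∀ x < 1000, M'.reg x = M₁.reg x) ∧ M'.iarr = M₁.iarr ∧
      (∀ a, a ≠ u₁ → a ≠ u₂ → a < o + 18 ∨ o + 50 ≤ a → M'.rarr a = M₁.rarr a) ∧
      M'.block (o + 24) k k * M'.block u₂ k k = 1 ∧
      ∀ i ∈ zeroRows D, (M'.block u₁ m k * M'.block u₂ k k) i = Unew i := by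
    by_cases hc : M₁.rarr (o + 17) 0 0 = 0
    · obtain ⟨M₂, t₂, ex₂, ht₂, reg₂, ia₂, ra₂, ⟨W', hW', hu'⟩, inv₂⟩ := exec_multiplySmall hO M₁ ho
        ho' (u₂ := u₂) (by omega) (s := s) (z := z) hk (by rw [reg₁ _ (by omega), h2]) svd f0
        (chk.1 hc) (by rw [b1u₂]; exact hunit)
      refine ⟨M₂, _, .cond_true (by simpa [BExp.Holds, RExp.eval, IExp.eval] using hc) ex₂, ?_, reg₂,
        ia₂, fun a _ h h' => ra₂ a h h', inv₂, ?_⟩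
      · intro _
        have b0 := le_cost (z := z) hN
        simp only [BExp.cost, RExp.cost, IExp.cost]
        omega
      -- A Gram matrix can be cancelled: `UJᵀ UJ X = 0` implies `UJ X = 0`.
      · have hJ : UJ * W' = UJ * W := by
          have h0 : UJᵀ * UJ * (W' - W) = 0 := by rw [Matrix.mul_sub, hW', sub_self]
          rw [← Matrix.conjTranspose_eq_transpose_of_trivial,
            Matrix.conjTranspose_mul_self_mul_eq_zero, Matrix.mul_sub, sub_eq_zero] at h0
          exact h0
        intro i hi
        have e1 : M₂.block u₁ m k = U₁ := by
          rw [← b1u₁]; simp only [Mem.block, ra₂ u₁ hu (by omega)]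
        rw [e1, hu', b1u₂, ← Matrix.mul_assoc, ← hUdef, hunt i hi]
        exact congrFun hJ ⟨i, hi⟩
    · obtain ⟨M₂, t₂, ex₂, reg₂, ia₂, ra₂, v₁, v₂, v₃⟩ := exec_multiplyTall O M₁ ho ho' hu₁ hu₂ hu hmr
        (m := m) (k := k) (by rw [reg₁ _ (by omega), h2]) (by rw [reg₁ _ (by omega), hm]) b1id
      refine ⟨M₂, _, .cond_false (by simpa [BExp.Holds, RExp.eval, IExp.eval] using hc) ex₂, ?_,
        reg₂, ia₂, ra₂, by rw [v₂, v₃, Matrix.one_mul], ?_⟩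
      · intro hsame
        -- Equality of ranks would have made the test `H * F₀ = 0` succeed.
        refine absurd (chk.2 ?_) hc
        rw [SameRankOn, hsub] at hsame
        rw [f0]
        exact gram_mul_eq_zero_of_rank_eq svd hsame
      · intro i hi
        rw [v₁, v₂, Matrix.mul_one, b1u₁, b1u₂, ← hUdef, hunt i hi]
  have r2_o : M₂.reg o = r := by rw [reg₂ _ (by omega), reg₁ _ (by omega), hprep.reg_count]
  have r2_2 : M₂.reg 2 = k := by rw [reg₂ _ (by omega), reg₁ _ (by omega), h2]
  have ls : ∀ t : Fin r, M₂.iarr (o + 1) t = idx t := by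
    intro t
    rw [ia₂, ia₁]
    exact hprep.list t
  obtain ⟨M₃, t₃, ex₃, ht₃, s₃, v₃, u₃⟩ := exec_tabulate O M₂ u₁ (.arr (o + 1) (.reg 1000))
    (.reg 1001) (.reg o) (.reg 2) (.reg 2) .zero
    (.mul (.arr (o + 9) (.reg 1000) (.reg 1002)) (.arr (o + 24) (.reg 1002) (.reg 1001)))
    (by simp [IExp.Below]) (by simp [IExp.Below]) (by simp [IExp.Below]; omega)
    (by simp [IExp.Below]) (by simp [IExp.Below]) trivial
    (by simp [RExp.Avoids, IExp.Below]; omega)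
    (by
      intro i hi j hj i' hi' j' hj' h1 h2
      simp only [IExp.eval, Mem.counters_reg_fst, Mem.counters_reg_snd, Mem.counters_iarr,
        r2_o] at hi hi' h1 h2
      refine ⟨?_, h2⟩
      have a := ls ⟨i, hi⟩
      have b := ls ⟨i', hi'⟩
      simp only at a b
      rw [a, b] at h1
      simpa using hprep.injective (Fin.ext h1))
    100 (by simp [tabulateCost, IExp.cost, RExp.cost])
  simp only [RExp.eval, IExp.eval, Mem.counters_rarr, Mem.counters_reg_fst, Mem.counters_reg_snd,
      Mem.counters_reg_trd, Mem.counters_iarr, zero_add, r2_o, r2_2] at ht₃ v₃ u₃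
  refine ⟨M₃, _, .seq ex₁ (.seq ex₂ ex₃), ?_, ?_, ?_, ?_, ?_⟩
  · intro x hx
    rw [s₃.reg hx, reg₂ x hx, reg₁ x hx]
  · rw [s₃.iarr, ia₂, ia₁]
  · intro a h1 h2 h3
    rw [s₃.rarr h1, ra₂ a h1 h2 (by omega), ra₁ a (by omega)]
  · have e2 : M₃.block u₂ k k = M₂.block u₂ k k := s₃.block (by omega) _ _
    rw [e2]
    ext i j
    by_cases hi : i ∈ zeroRows D
    · rw [← congrFun (unt₂ i hi) j, Matrix.mul_apply, Matrix.mul_apply]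
      refine Finset.sum_congr rfl fun l _ => ?_
      congr 1
      simp only [Mem.block, Matrix.of_apply]
      refine u₃ i l fun t ht _ _ h => (hprep.mem_zeroRows i).1 hi ⟨t, ht⟩ ?_
      apply Fin.ext
      rw [h.1, ← ls]
    · rw [hprep.mem_zeroRows] at hi
      push Not at hi
      obtain ⟨t, rfl⟩ := hi
      have e3 : ∀ l : Fin k, M₃.block u₁ m k (idx t) l =
          (M₂.block (o + 9) r k * M₂.block (o + 24) k k) t l := by
        intro l
        have := v₃ t t.2 l l.2
        rw [ls, Finset.sum_range] at this
        rw [Matrix.mul_apply]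
        exact this
      have e4 : M₂.block (o + 9) r k = Unew.submatrix idx id := by
        rw [hWf]
        have : M₂.block (o + 9) r k = M₁.block (o + 9) r k := by
          simp only [Mem.block, ra₂ (o + 9) (by omega) (by omega) (by omega)]
        rw [this, nw, hprep.rows]
        rfl
      calc (M₃.block u₁ m k * M₂.block u₂ k k) (idx t) j
          = ((M₂.block (o + 9) r k * M₂.block (o + 24) k k) * M₂.block u₂ k k) t j := by
            rw [Matrix.mul_apply, Matrix.mul_apply (M := _ * _)]
            simp only [e3]
        _ = Unew (idx t) j := by
            rw [Matrix.mul_assoc, inv₂, Matrix.mul_one, e4]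
            rfl
  · intro hsame
    have h5 := ht₂ hsame
    have b1 := cost_bound (z := z) (P := r) (Q := k) (R := k) hN
      (by have := hprep.count_le; omega) (by omega) (by omega)
    omega

/-! ### Update of the weights -/

/-- Store `k + s` in register `9`, the identity matrix in the array `9` and the middle factor
`diag (σ, 1)` in row `0` of the array `20`. -/
def setup : Prog :=
  .seq (.setReg 9 (.add (.reg 2) (.reg 3))) <|
  .seq (fill 9 (.reg 2) (.reg 2) (.lit 0) .zero .zero) <|
  .seq (tabulate 9 (.reg 1001) (.reg 1001) (.lit 1) (.reg 2) (.lit 0) .one .zero) <|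
  .seq (fill 20 (.lit 1) (.reg 2) (.lit 0) (.arr 2 (.lit 0) (.reg 1001)) .zero) <|
  tabulate 20 (.lit 0) (.add (.reg 2) (.reg 1001)) (.lit 1) (.reg 3) (.lit 0) .one .zero

/-- The diagonal of the identity and the trailing ones of the middle factor are written by
tabulations with an outer loop of length one; the column counter serves as both coordinates,
respectively is shifted by `k`. -/
theorem exec_setup (O : SVDRoutine) (M : Mem) {k s z : ℕ} (hk : 0 < k) (h2 : M.reg 2 = k)
    (h3 : M.reg 3 = s) :
    ∃ M' t, Exec O setup M M' t ∧ t ≤ 10000 * ((z + (k + s)) * (k + s) ^ 2) ∧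
      (∀ x < 1000, x ≠ 9 → M'.reg x = M.reg x) ∧ M'.reg 9 = k + s ∧ M'.iarr = M.iarr ∧
      (∀ a, a ≠ 9 → a ≠ 20 → M'.rarr a = M.rarr a) ∧ M'.block 9 k k = 1 ∧
      ∀ l : Fin (k + s), M'.rarr 20 0 l =
        Fin.append (fun j : Fin k => M.rarr 2 0 j) (fun _ : Fin s => (1 : ℝ)) l := by
  have hN : 1 ≤ k + s := by omega
  set M₀ := M.setReg 9 (k + s) with hM₀
  have ex₀ : Exec O (.setReg 9 (.add (.reg 2) (.reg 3))) M M₀ 4 := by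
    have := Exec.setReg (O := O) M 9 (.add (.reg 2) (.reg 3))
    simpa [IExp.eval, IExp.cost, h2, h3] using this
  have r0 : ∀ x, x ≠ 9 → M₀.reg x = M.reg x := fun x hx => Mem.setReg_reg_of_ne _ hx
  have r0_2 : M₀.reg 2 = k := by rw [r0 _ (by omega), h2]
  obtain ⟨M₁, t₁, ex₁, ht₁, s₁, v₁, -⟩ := exec_fill O M₀ 9 (.reg 2) (.reg 2) (.lit 0) .zero .zero
    (R := 0) r0_2 r0_2 rfl (by simp [IExp.Below]) (by simp [IExp.Below]) trivial trivial trivial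
    (by simp [tabulateCost, IExp.cost, RExp.cost])
  have r1_2 : M₁.reg 2 = k := by rw [s₁.reg (by omega), r0_2]
  obtain ⟨M₂, t₂, ex₂, ht₂, s₂, v₂, u₂⟩ := exec_tabulate O M₁ 9 (.reg 1001) (.reg 1001) (.lit 1)
    (.reg 2) (.lit 0) .one .zero (by simp [IExp.Below]) (by simp [IExp.Below]) trivial
    (by simp [IExp.Below]) trivial trivial trivial
    (by
      intro i hi j hj i' hi' j' hj' h1 h2
      simp only [IExp.eval, Mem.counters_reg_snd] at hi hi' h1
      omega) 100 (by simp [tabulateCost, IExp.cost, RExp.cost])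
  simp only [RExp.eval, IExp.eval, Mem.counters_reg_snd, r1_2, Finset.range_zero,
    Finset.sum_empty, add_zero] at ht₂ v₂ u₂
  have r2_2 : M₂.reg 2 = k := by rw [s₂.reg (by omega), r1_2]
  obtain ⟨M₃, t₃, ex₃, ht₃, s₃, v₃, -⟩ := exec_fill O M₂ 20 (.lit 1) (.reg 2) (.lit 0)
    (.arr 2 (.lit 0) (.reg 1001)) .zero (P := 1) (R := 0) rfl r2_2 rfl trivial
    (by simp [IExp.Below]) trivial (by simp [RExp.Avoids, IExp.Below]) trivial
    (by simp [tabulateCost, IExp.cost, RExp.cost])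
  have r3_2 : M₃.reg 2 = k := by rw [s₃.reg (by omega), r2_2]
  have r3_3 : M₃.reg 3 = s := by
    rw [s₃.reg (by omega), s₂.reg (by omega), s₁.reg (by omega), r0 _ (by omega), h3]
  obtain ⟨M₄, t₄, ex₄, ht₄, s₄, v₄, u₄⟩ := exec_tabulate O M₃ 20 (.lit 0)
    (.add (.reg 2) (.reg 1001)) (.lit 1)
    (.reg 3) (.lit 0) .one .zero (by simp [IExp.Below]) (by simp [IExp.Below]) trivial
    (by simp [IExp.Below]) trivial trivial trivial
    (by
      intro i hi j hj i' hi' j' hj' h1 h2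
      simp only [IExp.eval, Mem.counters_reg_snd, Mem.counters_reg_of_lt _ (show 2 < 1000 by omega)]
        at hi hi' h2
      omega) 100 (by simp [tabulateCost, IExp.cost, RExp.cost])
  simp only [RExp.eval, IExp.eval, Mem.counters_reg_snd, r3_3, Finset.range_zero,
    Finset.sum_empty, add_zero, Mem.counters_reg_of_lt _ (show 2 < 1000 by omega), r3_2]
    at ht₄ v₄ u₄
  refine ⟨M₄, _, .seq ex₀ (.seq ex₁ (.seq ex₂ (.seq ex₃ ex₄))), ?_, ?_, ?_, ?_, ?_, ?_, ?_⟩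
  · have b0 := le_cost (z := z) hN
    have b1 := cost_bound (z := z) (P := k) (Q := k) (R := 0) hN (by omega) (by omega) (by omega)
    have b2 := cost_bound (z := z) (P := 1) (Q := k) (R := 0) hN (by omega) (by omega) (by omega)
    have b3 := cost_bound (z := z) (P := 1) (Q := s) (R := 0) hN (by omega) (by omega) (by omega)
    omega
  · intro x hx hx'
    rw [s₄.reg hx, s₃.reg hx, s₂.reg hx, s₁.reg hx, r0 x hx']
  · rw [s₄.reg (by omega), s₃.reg (by omega), s₂.reg (by omega), s₁.reg (by omega), hM₀,
      Mem.setReg_reg_self]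
  · rw [s₄.iarr, s₃.iarr, s₂.iarr, s₁.iarr]; rfl
  · intro a h1 h2
    rw [s₄.rarr h2, s₃.rarr h2, s₂.rarr h1, s₁.rarr h1]; rfl
  · rw [s₄.block (by omega), s₃.block (by omega)]
    ext i j
    simp only [Mem.block, Matrix.of_apply]
    by_cases hij : i = j
    · subst hij
      rw [Matrix.one_apply_eq]
      exact v₂ 0 (by omega) i i.2
    · rw [Matrix.one_apply_ne hij, u₂, v₁ i i.2 j j.2]
      · simp [RExp.eval]
      · rintro - - l hl ⟨h1, h2⟩
        exact hij (Fin.ext (h1.trans h2.symm))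
  · intro l
    refine Fin.addCases (fun j => ?_) (fun j => ?_) l
    · rw [Fin.append_left, Fin.val_castAdd, u₄, v₃ 0 (by omega) j j.2]
      · simp only [RExp.eval, IExp.eval, Mem.counters_reg_snd, Mem.counters_rarr, Finset.range_zero,
          Finset.sum_empty, add_zero]
        rw [s₂.rarr (by omega), s₁.rarr (by omega)]
        rfl
      · rintro - - l hl ⟨-, h⟩
        have := j.2
        omega
    · rw [Fin.append_right, Fin.val_natAdd]
      exact v₄ 0 (by omega) j j.2

/-- The SVD of the small matrix in the middle. -/
def core : Prog :=
  .seq (fill 21 (.reg 101) (.reg 201) (.reg 9) .zero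
    (.mul (.mul (.arr 107 (.reg 1000) (.reg 1002)) (.arr 20 (.lit 0) (.reg 1002)))
      (.arr 207 (.reg 1001) (.reg 1002)))) <|
  .svd (.reg 101) (.reg 201) (.reg 2) 21 22 2 23

/-- The inequalities `k ≤ ρ` and `k ≤ ρ'` make the SVD request legal, and `ρ, ρ' ≤ k + s` make it
cheap. The new singular values land directly in array `2`, their place in the stored form. -/
theorem exec_core {O : SVDRoutine} (hO : O.Correct) (M : Mem) {k s z ρ ρ' : ℕ} (hk : 0 < k)
    (h2 : M.reg 2 = k) (h9 : M.reg 9 = k + s) (hρ : M.reg 101 = ρ) (hρ' : M.reg 201 = ρ')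
    (kρ : k ≤ ρ) (kρ' : k ≤ ρ') (ρN : ρ ≤ k + s) (ρN' : ρ' ≤ k + s) :
    ∃ M' t, Exec O core M M' t ∧ t ≤ 10000 * ((z + (k + s)) * (k + s) ^ 2) ∧
      (∀ x < 1000, M'.reg x = M.reg x) ∧ M'.iarr = M.iarr ∧
      (∀ a, a ≠ 2 → a ≠ 21 → a ≠ 22 → a ≠ 23 → M'.rarr a = M.rarr a) ∧
      IsTruncSVD k (M.block 107 ρ (k + s) * (Matrix.diagonal fun l : Fin (k + s) => M.rarr 20 0 l) *
        (M.block 207 ρ' (k + s))ᵀ) (M'.block 22 ρ k) (fun j => M'.rarr 2 0 j)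
        (M'.block 23 ρ' k) := by
  have hN : 1 ≤ k + s := by omega
  obtain ⟨M₁, t₁, ex₁, ht₁, s₁, v₁, -⟩ := exec_fill_block O M 21 (.reg 101) (.reg 201) (.reg 9) .zero
    (.mul (.mul (.arr 107 (.reg 1000) (.reg 1002)) (.arr 20 (.lit 0) (.reg 1002)))
      (.arr 207 (.reg 1001) (.reg 1002))) hρ hρ' h9 (by simp [IExp.Below]) (by simp [IExp.Below])
    (by simp [IExp.Below]) trivial (by simp [RExp.Avoids, IExp.Below])
    (by simp [tabulateCost, IExp.cost, RExp.cost])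
  obtain ⟨M₂, t₂, ex₂, ht₂, svd₂, reg₂, ia₂, ra₂⟩ := exec_svd hO M₁ (.reg 101) (.reg 201) (.reg 2)
    21 22 2 23 (P := ρ) (Q := ρ') (K := k) (by rw [← hρ]; exact s₁.reg (by omega))
    (by rw [← hρ']; exact s₁.reg (by omega)) (by rw [← h2]; exact s₁.reg (by omega)) kρ kρ'
    (by omega) (by omega) (by omega)
  refine ⟨M₂, _, .seq ex₁ ex₂, ?_, ?_, ?_, ?_, ?_⟩
  · have b0 := le_cost (z := z) hN
    have b1 := cost_bound (z := z) (P := ρ) (Q := ρ') (R := k + s) hN (by omega) (by omega)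
      (by omega)
    have b2 : (ρ + ρ') ^ 3 ≤ 8 * ((z + (k + s)) * (k + s) ^ 2) := by
      have := cube_le_cost (z := z) (N := k + s)
      calc (ρ + ρ') ^ 3 ≤ (k + s + (k + s)) ^ 3 := by gcongr
        _ = 8 * (k + s) ^ 3 := by ring
        _ ≤ _ := by omega
    simp only [IExp.cost] at ht₂
    omega
  · intro x hx
    rw [reg₂, s₁.reg hx]
  · rw [ia₂, s₁.iarr]
  · intro a h1 h2 h3 h4
    rw [ra₂ h3 h1 h4, s₁.rarr h2]
  · convert svd₂ using 1
    ext i j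
    rw [v₁, Matrix.mul_apply]
    simp [RExp.eval, IExp.eval, Matrix.mul_diagonal, Mem.block]

/-- Update of the weights. -/
def updateWeightsProg : Prog :=
  .seq setup <|
  .seq (prepare 100 0 1 4 0 1 5) <|
  .seq (prepare 200 3 4 5 2 3 6) <|
  .seq core <|
  .seq (finish 100 0 1 0 22) (finish 200 3 4 1 23)

theorem GivenSparse.reg_eq_nnz {p q : ℕ} {M : Mem} {len row col val : ℕ}
    {E : Matrix (Fin p) (Fin q) ℝ} (h : GivenSparse M len row col val E) : M.reg len = nnz E := by
  obtain ⟨e, -⟩ := h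
  rw [nnz, ← Nat.card_congr e, Nat.card_fin]

theorem GivenSparse.congr {p q : ℕ} {M M' : Mem} {len row col val : ℕ}
    {E : Matrix (Fin p) (Fin q) ℝ} (h : GivenSparse M len row col val E)
    (hlen : M'.reg len = M.reg len) (hrow : M'.iarr row = M.iarr row)
    (hcol : M'.iarr col = M.iarr col) (hval : M'.rarr val = M.rarr val) :
    GivenSparse M' len row col val E := by
  rw [GivenSparse, hlen, hrow, hcol, hval]
  exact h

/-- Block multiplication: the columns of `D` and `E` enter with weight one in the middle factor. -/
theorem add_mul_transpose_eq {m n k s : ℕ} (U : Matrix (Fin m) (Fin k) ℝ)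
    (V : Matrix (Fin n) (Fin k) ℝ) (σ : Fin k → ℝ) (D : Matrix (Fin m) (Fin s) ℝ)
    (E : Matrix (Fin n) (Fin s) ℝ) :
    U * Matrix.diagonal σ * Vᵀ + D * Eᵀ =
      appendCols U D * (Matrix.diagonal (Fin.append σ fun _ : Fin s => (1 : ℝ))) *
        (appendCols V E)ᵀ := by
  ext i j
  rw [Matrix.add_apply, Matrix.mul_apply, Matrix.mul_apply, Matrix.mul_apply, Fin.sum_univ_add]
  simp [appendCols, Matrix.mul_diagonal]

/-- Both sides must be prepared before the middle SVD and finished after it. Scratch names from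
`100` and from `200` on keep the two sides apart, so that each phase preserves what the other side
has stored. -/
theorem exec_updateWeights {O : SVDRoutine} (hO : O.Correct) {m n k : ℕ} (hk : 0 < k)
    (S : FiveFactor m n k) (M : Mem) (hS : Stores M S) {s : ℕ} (D : Matrix (Fin m) (Fin s) ℝ)
    (E : Matrix (Fin n) (Fin s) ℝ) (hin : Input₂ M s D E) :
    ∃ (S' : FiveFactor m n k) (M' : Mem) (t : ℕ),
      Exec O updateWeightsProg M M' t ∧ Stores M' S' ∧
      IsTruncSVD k (S.approx + D * Eᵀ) S'.U S'.σ S'.V ∧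
      (SameRankOn (zeroRows D) S.U S'.U → SameRankOn (zeroRows E) S.V S'.V →
        t ≤ 110000 * ((nnz D + nnz E) * (s + k) ^ 2 + (s + k) ^ 3)) := by
  obtain ⟨⟨h3, hD⟩, hE⟩ := hin
  set z := nnz D + nnz E with hz
  have lD := hD.reg_eq_nnz
  have lE := hE.reg_eq_nnz
  obtain ⟨M₁, t₁, ex₁, ht₁, reg₁, r1_9, ia₁, ra₁, id₁, kd₁⟩ := exec_setup O M (z := z) hk hS.rank h3
  have bU₁ : M₁.block 0 m k = S.U₁ := by
    rw [← hS.U₁]; simp only [Mem.block, ra₁ 0 (by omega) (by omega)]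
  have bU₂ : M₁.block 1 k k = S.U₂ := by
    rw [← hS.U₂]; simp only [Mem.block, ra₁ 1 (by omega) (by omega)]
  have bV₁ : M₁.block 3 n k = S.V₁ := by
    rw [← hS.V₁]; simp only [Mem.block, ra₁ 3 (by omega) (by omega)]
  have bV₂ : M₁.block 4 k k = S.V₂ := by
    rw [← hS.V₂]; simp only [Mem.block, ra₁ 4 (by omega) (by omega)]
  have r1_2 : M₁.reg 2 = k := by rw [reg₁ _ (by omega) (by omega), hS.rank]
  obtain ⟨M₂, t₂, ex₂, ht₂, w₂, r, ρ, idx, p₂⟩ := exec_prepare hO M₁ (o := 100) (u₁ := 0) (u₂ := 1)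
    (len := 4) (row := 0) (col := 1) (val := 5) (z := z) (by omega) (by omega) (by omega) (by omega)
    (by omega) (by omega) (by omega) (by omega) hk r1_2 r1_9 id₁ bU₁ bU₂ S.left_orth
    (hD.congr (reg₁ _ (by omega) (by omega)) (by rw [ia₁]) (by rw [ia₁])
      (ra₁ _ (by omega) (by omega)))
    (by rw [reg₁ _ (by omega) (by omega)]; omega)
  have fb₂ : ∀ a p q, a < 100 → M₂.block a p q = M₁.block a p q := by
    intro a p q ha
    simp only [Mem.block, w₂.rarr (Or.inl ha)]
  have r2_2 : M₂.reg 2 = k := by rw [w₂.reg (by omega) (by omega), r1_2]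
  have r2_9 : M₂.reg 9 = k + s := by rw [w₂.reg (by omega) (by omega), r1_9]
  obtain ⟨M₃, t₃, ex₃, ht₃, w₃, r', ρ', idx', p₃⟩ := exec_prepare hO M₂ (o := 200) (u₁ := 3)
    (u₂ := 4) (len := 5) (row := 2) (col := 3) (val := 6) (z := z) (by omega) (by omega) (by omega)
    (by omega) (by omega) (by omega) (by omega) (by omega) hk r2_2 r2_9
    ((fb₂ _ _ _ (by omega)).trans id₁) ((fb₂ _ _ _ (by omega)).trans bV₁)
    ((fb₂ _ _ _ (by omega)).trans bV₂) S.right_orth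
    (hE.congr (by rw [w₂.reg (by omega) (by omega), reg₁ _ (by omega) (by omega)])
      (by rw [w₂.iarr (by omega), ia₁]) (by rw [w₂.iarr (by omega), ia₁])
      (by rw [w₂.rarr (by omega), ra₁ _ (by omega) (by omega)]))
    (by rw [w₂.reg (by omega) (by omega), reg₁ _ (by omega) (by omega)]; omega)
  have fb₃ : ∀ a p q, a < 100 → M₃.block a p q = M₁.block a p q := by
    intro a p q ha
    rw [← fb₂ a p q ha]
    simp only [Mem.block, w₃.rarr (show a < 200 ∨ 200 + 50 ≤ a by omega)]
  have p₂' : Prepared M₃ 100 z r ρ (S.U₁ * S.U₂) D idx :=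
    p₂.congr (w₃.reg (by omega) (by omega)) (w₃.reg (by omega) (by omega)) (w₃.iarr (by omega))
      fun a h1 h2 => w₃.rarr (by omega)
  have r3_2 : M₃.reg 2 = k := by rw [w₃.reg (by omega) (by omega), r2_2]
  have r3_9 : M₃.reg 9 = k + s := by rw [w₃.reg (by omega) (by omega), r2_9]
  obtain ⟨M₄, t₄, ex₄, ht₄, reg₄, ia₄, ra₄, svd₄⟩ := exec_core hO M₃ (z := z) hk r3_2 r3_9
    p₂'.reg_rank p₃.reg_rank p₂'.le_rank p₃.le_rank p₂'.rank_le p₃.rank_le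
  have hkd : (fun l : Fin (k + s) => M₃.rarr 20 0 l) = Fin.append S.σ fun _ => (1 : ℝ) := by
    ext l
    rw [w₃.rarr (by omega), w₂.rarr (by omega), kd₁ l, ← hS.σ]
    rfl
  rw [hkd] at svd₄
  have fb₄ : ∀ a p q, a ≠ 2 → a ≠ 21 → a ≠ 22 → a ≠ 23 → M₄.block a p q = M₃.block a p q := by
    intro a p q h1 h2 h3 h4
    simp only [Mem.block, ra₄ a h1 h2 h3 h4]
  have p₄ : Prepared M₄ 100 z r ρ (S.U₁ * S.U₂) D idx :=
    p₂'.congr (reg₄ _ (by omega)) (reg₄ _ (by omega)) (by rw [ia₄])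
      fun a h1 h2 => ra₄ a (by omega) (by omega) (by omega) (by omega)
  have p₄' : Prepared M₄ 200 z r' ρ' (S.V₁ * S.V₂) E idx' :=
    p₃.congr (reg₄ _ (by omega)) (reg₄ _ (by omega)) (by rw [ia₄])
      fun a h1 h2 => ra₄ a (by omega) (by omega) (by omega) (by omega)
  have main : IsTruncSVD k (S.approx + D * Eᵀ)
      (appendCols (S.U₁ * S.U₂) D * M₄.block 106 (k + s) ρ * M₄.block 22 ρ k)
      (fun j => M₄.rarr 2 0 j)
      (appendCols (S.V₁ * S.V₂) E * M₄.block 206 (k + s) ρ' * M₄.block 23 ρ' k) := by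
    have := svd₄.lift p₄.orth p₄'.orth
    convert this using 1
    rw [FiveFactor.approx, FiveFactor.U, FiveFactor.V, add_mul_transpose_eq]
    -- Substituting `B = B L R` on both sides exposes the middle matrix whose SVD has been computed.
    have e1 := p₄.factor
    have e2 := p₄'.factor
    rw [fb₄ (100 + 7) _ _ (by omega) (by omega) (by omega) (by omega)] at e1
    rw [fb₄ (200 + 7) _ _ (by omega) (by omega) (by omega) (by omega)] at e2
    conv_lhs => rw [← e1, ← e2]
    simp only [Matrix.transpose_mul, Matrix.mul_assoc]
  have rg : ∀ x < 100, x ≠ 9 → M₄.reg x = M.reg x := by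
    intro x hx hx'
    rw [reg₄ _ (by omega), w₃.reg (by omega) (by omega), w₂.reg (by omega) (by omega),
      reg₁ _ (by omega) hx']
  have r4_2 : M₄.reg 2 = k := by rw [rg _ (by omega) (by omega), hS.rank]
  have r4_9 : M₄.reg 9 = k + s := by rw [reg₄ _ (by omega), r3_9]
  have fb₁₄ : ∀ a p q, a < 20 → a ≠ 2 → M₄.block a p q = M₁.block a p q := by
    intro a p q h1 h2
    rw [fb₄ _ _ _ h2 (by omega) (by omega) (by omega), fb₃ _ _ _ (by omega)]
  obtain ⟨M₅, t₅, ex₅, reg₅, ia₅, ra₅, new₅, ht₅⟩ := exec_finish hO M₄ (o := 100) (u₁ := 0) (u₂ := 1)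
    (mr := 0) (fx := 22) (by omega) (by omega) (by omega) (by omega) (by omega) (by omega)
    (by omega) hk r4_2 r4_9 ((rg 0 (by omega) (by omega)).trans hS.rows)
    ((fb₁₄ _ _ _ (by omega) (by omega)).trans id₁) ((fb₁₄ _ _ _ (by omega) (by omega)).trans bU₁)
    ((fb₁₄ _ _ _ (by omega) (by omega)).trans bU₂) S.left_orth p₄ rfl
  have fb₅ : ∀ a p q, a ≠ 0 → a ≠ 1 → (a < 100 ∨ 150 ≤ a) → M₅.block a p q = M₄.block a p q := by
    intro a p q h1 h2 h3
    simp only [Mem.block, ra₅ a h1 h2 h3]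
  have p₅ : Prepared M₅ 200 z r' ρ' (S.V₁ * S.V₂) E idx' :=
    p₄'.congr (reg₅ _ (by omega)) (reg₅ _ (by omega)) (by rw [ia₅])
      fun a h1 h2 => ra₅ a (by omega) (by omega) (by omega)
  obtain ⟨M₆, t₆, ex₆, reg₆, ia₆, ra₆, new₆, ht₆⟩ := exec_finish hO M₅ (o := 200) (u₁ := 3) (u₂ := 4)
    (mr := 1) (fx := 23) (by omega) (by omega) (by omega) (by omega) (by omega) (by omega)
    (by omega) hk ((reg₅ _ (by omega)).trans r4_2) ((reg₅ _ (by omega)).trans r4_9)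
    (((reg₅ _ (by omega)).trans (rg 1 (by omega) (by omega))).trans hS.cols)
    ((fb₅ _ _ _ (by omega) (by omega) (by omega)).trans
      ((fb₁₄ _ _ _ (by omega) (by omega)).trans id₁))
    ((fb₅ _ _ _ (by omega) (by omega) (by omega)).trans
      ((fb₁₄ _ _ _ (by omega) (by omega)).trans bV₁))
    ((fb₅ _ _ _ (by omega) (by omega) (by omega)).trans
      ((fb₁₄ _ _ _ (by omega) (by omega)).trans bV₂)) S.right_orth p₅ rfl
  rw [fb₅ _ _ _ (by omega) (by omega) (by omega), fb₅ _ _ _ (by omega) (by omega) (by omega)]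
    at new₆ ht₆
  have fb₆ : ∀ a p q, a ≠ 3 → a ≠ 4 → (a < 200 ∨ 250 ≤ a) → M₆.block a p q = M₅.block a p q := by
    intro a p q h1 h2 h3
    simp only [Mem.block, ra₆ a h1 h2 h3]
  have hsig : (fun j : Fin k => M₄.rarr 2 0 j) = M₆.rarr 2 0 ∘ Fin.val := by
    ext j
    simp only [Function.comp]
    rw [ra₆ _ (by omega) (by omega) (by omega), ra₅ _ (by omega) (by omega) (by omega)]
  have newU : M₆.block 0 m k * M₆.block 1 k k =
      appendCols (S.U₁ * S.U₂) D * M₄.block 106 (k + s) ρ * M₄.block 22 ρ k := by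
    rw [fb₆ _ _ _ (by omega) (by omega) (by omega), fb₆ _ _ _ (by omega) (by omega) (by omega)]
    exact new₅
  rw [← newU, ← new₆, hsig] at main
  rw [← newU] at ht₅
  rw [← new₆] at ht₆
  refine ⟨⟨M₆.block 0 m k, M₆.block 1 k k, M₆.rarr 2 0 ∘ Fin.val, M₆.block 3 n k, M₆.block 4 k k,
    main.left_orth, main.right_orth, main.nonneg, main.antitone⟩, M₆, _,
    .seq ex₁ (.seq ex₂ (.seq ex₃ (.seq ex₄ (.seq ex₅ ex₆)))), ⟨?_, ?_, ?_, rfl, rfl, rfl, rfl, rfl⟩,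
    main, ?_⟩
  · rw [reg₆ _ (by omega), reg₅ _ (by omega), rg _ (by omega) (by omega), hS.rows]
  · rw [reg₆ _ (by omega), reg₅ _ (by omega), rg _ (by omega) (by omega), hS.cols]
  · rw [reg₆ _ (by omega), reg₅ _ (by omega), r4_2]
  · intro hA hB
    have a := ht₅ hA
    have b := ht₆ hB
    -- The six phases contribute the constants 10000, 12000, 12000, 10000, 30000 and 30000.
    have e : z * (s + k) ^ 2 + (s + k) ^ 3 = (z + (k + s)) * (k + s) ^ 2 := by ring
    rw [e]
    omega

/-! ### New rows and columns as weight updates -/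

@[simp] theorem appendRows_castAdd {m n s : ℕ} (A : Matrix (Fin m) (Fin n) ℝ)
    (E : Matrix (Fin s) (Fin n) ℝ) (i : Fin m) (j : Fin n) :
    appendRows A E (Fin.castAdd s i) j = A i j :=
  congrFun (Fin.append_left A E i) j

@[simp] theorem appendRows_natAdd {m n s : ℕ} (A : Matrix (Fin m) (Fin n) ℝ)
    (E : Matrix (Fin s) (Fin n) ℝ) (i : Fin s) (j : Fin n) :
    appendRows A E (Fin.natAdd m i) j = E i j :=
  congrFun (Fin.append_right A E i) j

theorem appendRows_mul {m n s q : ℕ} (A : Matrix (Fin m) (Fin n) ℝ) (E : Matrix (Fin s) (Fin n) ℝ)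
    (Y : Matrix (Fin n) (Fin q) ℝ) : appendRows A E * Y = appendRows (A * Y) (E * Y) := by
  ext i j
  refine Fin.addCases (fun i => ?_) (fun i => ?_) i <;>
  simp [Matrix.mul_apply]

/-- Zero rows contribute nothing to inner products of columns, so padding preserves orthonormality.
-/
theorem appendRows_zero_gram {m n s : ℕ} (A : Matrix (Fin m) (Fin n) ℝ) :
    (appendRows A (0 : Matrix (Fin s) (Fin n) ℝ))ᵀ *
      appendRows A (0 : Matrix (Fin s) (Fin n) ℝ) = Aᵀ * A := by
  ext i j
  rw [Matrix.mul_apply, Matrix.mul_apply, Fin.sum_univ_add]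
  simp

/-- The matrix `[0; 1]` whose product with `E` moves the rows of `E` below `m` zero rows. -/
def shift (m s : ℕ) : Matrix (Fin (m + s)) (Fin s) ℝ := appendRows 0 1

theorem shift_apply {m s : ℕ} (i : Fin (m + s)) (j : Fin s) :
    shift m s i j = if (i : ℕ) = m + j then 1 else 0 := by
  refine Fin.addCases (fun i => ?_) (fun i => ?_) i
  · have := i.2
    simp only [shift, appendRows_castAdd, Fin.val_castAdd]
    rw [if_neg (by omega)]
    rfl
  · simp [shift, Matrix.one_apply, Fin.ext_iff]

/-- A non-zero entry is determined by its column. Hence using `shift` as an input adds at most `s *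
(s + k) ^ 2` to the bound, which is within the cubic term. -/
theorem nnz_shift_le (m s : ℕ) : nnz (shift m s) ≤ s := by
  have : nnz (shift m s) ≤ Nat.card (Fin s) := by
    refine Nat.card_le_card_of_injective (fun x => x.1.2) fun x y h => ?_
    obtain ⟨⟨i, j⟩, hx⟩ := x
    obtain ⟨⟨i', j'⟩, hy⟩ := y
    simp only [shift_apply, ne_eq, ite_eq_right_iff, one_ne_zero, imp_false, not_not] at hx hy h
    subst h
    simp [Fin.ext_iff, hx, hy]
  rwa [Nat.card_fin] at this

theorem nnz_transpose {p q : ℕ} (E : Matrix (Fin p) (Fin q) ℝ) : nnz Eᵀ = nnz E :=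
  Nat.card_congr ⟨fun x => ⟨(x.1.2, x.1.1), x.2⟩, fun x => ⟨(x.1.2, x.1.1), x.2⟩,
    fun _ => rfl, fun _ => rfl⟩

theorem mem_zeroRows_shift {m s : ℕ} (i : Fin (m + s)) :
    i ∈ zeroRows (shift m s) ↔ (i : ℕ) < m := by
  simp only [zeroRows, Set.mem_ofPred_eq, shift_apply, ite_eq_right_iff, one_ne_zero, imp_false]
  constructor
  · intro h
    by_contra hi
    exact h ⟨i - m, by omega⟩ (by simp only; omega)
  · intro h j
    omega

/-- The zero rows of `shift m s` are the first `m` ones, so each block is a reindexed submatrix of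
the other. This translates the non-degeneracy condition for appended rows into the one for a weight
update. -/
theorem rank_submatrix_zeroRows_shift {m s k : ℕ} (X : Matrix (Fin (m + s)) (Fin k) ℝ) :
    (X.submatrix (Subtype.val : zeroRows (shift m s) → Fin (m + s)) id).rank =
      ((topRows X).submatrix (Subtype.val : ↥(Set.univ : Set (Fin m)) → Fin m) id).rank := by
  apply le_antisymm
  · exact Matrix.rank_submatrix_le
      ((topRows X).submatrix (Subtype.val : ↥(Set.univ : Set (Fin m)) → Fin m) id)
      (fun i : zeroRows (shift m s) => ⟨⟨i.1, (mem_zeroRows_shift _).1 i.2⟩, trivial⟩) id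
  · exact Matrix.rank_submatrix_le
      (X.submatrix (Subtype.val : zeroRows (shift m s) → Fin (m + s)) id)
      (fun i : (Set.univ : Set (Fin m)) => ⟨Fin.castAdd s i.1, (mem_zeroRows_shift _).2 i.1.2⟩) id

theorem topRows_appendRows {m s k : ℕ} (A : Matrix (Fin m) (Fin k) ℝ)
    (E : Matrix (Fin s) (Fin k) ℝ) : topRows (appendRows A E) = A := by
  ext i j
  simp [topRows]

theorem sameRankOn_shift {m s k : ℕ} {X : Matrix (Fin m) (Fin k) ℝ}
    {Y : Matrix (Fin (m + s)) (Fin k) ℝ} (h : SameRankOn Set.univ X (topRows Y)) :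
    SameRankOn (zeroRows (shift m s)) (appendRows X 0) Y := by
  rw [SameRankOn, rank_submatrix_zeroRows_shift, rank_submatrix_zeroRows_shift, topRows_appendRows]
  exact h

theorem appendRows_eq {m n s : ℕ} (A : Matrix (Fin m) (Fin n) ℝ) (E : Matrix (Fin s) (Fin n) ℝ) :
    appendRows A E = appendRows A 0 + shift m s * Eᵀᵀ := by
  rw [Matrix.transpose_transpose, shift, appendRows_mul, Matrix.zero_mul, Matrix.one_mul]
  ext i j
  refine Fin.addCases (fun i => ?_) (fun i => ?_) i <;> simp

/-- The transpose of `appendRows_eq`. -/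
theorem appendCols_eq {m n s : ℕ} (A : Matrix (Fin m) (Fin n) ℝ) (E : Matrix (Fin m) (Fin s) ℝ) :
    appendCols A E = (appendRows Aᵀ 0)ᵀ + E * (shift n s)ᵀ := by
  have := congrArg Matrix.transpose (appendRows_eq Aᵀ Eᵀ)
  rw [Matrix.transpose_add, Matrix.transpose_mul, Matrix.transpose_transpose,
    Matrix.transpose_transpose] at this
  rw [← this]
  ext i j
  refine Fin.addCases (fun j => ?_) (fun j => ?_) j <;> simp [appendCols]

/-! ### Padding the stored factors with zero rows -/

/-- Append zero rows to the left factor. -/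
def FiveFactor.padLeft {m n k : ℕ} (S : FiveFactor m n k) (s : ℕ) : FiveFactor (m + s) n k where
  U₁ := appendRows S.U₁ 0
  U₂ := S.U₂
  σ := S.σ
  V₁ := S.V₁
  V₂ := S.V₂
  left_orth := by
    rw [appendRows_mul, Matrix.zero_mul, appendRows_zero_gram, S.left_orth]
  right_orth := S.right_orth
  nonneg := S.nonneg
  sorted := S.sorted

/-- Append zero rows to the right factor. -/
def FiveFactor.padRight {m n k : ℕ} (S : FiveFactor m n k) (s : ℕ) : FiveFactor m (n + s) k where
  U₁ := S.U₁
  U₂ := S.U₂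
  σ := S.σ
  V₁ := appendRows S.V₁ 0
  V₂ := S.V₂
  left_orth := S.left_orth
  right_orth := by
    rw [appendRows_mul, Matrix.zero_mul, appendRows_zero_gram, S.right_orth]
  nonneg := S.nonneg
  sorted := S.sorted

theorem FiveFactor.padLeft_U {m n k : ℕ} (S : FiveFactor m n k) (s : ℕ) :
    (S.padLeft s).U = appendRows S.U 0 := by
  simp only [FiveFactor.U, FiveFactor.padLeft, appendRows_mul, Matrix.zero_mul]

theorem FiveFactor.padRight_V {m n k : ℕ} (S : FiveFactor m n k) (s : ℕ) :
    (S.padRight s).V = appendRows S.V 0 := by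
  simp only [FiveFactor.V, FiveFactor.padRight, appendRows_mul, Matrix.zero_mul]

theorem FiveFactor.padLeft_approx {m n k : ℕ} (S : FiveFactor m n k) (s : ℕ) :
    (S.padLeft s).approx = appendRows S.approx 0 := by
  rw [FiveFactor.approx, padLeft_U, appendRows_mul, appendRows_mul, Matrix.zero_mul,
    Matrix.zero_mul]
  rfl

theorem FiveFactor.padRight_approx {m n k : ℕ} (S : FiveFactor m n k) (s : ℕ) :
    (S.padRight s).approx = (appendRows S.approxᵀ 0)ᵀ := by
  rw [FiveFactor.approx, padRight_V, ← Matrix.transpose_transpose (_ * _ * _)]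
  congr 1
  rw [Matrix.transpose_mul, Matrix.transpose_transpose, appendRows_mul, Matrix.zero_mul,
    FiveFactor.approx]
  conv_rhs => rw [Matrix.transpose_mul, Matrix.transpose_transpose]
  rfl

/-! ### Programs for padding and for transposing the input -/

/-- Fill the integer arrays `r` and `c`. -/
def fillPairs (r c : ℕ) (n e f : IExp) : Prog :=
  forLoop 1000 n (.seq (.setInt r (.reg 1000) e) (.setInt c (.reg 1000) f))

/-- By `hv` and `hw` the two expressions depend only on the counter and on memory that the loop
leaves alone. Agreement is asked for off both arrays because `f` is evaluated after the first write.
-/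
theorem exec_fillPairs (O : SVDRoutine) (M : Mem) {r c x : ℕ} {e f : IExp} (hrc : r ≠ c)
    (hx : x < 1000) (he : e.cost ≤ 10) (hf : f.cost ≤ 10) {v w : ℕ → ℕ}
    (hv : ∀ (M' : Mem) t, (∀ x < 1000, M'.reg x = M.reg x) →
      (∀ a, a ≠ r → a ≠ c → M'.iarr a = M.iarr a) → M'.reg 1000 = t → e.eval M' = v t)
    (hw : ∀ (M' : Mem) t, (∀ x < 1000, M'.reg x = M.reg x) →
      (∀ a, a ≠ r → a ≠ c → M'.iarr a = M.iarr a) → M'.reg 1000 = t → f.eval M' = w t) :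
    ∃ M' t, Exec O (fillPairs r c (.reg x) e f) M M' t ∧ t ≤ 100 * (M.reg x + 1) ∧
      (∀ x < 1000, M'.reg x = M.reg x) ∧ (∀ a, a ≠ r → a ≠ c → M'.iarr a = M.iarr a) ∧
      M'.rarr = M.rarr ∧ ∀ t < M.reg x, M'.iarr r t = v t ∧ M'.iarr c t = w t := by
  obtain ⟨M', t, ex, ht, -, h1, h2, h3, h4⟩ := exec_forLoop (O := O) (x := 1000) (n := .reg x)
    (body := .seq (.setInt r (.reg 1000) e) (.setInt c (.reg 1000) f)) (M := M) (M.reg x) 30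
    (fun n M' => (∀ x < 1000, M'.reg x = M.reg x) ∧ (∀ a, a ≠ r → a ≠ c → M'.iarr a = M.iarr a) ∧
      M'.rarr = M.rarr ∧ ∀ t < n, M'.iarr r t = v t ∧ M'.iarr c t = w t)
    ⟨fun y hy => Mem.setReg_reg_of_ne _ (by omega), fun _ _ _ => rfl, rfl, by simp⟩
    (fun n M' _ h => h.1 x hx)
    (by
      rintro t M' ht hr ⟨h1, h2, h3, h4⟩
      set M₁ := M'.setInt r t (v t) with hM₁
      have ex₁ : Exec O (.setInt r (.reg 1000) e) M' M₁ (1 + e.cost + 1) := by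
        have := Exec.setInt (O := O) M' r (.reg 1000) e
        rw [hv M' t h1 h2 hr] at this
        simpa only [IExp.eval, IExp.cost, hr] using this
      have i₁ : ∀ a, a ≠ r → a ≠ c → M₁.iarr a = M.iarr a := by
        intro a ha hc
        rw [← h2 a ha hc]
        ext j
        rw [hM₁, Mem.setInt_iarr, if_neg (by tauto)]
      set M₂ := M₁.setInt c t (w t) with hM₂
      have ex₂ : Exec O (.setInt c (.reg 1000) f) M₁ M₂ (1 + f.cost + 1) := by
        have := Exec.setInt (O := O) M₁ c (.reg 1000) f
        rw [hw M₁ t h1 i₁ hr] at this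
        simpa only [IExp.eval, IExp.cost, show M₁.reg 1000 = t from hr] using this
      refine ⟨M₂, _, .seq ex₁ ex₂, by omega, hr, ?_, ?_, h3, ?_⟩
      · intro y hy
        rw [Mem.setReg_reg_of_ne _ (by omega)]
        exact h1 y hy
      · intro a ha hc
        rw [← i₁ a ha hc]
        ext j
        rw [Mem.setReg_iarr, hM₂, Mem.setInt_iarr, if_neg (by tauto)]
      · intro t' ht'
        simp only [Mem.setReg_iarr, hM₂, hM₁, Mem.setInt_iarr, hrc, hrc.symm, true_and, false_and,
          if_false]
        rcases Nat.lt_succ_iff_lt_or_eq.1 ht' with h | h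
        · rw [if_neg (by omega), if_neg (by omega)]
          exact h4 t' h
        · simp [h])
  refine ⟨M', t, ex, ht.trans ?_, h1, h2, h3, h4⟩
  simp only [IExp.cost]
  gcongr
  omega

/-- Append `s` zero rows to the tall factor in the array `u₁`, whose number of rows is in
the register `mr`, and store the matrix `shift m s` in coordinate format. -/
def pad (u₁ mr len row col val : ℕ) : Prog :=
  .seq (tabulate u₁ (.add (.reg mr) (.reg 1000)) (.reg 1001) (.reg 3) (.reg 2) (.lit 0)
    .zero .zero) <|
  .seq (fill val (.lit 1) (.reg 3) (.lit 0) .one .zero) <|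
  .seq (fillPairs row col (.reg 3) (.add (.reg mr) (.reg 1000)) (.reg 1000)) <|
  .seq (.setReg len (.reg 3)) (.setReg mr (.add (.reg mr) (.reg 3)))

/-- The old rows stay where they are, so only the `s` new rows are paid for. Entry `t` of the list
for `shift m s` sits at `(m + t, t)`; the row count in `mr` is raised last, since the earlier steps
use its old value. -/
theorem exec_pad (O : SVDRoutine) (M : Mem) {u₁ mr len row col val : ℕ} (hmr : mr < 1000)
    (hml : mr ≠ len) (hl3 : len ≠ 3) (hrc : row ≠ col) (huv : u₁ ≠ val) {m k s z : ℕ} (hk : 0 < k) (hm : M.reg mr = m)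
    (h2 : M.reg 2 = k) (h3 : M.reg 3 = s) :
    ∃ M' t, Exec O (pad u₁ mr len row col val) M M' t ∧
      t ≤ 5000 * ((z + (k + s)) * (k + s) ^ 2) ∧
      (∀ x < 1000, x ≠ mr → x ≠ len → M'.reg x = M.reg x) ∧ M'.reg mr = m + s ∧
      (∀ a, a ≠ row → a ≠ col → M'.iarr a = M.iarr a) ∧
      (∀ a, a ≠ u₁ → a ≠ val → M'.rarr a = M.rarr a) ∧
      M'.block u₁ (m + s) k = appendRows (M.block u₁ m k) 0 ∧
      GivenSparse M' len row col val (shift m s) := by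
  have hN : 1 ≤ k + s := by omega
  obtain ⟨M₁, t₁, ex₁, ht₁, s₁, v₁, u₁'⟩ := exec_tabulate O M u₁ (.add (.reg mr) (.reg 1000))
    (.reg 1001) (.reg 3) (.reg 2) (.lit 0) .zero .zero (by simp [IExp.Below]; omega)
    (by simp [IExp.Below]) (by simp [IExp.Below]) (by simp [IExp.Below]) trivial trivial trivial
    (by
      intro i _ j _ i' _ j' _ h1 h2
      simp only [IExp.eval, Mem.counters_reg_fst, Mem.counters_reg_snd,
        Mem.counters_reg_of_lt _ hmr] at h1 h2
      omega) 100 (by simp [tabulateCost, IExp.cost, RExp.cost])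
  simp only [RExp.eval, IExp.eval, Mem.counters_reg_fst, Mem.counters_reg_snd,
        Mem.counters_reg_of_lt _ hmr, hm, h2, h3, Finset.range_zero, Finset.sum_empty,
        add_zero] at ht₁ v₁ u₁'
  have r1_3 : M₁.reg 3 = s := by rw [s₁.reg (by omega), h3]
  obtain ⟨M₂, t₂, ex₂, ht₂, s₂, v₂, -⟩ := exec_fill O M₁ val (.lit 1) (.reg 3) (.lit 0)
    .one .zero (P := 1) (R := 0) rfl r1_3 rfl trivial (by simp [IExp.Below]) trivial trivial trivial
    (by simp [tabulateCost, IExp.cost, RExp.cost])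
  have r2_3 : M₂.reg 3 = s := by rw [s₂.reg (by omega), r1_3]
  have r2_m : M₂.reg mr = m := by rw [s₂.reg hmr, s₁.reg hmr, hm]
  obtain ⟨M₃, t₃, ex₃, ht₃, reg₃, ia₃, ra₃, v₃⟩ := exec_fillPairs O M₂ (r := row) (c := col) (x := 3)
    (e := .add (.reg mr) (.reg 1000)) (f := .reg 1000) hrc (by omega) (by simp [IExp.cost])
    (by simp [IExp.cost]) (v := fun t => m + t) (w := fun t => t)
    (by
      intro M' t h _ ht
      simp only [IExp.eval, ht, h mr hmr, r2_m])
    (by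
      intro M' t h _ ht
      simp only [IExp.eval, ht])
  rw [r2_3] at ht₃ v₃
  set M₄ := M₃.setReg len s with hM₄
  have ex₄ : Exec O (.setReg len (.reg 3)) M₃ M₄ 2 := by
    have := Exec.setReg (O := O) M₃ len (.reg 3)
    simpa [IExp.eval, IExp.cost, reg₃ 3 (by omega), r2_3] using this
  set M₅ := M₄.setReg mr (m + s) with hM₅
  have ex₅ : Exec O (.setReg mr (.add (.reg mr) (.reg 3))) M₄ M₅ 4 := by
    have := Exec.setReg (O := O) M₄ mr (.add (.reg mr) (.reg 3))
    have e1 : M₄.reg mr = m := by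
      rw [hM₄, Mem.setReg_reg_of_ne _ hml, reg₃ mr hmr, r2_m]
    have e2 : M₄.reg 3 = s := by
      rw [hM₄, Mem.setReg_reg_of_ne _ hl3.symm, reg₃ 3 (by omega), r2_3]
    simpa [IExp.eval, IExp.cost, e1, e2] using this
  have ra₅ : M₅.rarr = M₂.rarr := ra₃
  have ia₅ : M₅.iarr = M₃.iarr := rfl
  have r5_len : M₅.reg len = s := by
    rw [hM₅, Mem.setReg_reg_of_ne _ hml.symm, hM₄, Mem.setReg_reg_self]
  refine ⟨M₅, _, .seq ex₁ (.seq ex₂ (.seq ex₃ (.seq ex₄ ex₅))), ?_, ?_, ?_, ?_, ?_, ?_, ?_⟩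
  · have b0 := le_cost (z := z) hN
    have b1 := cost_bound (z := z) (P := s) (Q := k) (R := 0) hN (by omega) (by omega) (by omega)
    have b2 := cost_bound (z := z) (P := 1) (Q := s) (R := 0) hN (by omega) (by omega) (by omega)
    omega
  · intro x hx h1 h2
    rw [hM₅, Mem.setReg_reg_of_ne _ h1, hM₄, Mem.setReg_reg_of_ne _ h2, reg₃ x hx, s₂.reg hx,
      s₁.reg hx]
  · rw [hM₅, Mem.setReg_reg_self]
  · intro a h1 h2
    rw [ia₅, ia₃ a h1 h2, s₂.iarr, s₁.iarr]
  · intro a h1 h2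
    rw [ra₅, s₂.rarr h2, s₁.rarr h1]
  · ext i j
    simp only [Mem.block, Matrix.of_apply, ra₅]
    rw [s₂.rarr huv]
    refine Fin.addCases (fun i => ?_) (fun i => ?_) i
    · rw [u₁']
      · simp
      · rintro a ha b hb ⟨h, -⟩
        have := i.2
        simp only [Fin.val_castAdd] at h
        omega
    · rw [Fin.val_natAdd, v₁ i i.2 j j.2]
      simp
  · rw [GivenSparse, r5_len]
    let e : Fin s → {x : Fin (m + s) × Fin s // shift m s x.1 x.2 ≠ 0} := fun t =>
      ⟨(Fin.natAdd m t, t), by simp [shift_apply]⟩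
    refine ⟨Equiv.ofBijective e ⟨?_, ?_⟩, ?_⟩
    · intro a b h
      simpa [e] using h
    · rintro ⟨⟨i, j⟩, hij⟩
      refine ⟨j, ?_⟩
      simp only [shift_apply, ne_eq, ite_eq_right_iff, one_ne_zero, imp_false, not_not] at hij
      simp [e, Fin.ext_iff, hij]
    · intro t
      obtain ⟨h1, h2⟩ := v₃ t t.2
      refine ⟨?_, ?_, ?_⟩
      · rw [ia₅, h1]; rfl
      · rw [ia₅, h2]; rfl
      · rw [ra₅, v₂ 0 (by omega) t t.2]
        change _ = shift m s (Fin.natAdd m t) t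
        simp [RExp.eval, shift_apply]

/-- Store the transpose of the first sparse matrix as the second one. -/
def transposeInput : Prog :=
  .seq (fill 6 (.lit 1) (.reg 4) (.lit 0) (.arr 5 (.lit 0) (.reg 1001)) .zero) <|
  .seq (fillPairs 2 3 (.reg 4) (.arr 1 (.reg 1000)) (.arr 0 (.reg 1000))) (.setReg 5 (.reg 4))

/-- The row and column arrays exchange roles. The copy frees the first input slot, which
`addRowsProg` then fills with `shift m s`. -/
theorem exec_transposeInput (O : SVDRoutine) (M : Mem) {p q : ℕ} {E : Matrix (Fin p) (Fin q) ℝ}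
    (hE : GivenSparse M 4 0 1 5 E) :
    ∃ M' t, Exec O transposeInput M M' t ∧ t ≤ 1000 * (M.reg 4 + 1) ∧
      (∀ x < 1000, x ≠ 5 → M'.reg x = M.reg x) ∧ (∀ a, a ≠ 6 → M'.rarr a = M.rarr a) ∧
      GivenSparse M' 5 2 3 6 Eᵀ := by
  obtain ⟨z, hz⟩ : ∃ z, M.reg 4 = z := ⟨_, rfl⟩
  rw [GivenSparse, hz] at hE
  rw [hz]
  obtain ⟨e, he⟩ := hE
  obtain ⟨M₁, t₁, ex₁, ht₁, s₁, v₁, -⟩ := exec_fill O M 6 (.lit 1) (.reg 4) (.lit 0)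
    (.arr 5 (.lit 0) (.reg 1001)) .zero (P := 1) (R := 0) rfl hz rfl trivial (by simp [IExp.Below])
    trivial (by simp [RExp.Avoids, IExp.Below]) trivial
    (by simp [tabulateCost, IExp.cost, RExp.cost])
  obtain ⟨M₂, t₂, ex₂, ht₂, reg₂, ia₂, ra₂, v₂⟩ := exec_fillPairs O M₁ (r := 2) (c := 3) (x := 4)
    (e := .arr 1 (.reg 1000)) (f := .arr 0 (.reg 1000)) (by omega) (by omega) (by simp [IExp.cost])
    (by simp [IExp.cost]) (v := M.iarr 1) (w := M.iarr 0)
    (by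
      intro M' t _ h ht
      simp only [IExp.eval, ht, h 1 (by omega) (by omega), s₁.iarr])
    (by
      intro M' t _ h ht
      simp only [IExp.eval, ht, h 0 (by omega) (by omega), s₁.iarr])
  rw [s₁.reg (by omega), hz] at ht₂ v₂
  have r2_4 : M₂.reg 4 = z := by rw [reg₂ 4 (by omega), s₁.reg (by omega), hz]
  have ex₃ : Exec O (.setReg 5 (.reg 4)) M₂ (M₂.setReg 5 z) 2 := by
    have := Exec.setReg (O := O) M₂ 5 (.reg 4)
    simpa [IExp.eval, IExp.cost, r2_4] using this
  refine ⟨M₂.setReg 5 z, _, .seq ex₁ (.seq ex₂ ex₃), by omega, ?_, ?_, ?_⟩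
  · intro x hx h5
    rw [Mem.setReg_reg_of_ne _ h5, reg₂ x hx, s₁.reg hx]
  · intro a ha
    rw [Mem.setReg_rarr, ra₂, s₁.rarr ha]
  · rw [GivenSparse, Mem.setReg_reg_self]
    refine ⟨e.trans ⟨fun x => ⟨(x.1.2, x.1.1), x.2⟩, fun x => ⟨(x.1.2, x.1.1), x.2⟩, fun _ => rfl,
      fun _ => rfl⟩, fun t => ?_⟩
    obtain ⟨h1, h2⟩ := v₂ t t.2
    obtain ⟨h3, h4, h5⟩ := he t
    refine ⟨?_, ?_, ?_⟩
    · rw [Mem.setReg_iarr, h1, h4]; rfl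
    · rw [Mem.setReg_iarr, h2, h3]; rfl
    · rw [Mem.setReg_rarr, ra₂, v₁ 0 (by omega) t t.2]
      simp only [RExp.eval, IExp.eval, Mem.counters_rarr, Mem.counters_reg_snd, Finset.range_zero,
        Finset.sum_empty, add_zero, h5]
      rfl

/-- Addition of rows. -/
def addRowsProg : Prog :=
  .seq transposeInput (.seq (pad 0 0 4 0 1 5) updateWeightsProg)

/-- Addition of columns. -/
def addColsProg : Prog := .seq (pad 3 1 5 2 3 6) updateWeightsProg

/-- The new matrix is the padded `Ã` plus `shift m s * E`, a weight update with left factor `shift m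
s` and right factor `Eᵀ`. Its untouched rows on the left are all the old ones. -/
theorem exec_addRows {O : SVDRoutine} (hO : O.Correct) {m n k : ℕ} (hk : 0 < k)
    (S : FiveFactor m n k) (M : Mem) (hS : Stores M S) {s : ℕ} (E : Matrix (Fin s) (Fin n) ℝ)
    (hin : Input₁ M s E) :
    ∃ (S' : FiveFactor (m + s) n k) (M' : Mem) (t : ℕ),
      Exec O addRowsProg M M' t ∧ Stores M' S' ∧
      IsTruncSVD k (appendRows S.approx E) S'.U S'.σ S'.V ∧
      (SameRankOn Set.univ S.U (topRows S'.U) → SameRankOn (zeroRows Eᵀ) S.V S'.V →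
        t ≤ 300000 * (nnz E * (s + k) ^ 2 + (s + k) ^ 3)) := by
  obtain ⟨h3, hE⟩ := hin
  have hz := hE.reg_eq_nnz
  obtain ⟨M₁, t₁, ex₁, ht₁, reg₁, ra₁, g₁⟩ := exec_transposeInput O M hE
  obtain ⟨M₂, t₂, ex₂, ht₂, reg₂, m₂, ia₂, ra₂, b₂, g₂⟩ := exec_pad O M₁ (u₁ := 0) (mr := 0)
    (len := 4) (row := 0) (col := 1) (val := 5) (m := m) (k := k) (s := s) (z := nnz E) (by omega)
    (by omega) (by omega) (by omega) (by omega) hk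
    (by rw [reg₁ _ (by omega) (by omega), hS.rows]) (by rw [reg₁ _ (by omega) (by omega), hS.rank])
    (by rw [reg₁ _ (by omega) (by omega), h3])
  have fb : ∀ a p q, a ≠ 0 → a < 5 → M₂.block a p q = M.block a p q := by
    intro a p q h1 h2
    simp only [Mem.block, ra₂ a h1 (by omega), ra₁ a (by omega)]
  have hS₂ : Stores M₂ (S.padLeft s) := by
    refine ⟨m₂, ?_, ?_, ?_, ?_, ?_, ?_, ?_⟩
    · rw [reg₂ _ (by omega) (by omega) (by omega), reg₁ _ (by omega) (by omega), hS.cols]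
    · rw [reg₂ _ (by omega) (by omega) (by omega), reg₁ _ (by omega) (by omega), hS.rank]
    · rw [b₂]
      have : M₁.block 0 m k = S.U₁ := by
        rw [← hS.U₁]; simp only [Mem.block, ra₁ 0 (by omega)]
      rw [this]
      rfl
    · exact (fb _ _ _ (by omega) (by omega)).trans hS.U₂
    · rw [ra₂ _ (by omega) (by omega), ra₁ _ (by omega), hS.σ]
      rfl
    · exact (fb _ _ _ (by omega) (by omega)).trans hS.V₁
    · exact (fb _ _ _ (by omega) (by omega)).trans hS.V₂
  have hin₂ : Input₂ M₂ s (shift m s) Eᵀ := by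
    refine ⟨⟨?_, g₂⟩, g₁.congr ?_ ?_ ?_ ?_⟩
    · rw [reg₂ _ (by omega) (by omega) (by omega), reg₁ _ (by omega) (by omega), h3]
    · exact reg₂ _ (by omega) (by omega) (by omega)
    · exact ia₂ _ (by omega) (by omega)
    · exact ia₂ _ (by omega) (by omega)
    · exact ra₂ _ (by omega) (by omega)
  obtain ⟨S', M₃, t₃, ex₃, hS₃, svd₃, ht₃⟩ := exec_updateWeights hO hk (S.padLeft s) M₂ hS₂ _ _ hin₂
  refine ⟨S', M₃, _, .seq ex₁ (.seq ex₂ ex₃), hS₃, ?_, ?_⟩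
  · rw [appendRows_eq, ← FiveFactor.padLeft_approx]
    exact svd₃
  · intro hA hB
    have h4 := ht₃ (by rw [FiveFactor.padLeft_U]; exact sameRankOn_shift hA) hB
    rw [nnz_transpose] at h4
    have n1 := nnz_shift_le m s
    -- The at most `s` entries of `shift` cost no more than the cubic term, so the bound at most
    -- doubles.
    have n2 : (nnz (shift m s) + nnz E) * (s + k) ^ 2 + (s + k) ^ 3 ≤
        2 * (nnz E * (s + k) ^ 2 + (s + k) ^ 3) := by
      calc (nnz (shift m s) + nnz E) * (s + k) ^ 2 + (s + k) ^ 3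
          ≤ (s + k + nnz E) * (s + k) ^ 2 + (s + k) ^ 3 := by gcongr; omega
        _ = nnz E * (s + k) ^ 2 + 2 * (s + k) ^ 3 := by ring
        _ ≤ _ := by omega
    have n3 := le_cost (z := nnz E) (N := k + s) (by omega)
    have e : nnz E * (s + k) ^ 2 + (s + k) ^ 3 = (nnz E + (k + s)) * (k + s) ^ 2 := by ring
    rw [e] at n2 ⊢
    omega

/-- The mirror image of adding rows, but `E` already is the left factor in the first input slot, so
no transposition is needed. -/
theorem exec_addCols {O : SVDRoutine} (hO : O.Correct) {m n k : ℕ} (hk : 0 < k)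
    (S : FiveFactor m n k) (M : Mem) (hS : Stores M S) {s : ℕ} (E : Matrix (Fin m) (Fin s) ℝ)
    (hin : Input₁ M s E) :
    ∃ (S' : FiveFactor m (n + s) k) (M' : Mem) (t : ℕ),
      Exec O addColsProg M M' t ∧ Stores M' S' ∧
      IsTruncSVD k (appendCols S.approx E) S'.U S'.σ S'.V ∧
      (SameRankOn (zeroRows E) S.U S'.U → SameRankOn Set.univ S.V (topRows S'.V) →
        t ≤ 300000 * (nnz E * (s + k) ^ 2 + (s + k) ^ 3)) := by
  obtain ⟨h3, hE⟩ := hin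
  obtain ⟨M₂, t₂, ex₂, ht₂, reg₂, m₂, ia₂, ra₂, b₂, g₂⟩ := exec_pad O M (u₁ := 3) (mr := 1)
    (len := 5) (row := 2) (col := 3) (val := 6) (m := n) (k := k) (s := s) (z := nnz E) (by omega)
    (by omega) (by omega) (by omega) (by omega) hk hS.cols hS.rank h3
  have fb : ∀ a p q, a ≠ 3 → a < 5 → M₂.block a p q = M.block a p q := by
    intro a p q h1 h2
    simp only [Mem.block, ra₂ a h1 (by omega)]
  have hS₂ : Stores M₂ (S.padRight s) := by
    refine ⟨?_, m₂, ?_, ?_, ?_, ?_, ?_, ?_⟩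
    · rw [reg₂ _ (by omega) (by omega) (by omega), hS.rows]
    · rw [reg₂ _ (by omega) (by omega) (by omega), hS.rank]
    · exact (fb _ _ _ (by omega) (by omega)).trans hS.U₁
    · exact (fb _ _ _ (by omega) (by omega)).trans hS.U₂
    · rw [ra₂ _ (by omega) (by omega), hS.σ]
      rfl
    · rw [b₂, hS.V₁]
      rfl
    · exact (fb _ _ _ (by omega) (by omega)).trans hS.V₂
  have hin₂ : Input₂ M₂ s E (shift n s) := by
    refine ⟨⟨?_, hE.congr ?_ ?_ ?_ ?_⟩, g₂⟩
    · rw [reg₂ _ (by omega) (by omega) (by omega), h3]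
    · exact reg₂ _ (by omega) (by omega) (by omega)
    · exact ia₂ _ (by omega) (by omega)
    · exact ia₂ _ (by omega) (by omega)
    · exact ra₂ _ (by omega) (by omega)
  obtain ⟨S', M₃, t₃, ex₃, hS₃, svd₃, ht₃⟩ :=
    exec_updateWeights hO hk (S.padRight s) M₂ hS₂ _ _ hin₂
  refine ⟨S', M₃, _, .seq ex₂ ex₃, hS₃, ?_, ?_⟩
  · rw [appendCols_eq, ← FiveFactor.padRight_approx]
    exact svd₃
  · intro hA hB
    have h4 := ht₃ hA (by rw [FiveFactor.padRight_V]; exact sameRankOn_shift hB)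
    have n1 := nnz_shift_le n s
    have n2 : (nnz E + nnz (shift n s)) * (s + k) ^ 2 + (s + k) ^ 3 ≤
        2 * (nnz E * (s + k) ^ 2 + (s + k) ^ 3) := by
      calc (nnz E + nnz (shift n s)) * (s + k) ^ 2 + (s + k) ^ 3
          ≤ (nnz E + (s + k)) * (s + k) ^ 2 + (s + k) ^ 3 := by gcongr; omega
        _ = nnz E * (s + k) ^ 2 + 2 * (s + k) ^ 3 := by ring
        _ ≤ _ := by omega
    have e : nnz E * (s + k) ^ 2 + (s + k) ^ 3 = (nnz E + (k + s)) * (k + s) ^ 2 := by ring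
    rw [e] at n2 ⊢
    omega

/-! ### Queries -/

/-- Row `i` of the product of the arrays `u₁` and `u₂`, with `i` in register `6`, and the singular
values. -/
def queryProg (u₁ u₂ : ℕ) : Prog :=
  .seq (fill 7 (.lit 1) (.reg 2) (.reg 2) .zero
    (.mul (.arr u₁ (.reg 6) (.reg 1002)) (.arr u₂ (.reg 1002) (.reg 1001)))) <|
  fill 8 (.lit 1) (.reg 2) (.lit 0) (.arr 2 (.lit 0) (.reg 1001)) .zero

/-- One row of the tall factor is multiplied by the small one. The outputs go to arrays `7` and `8`,
away from the stored factors. -/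
theorem exec_query (O : SVDRoutine) {m n k p : ℕ} (hk : 0 < k) (S : FiveFactor m n k) (M : Mem)
    (hS : Stores M S) {u₁ u₂ : ℕ} (hu₁ : u₁ < 7) (hu₂ : u₂ < 7) (i : Fin p) (hi : M.reg 6 = i) :
    ∃ (M' : Mem) (t : ℕ), Exec O (queryProg u₁ u₂) M M' t ∧ Stores M' S ∧
      Output M' ((M.block u₁ p k * M.block u₂ k k) i) S.σ ∧ t ≤ 300000 * k ^ 2 := by
  obtain ⟨M₁, t₁, ex₁, ht₁, s₁, v₁, -⟩ := exec_fill O M 7 (.lit 1) (.reg 2) (.reg 2) .zero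
    (.mul (.arr u₁ (.reg 6) (.reg 1002)) (.arr u₂ (.reg 1002) (.reg 1001))) (P := 1) rfl hS.rank
    hS.rank trivial (by simp [IExp.Below]) (by simp [IExp.Below]) trivial
    (by simp [RExp.Avoids, IExp.Below]; omega) (by simp [tabulateCost, IExp.cost, RExp.cost])
  have r1_2 : M₁.reg 2 = k := by rw [s₁.reg (by omega), hS.rank]
  obtain ⟨M₂, t₂, ex₂, ht₂, s₂, v₂, -⟩ := exec_fill O M₁ 8 (.lit 1) (.reg 2) (.lit 0)
    (.arr 2 (.lit 0) (.reg 1001)) .zero (P := 1) (R := 0) rfl r1_2 rfl trivial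
    (by simp [IExp.Below]) trivial (by simp [RExp.Avoids, IExp.Below]) trivial
    (by simp [tabulateCost, IExp.cost, RExp.cost])
  have fb : ∀ a p q, a < 7 → M₂.block a p q = M.block a p q := by
    intro a p q ha
    rw [s₂.block (by omega), s₁.block (by omega)]
  refine ⟨M₂, _, .seq ex₁ ex₂, ⟨?_, ?_, ?_, ?_, ?_, ?_, ?_, ?_⟩, ⟨?_, ?_⟩, ?_⟩
  · rw [s₂.reg (by omega), s₁.reg (by omega), hS.rows]
  · rw [s₂.reg (by omega), s₁.reg (by omega), hS.cols]
  · rw [s₂.reg (by omega), r1_2]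
  · exact (fb _ _ _ (by omega)).trans hS.U₁
  · exact (fb _ _ _ (by omega)).trans hS.U₂
  · rw [s₂.rarr (by omega), s₁.rarr (by omega), hS.σ]
  · exact (fb _ _ _ (by omega)).trans hS.V₁
  · exact (fb _ _ _ (by omega)).trans hS.V₂
  · intro j
    rw [s₂.rarr (by omega), v₁ 0 (by omega) j j.2, Finset.sum_range, Matrix.mul_apply]
    simp [RExp.eval, IExp.eval, Mem.counters_reg, hi, Mem.block]
  · intro j
    rw [v₂ 0 (by omega) j j.2, ← hS.σ]
    simp only [RExp.eval, IExp.eval, Mem.counters_rarr, Mem.counters_reg_snd, Finset.range_zero,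
        Finset.sum_empty, add_zero]
    rw [s₁.rarr (by omega)]
    rfl
  -- Since `0 < k`, the loop overheads are absorbed into multiples of `k ^ 2`.
  · have b1 : (k + 1) * (k + 1) ≤ 4 * k ^ 2 := by nlinarith
    have b2 : k + 1 ≤ 2 * k ^ 2 := by nlinarith
    nlinarith

end TruncSVD

open TruncSVD
theorem theorem1 :
    ∃ (addRows addCols updateWeights queryLeft queryRight : Prog) (C : ℕ),
      ∀ O : SVDRoutine, O.Correct → ∀ m n k : ℕ, 0 < k →
        -- initialization with `U'' = V'' = 1`
        (∀ (A : Matrix (Fin m) (Fin n) ℝ) (U : Matrix (Fin m) (Fin k) ℝ) (σ : Fin k → ℝ)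
            (V : Matrix (Fin n) (Fin k) ℝ), IsTruncSVD k A U σ V →
          ∃ (S : FiveFactor m n k) (M : Mem), Stores M S ∧
            S.U₁ = U ∧ S.U₂ = 1 ∧ S.σ = σ ∧ S.V₁ = V ∧ S.V₂ = 1) ∧
        ∀ (S : FiveFactor m n k) (M : Mem), Stores M S →
          -- add rows
          (∀ (s : ℕ) (E : Matrix (Fin s) (Fin n) ℝ), Input₁ M s E →
            ∃ (S' : FiveFactor (m + s) n k) (M' : Mem) (t : ℕ),
              Exec O addRows M M' t ∧ Stores M' S' ∧
              IsTruncSVD k (appendRows S.approx E) S'.U S'.σ S'.V ∧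
              (SameRankOn Set.univ S.U (topRows S'.U) → SameRankOn (zeroRows Eᵀ) S.V S'.V →
                t ≤ C * (nnz E * (s + k) ^ 2 + (s + k) ^ 3))) ∧
          -- add columns
          (∀ (s : ℕ) (E : Matrix (Fin m) (Fin s) ℝ), Input₁ M s E →
            ∃ (S' : FiveFactor m (n + s) k) (M' : Mem) (t : ℕ),
              Exec O addCols M M' t ∧ Stores M' S' ∧
              IsTruncSVD k (appendCols S.approx E) S'.U S'.σ S'.V ∧
              (SameRankOn (zeroRows E) S.U S'.U → SameRankOn Set.univ S.V (topRows S'.V) →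
                t ≤ C * (nnz E * (s + k) ^ 2 + (s + k) ^ 3))) ∧
          -- update weights
          (∀ (s : ℕ) (D : Matrix (Fin m) (Fin s) ℝ) (E : Matrix (Fin n) (Fin s) ℝ),
            Input₂ M s D E →
            ∃ (S' : FiveFactor m n k) (M' : Mem) (t : ℕ),
              Exec O updateWeights M M' t ∧ Stores M' S' ∧
              IsTruncSVD k (S.approx + D * Eᵀ) S'.U S'.σ S'.V ∧
              (SameRankOn (zeroRows D) S.U S'.U → SameRankOn (zeroRows E) S.V S'.V →
                t ≤ C * ((nnz D + nnz E) * (s + k) ^ 2 + (s + k) ^ 3))) ∧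
          -- query a row of `U_k`, whose index is in register `6`
          (∀ i : Fin m, M.reg 6 = i →
            ∃ (M' : Mem) (t : ℕ), Exec O queryLeft M M' t ∧ Stores M' S ∧
              Output M' (S.U i) S.σ ∧ t ≤ C * k ^ 2) ∧
          -- query a row of `V_k`, whose index is in register `6`
          (∀ i : Fin n, M.reg 6 = i →
            ∃ (M' : Mem) (t : ℕ), Exec O queryRight M M' t ∧ Stores M' S ∧
              Output M' (S.V i) S.σ ∧ t ≤ C * k ^ 2) := by
  refine ⟨addRowsProg, addColsProg, updateWeightsProg, queryProg 0 1, queryProg 3 4, 300000, ?_⟩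
  intro O hO m n k hk
  refine ⟨?_, ?_⟩
  · intro A U σ V h
    refine ⟨⟨U, 1, σ, V, 1, by rw [Matrix.mul_one, h.left_orth], by rw [Matrix.mul_one, h.right_orth],
      h.nonneg, h.antitone⟩, ?_⟩
    -- The last case puts the identity into arrays `1` and `4`, and harmlessly into all unused ones.
    let arrays : ℕ → ℕ → ℕ → ℝ := fun a i j =>
      if a = 0 then (if h : i < m ∧ j < k then U ⟨i, h.1⟩ ⟨j, h.2⟩ else 0)
      else if a = 2 then (if h : j < k then σ ⟨j, h⟩ else 0)
      else if a = 3 then (if h : i < n ∧ j < k then V ⟨i, h.1⟩ ⟨j, h.2⟩ else 0)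
      else if i = j then 1 else 0
    refine ⟨⟨fun x => if x = 0 then m else if x = 1 then n else k, fun _ _ => 0, arrays⟩,
      ⟨rfl, rfl, rfl, ?_, ?_, ?_, ?_, ?_⟩, rfl, rfl, rfl, rfl, rfl⟩
    · ext i j
      simp [Mem.block, arrays]
    · ext i j
      simp [Mem.block, arrays, Matrix.one_apply, Fin.ext_iff]
    · ext j
      simp [arrays]
    · ext i j
      simp [Mem.block, arrays]
    · ext i j
      simp [Mem.block, arrays, Matrix.one_apply, Fin.ext_iff]
  · intro S M hS
    refine ⟨fun s E hE => exec_addRows hO hk S M hS E hE, fun s E hE => exec_addCols hO hk S M hS E hE,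
      fun s D E h => ?_, fun i hi => ?_, fun i hi => ?_⟩
    · obtain ⟨S', M', t, h1, h2, h3, h4⟩ := exec_updateWeights hO hk S M hS D E h
      exact ⟨S', M', t, h1, h2, h3, fun a b => (h4 a b).trans (Nat.mul_le_mul_right _ (by norm_num))⟩
    · have := exec_query O hk S M hS (u₁ := 0) (u₂ := 1) (by omega) (by omega) i hi
      rw [hS.U₁, hS.U₂] at this
      exact this
    · have := exec_query O hk S M hS (u₁ := 3) (u₂ := 4) (by omega) (by omega) i hi
      rw [hS.V₁, hS.V₂] at this
      exact this
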